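/- Let $n\ge 0$ and let $E=\mathbb C^{2n}$ with basis $e_1,\dots,e_{2n}$ and the skew-symmetric form given by $(e_k,e_l)=\delta_{k+l,2n+1}$ for $1\le k\le n$. Let $pr_k:E\to E$ be the projection with $pr_ke_k=0$ and $pr_ke_l=e_l$ for $l\ne k$. The symplectic degenerate flag variety is $$SpF^a_{2n}=\{(V_1,\dots,V_n):\ V_k\subset E,\ \dim V_k=k,\ pr_{k+1}V_k\subset V_{k+1}\ (1\le k<n),\ V_n\text{ Lagrangian}\}.$$ Let $\mathcal I_{2n}$ be the set of collections $\mathbf I=(I_1,\dots,I_n)$ of subsets of $\{1,\dots,2n\}$ such that $|I_k|=k$, $I_k\subset I_{k+1}\cup\{k+1\}$ for $1\le k<n$, and $a\in I_n$ implies $2n+1-a\notin I_n$. For $1\le k\le n$ order $\{1,\dots,2n\}$ by $k+1<_k k+2<_k\dots<_k 2n<_k 1<_k\dots<_k k$. The cell $C(\mathbf I)\subset SpF^a_{2n}$ consists of the points $(V_1,\dots,V_n)$ of $SpF^a_{2n}$ such that every $V_k$ has a basis of the form $e_a+\sum_{b<_k a,\ b\notin I_k}x_{a,b}e_b$, $a\in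 I_k$, with $x_{a,b}\in\mathbb C$ (depending on $k$). A symmetric Dellac configuration $S\in SDC_{2n}$ is a set of marked boxes (points) of a tableau with $2n$ columns and $4n$ rows, where $(j,i)$ is the box in the $j$-th column from the left and the $i$-th row from the bottom, such that every row contains exactly one point, every column contains exactly two points, every point $(j,i)$ satisfies $j\le i\le 2n+j$, and $S$ is stable under the central reflection $R(j,i)=(2n+1-j,4n+1-i)$. An inversion of $S$ is a pair of points $((j,i),(j',i'))$ with $j<j'$ and $i>i'$. Two inversions $(p_1,p_1')$ and $(p_2,p_2')$ are identified if they are equal or $R(\{p_1,p_1'\})=\{p_2,p_2'\}$, and $\widetilde{inv}(S)$ is the number of classes of inversions. For $\mathbf I\in\mathcal I_{2n}$ let $S(\mathbf I)$ be the following set of boxes. For $1\le k\le n$ and $l\in I_k$ with $l=k$ or $l\notin I_{k-1}$ (where $I_0=\emptyset$) mark the box $(k,l)$ if $l>k$ and the box $(k,2n+l)$ if $l\le k$. Then, for every $1\le i\le n$ such that the $i$-th row is still empty, mark the box $(i,i)$. Finally, add the images under $R$ of all these marked boxes. Then for every $\mathbf I\in\mathcal I_{2n}$ the set $S(\mathbf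 I)$ belongs to $SDC_{2n}$, and $$\dim_{\mathbb C} C(\mathbf I)=\widetilde{inv}(S(\mathbf I)).$$ Moreover, the rational cohomology of $SpF^a_{2n}$ (in its Euclidean topology) is finite-dimensional in each degree, and the Poincaré polynomial of $SpF^a_{2n}$ is $$\sum_{p\ge0}\dim H^p(SpF^a_{2n};\mathbb Q)\,t^p=\sum_{S\in SDC_{2n}}q^{\widetilde{inv}(S)},\qquad q=t^2 .$$ -/

import Mathlib

/-! ### Rational cohomology and the Poincaré series of a topological space

The cohomology is that of Alexander–Spanier cochains: all functions on `(p+1)`-tuples of points,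
modulo those that vanish near the diagonal.  On a compact Hausdorff locally contractible space,
such as a complex projective variety with its Euclidean topology, it is the usual
(singular) rational cohomology. -/

namespace RatCoh

/-- `p`-cochains: arbitrary rational functions on `X^{p+1}`. -/
abbrev Cochain (X : Type) (p : ℕ) : Type := (Fin (p + 1) → X) → ℚ

/-- The coboundary `(δf)(x_0,…,x_{p+1}) = ∑ (-1)^i f(x_0,…,x̂_i,…,x_{p+1})`. -/
def coboundary (X : Type) (p : ℕ) : Cochain X p →ₗ[ℚ] Cochain X (p + 1) where
  toFun f := fun x => ∑ i : Fin (p + 2), (-1) ^ (i : ℕ) * f (fun j => x (i.succAbove j))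
  map_add' f g := by
    funext x
    simp [mul_add, Finset.sum_add_distrib]
  map_smul' c f := by
    funext x
    simp only [Pi.smul_apply, smul_eq_mul, RingHom.id_apply, Finset.mul_sum]
    exact Finset.sum_congr rfl fun i _ => by ring

/-- The cochains that vanish on all sufficiently small simplices, i.e. on `U^{p+1}` for all
members `U` of some open cover of `X`. -/
def locallyZero (X : Type) [TopologicalSpace X] (p : ℕ) : Submodule ℚ (Cochain X p) where
  carrier := {f | ∀ x : X, ∃ U ∈ nhds x, ∀ s : Fin (p + 1) → X, (∀ i, s i ∈ U) → f s = 0}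
  zero_mem' := fun _ => ⟨Set.univ, Filter.univ_mem, fun _ _ => rfl⟩
  add_mem' := by
    intro f g hf hg x
    obtain ⟨U, hU, hfU⟩ := hf x
    obtain ⟨V, hV, hgV⟩ := hg x
    refine ⟨U ∩ V, Filter.inter_mem hU hV, fun s hs => ?_⟩
    simp [hfU s fun i => (hs i).1, hgV s fun i => (hs i).2]
  smul_mem' := by
    intro c f hf x
    obtain ⟨U, hU, hfU⟩ := hf x
    exact ⟨U, hU, fun s hs => by simp [hfU s hs]⟩

/-- Cochains whose coboundary is locally zero. -/
def cocycles (X : Type) [TopologicalSpace X] (p : ℕ) : Submodule ℚ (Cochain X p) :=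
  (locallyZero X (p + 1)).comap (coboundary X p)

/-- Cochains that are coboundaries up to a locally zero cochain. -/
def coboundaries (X : Type) [TopologicalSpace X] : (p : ℕ) → Submodule ℚ (Cochain X p)
  | 0 => locallyZero X 0
  | p + 1 => locallyZero X (p + 1) ⊔ LinearMap.range (coboundary X p)

/-- The rational cohomology `H^p(X; ℚ)`. -/
abbrev H (X : Type) [TopologicalSpace X] (p : ℕ) : Type :=
  cocycles X p ⧸ (coboundaries X p).comap (cocycles X p).subtype

/-- The Poincaré series `∑_p dim H^p(X; ℚ) t^p`. -/
noncomputable def poincareSeries (X : Type) [TopologicalSpace X] : PowerSeries ℕ :=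
  PowerSeries.mk fun p => Module.finrank ℚ (H X p)

end RatCoh

/-! ### Symmetric Dellac configurations

Columns `1,…,N` (left to right) and rows `1,…,2N` (bottom to top) are numbered from `0` here. -/

namespace Dellac

/-- A box `(j, i)`: column `j`, row `i`. -/
abbrev Box (N : ℕ) : Type := Fin N × Fin (2 * N)

/-- Central reflection of the `N × 2N` tableau. -/
def reflect {N : ℕ} (p : Box N) : Box N := (p.1.rev, p.2.rev)

/-- Dellac configurations, as sets of marked boxes. -/
structure IsDellac {N : ℕ} (D : Finset (Box N)) : Prop where
  row : ∀ i : Fin (2 * N), ∃! j : Fin N, (j, i) ∈ D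
  col : ∀ j : Fin N, (D.filter fun p => p.1 = j).card = 2
  band : ∀ p ∈ D, (p.1 : ℕ) ≤ p.2 ∧ (p.2 : ℕ) ≤ N + p.1

/-- The set `SDC_N` of Dellac configurations that are invariant under the central reflection. -/
noncomputable def SDC (N : ℕ) : Finset (Finset (Box N)) :=
  open Classical in
  Finset.univ.filter fun D => IsDellac D ∧ ∀ p, p ∈ D ↔ reflect p ∈ D

/-- Inversions: pairs of points, the first strictly to the left of and strictly above
the second. -/
abbrev Inversion {N : ℕ} (D : Finset (Box N)) : Type :=
  {x : Box N × Box N // x.1 ∈ D ∧ x.2 ∈ D ∧ x.1.1 < x.2.1 ∧ x.2.2 < x.1.2}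

/-- The reflection carries the pair of points of one inversion onto that of the other. -/
def Symmetric {N : ℕ} (D : Finset (Box N)) (x y : Inversion D) : Prop :=
  ({reflect x.1.1, reflect x.1.2} : Set (Box N)) = {y.1.1, y.1.2}

/-- The number of classes of inversions modulo the central reflection. -/
noncomputable def invTilde {N : ℕ} (D : Finset (Box N)) : ℕ :=
  Nat.card (Quot (Symmetric D))

end Dellac

/-! ### The even symplectic degenerate flag variety

The basis vectors `e_1,…,e_{2n}` and the subspaces `V_1,…,V_n` are numbered from `0` here, so
`V k` has dimension `k + 1`, and `2n + 1 - a` becomes `Fin.rev a`. -/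

namespace SpFlag

abbrev E (n : ℕ) : Type := Fin (2 * n) → ℂ

/-- The index of `V_k` as the index of a basis vector. -/
abbrev idx {n : ℕ} (k : Fin n) : Fin (2 * n) := ⟨k, by omega⟩

/-- The skew-symmetric form with `(e_a, e_{2n+1-a}) = 1` for `a ≤ n`. -/
def form {n : ℕ} (x y : E n) : ℂ :=
  ∑ a : Fin (2 * n), (if (a : ℕ) < n then 1 else -1) * (x a * y a.rev)

/-- The projection killing the basis vector `e_a` and fixing the others. -/
def pr {n : ℕ} (a : Fin (2 * n)) : E n →ₗ[ℂ] E n where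
  toFun x := fun b => if b = a then 0 else x b
  map_add' x y := by
    funext b
    by_cases h : b = a <;> simp [h]
  map_smul' c x := by
    funext b
    by_cases h : b = a <;> simp [h]

/-- The product of Grassmannians `Gr(1,2n) × ⋯ × Gr(n,2n)`. -/
def GrProd (n : ℕ) : Type :=
  {V : Fin n → Submodule ℂ (E n) // ∀ k, Module.finrank ℂ (V k) = (k : ℕ) + 1}

/-- Tuples of frames: the `k`-th component is a basis of a subspace from the `k`-th
Grassmannian. -/
def Frames (n : ℕ) : Type :=
  {A : (k : Fin n) → Fin ((k : ℕ) + 1) → E n // ∀ k, LinearIndependent ℂ (A k)}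

/-- The quotient map from tuples of frames to tuples of subspaces. -/
def Frames.span {n : ℕ} (A : Frames n) : GrProd n :=
  ⟨fun k => Submodule.span ℂ (Set.range (A.1 k)), fun k => by
    rw [finrank_span_eq_card (A.2 k), Fintype.card_fin]⟩

/-- The Euclidean topology on the product of Grassmannians: the quotient topology from the
space of tuples of frames. -/
noncomputable instance (n : ℕ) : TopologicalSpace (GrProd n) :=
  TopologicalSpace.coinduced Frames.span
    (TopologicalSpace.induced (fun A : Frames n => A.1) Pi.topologicalSpace)

/-- The coordinates of a tuple of frames. -/
def Frames.coord {n : ℕ} (A : Frames n) : (Σ k : Fin n, Fin ((k : ℕ) + 1) × Fin (2 * n)) → ℂ :=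
  fun s => A.1 s.1 s.2.1 s.2.2

/-- The Zariski topology on tuples of frames, generated by the non-vanishing loci of
polynomials in the coordinates. -/
abbrev framesZariski (n : ℕ) : TopologicalSpace (Frames n) :=
  TopologicalSpace.generateFrom
    {U | ∃ p : MvPolynomial (Σ k : Fin n, Fin ((k : ℕ) + 1) × Fin (2 * n)) ℂ,
      U = {A | MvPolynomial.eval A.coord p ≠ 0}}

/-- The Zariski topology on the product of Grassmannians. -/
abbrev zariski (n : ℕ) : TopologicalSpace (GrProd n) :=
  TopologicalSpace.coinduced Frames.span (framesZariski n)

/-- The (complex) dimension of a subset of the product of Grassmannians: the Krull dimension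
for the Zariski topology. -/
noncomputable def dim {n : ℕ} (Z : Set (GrProd n)) : WithBot ℕ∞ :=
  @topologicalKrullDim Z (@instTopologicalSpaceSubtype (GrProd n) (· ∈ Z) (zariski n))

/-- The degenerate flag variety `SpF^a_{2n}`: `dim V_k = k`, `pr_{k+1} V_k ⊆ V_{k+1}`
and `V_n` is Lagrangian. -/
def SpF (n : ℕ) : Set (GrProd n) :=
  {V | (∀ k l : Fin n, (k : ℕ) + 1 = l → (V.1 k).map (pr (idx l)) ≤ V.1 l) ∧
    ∀ k : Fin n, (k : ℕ) + 1 = n → ∀ x ∈ V.1 k, ∀ y ∈ V.1 k, form x y = 0}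

/-- The set `𝓘_{2n}`. -/
structure IsIndex {n : ℕ} (I : Fin n → Finset (Fin (2 * n))) : Prop where
  card : ∀ k, (I k).card = (k : ℕ) + 1
  step : ∀ k l : Fin n, (k : ℕ) + 1 = l → I k ⊆ insert (idx l) (I l)
  lagrangian : ∀ k : Fin n, (k : ℕ) + 1 = n → ∀ a ∈ I k, a.rev ∉ I k

/-- The row in which the disk `[k:l]` is drawn; it is `l_k` in the numbering from `1`.
The order `<_k` on basis vectors, `k+1 <_k ⋯ <_k 2n <_k 1 <_k ⋯ <_k k`, is the order of
these rows. -/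
def height {n : ℕ} (k : Fin n) (l : Fin (2 * n)) : Fin (2 * (2 * n)) :=
  if (k : ℕ) < l then ⟨l, by omega⟩ else ⟨2 * n + l, by omega⟩

/-- The cell `C(𝐈)`: the points of `SpF^a_{2n}` such that each `V_k` has a basis of the form
`e_a + ∑_{b <_k a, b ∉ I_k} x_{a,b} e_b`, `a ∈ I_k`. -/
def cell {n : ℕ} (I : Fin n → Finset (Fin (2 * n))) : Set (GrProd n) :=
  {V | V ∈ SpF n ∧ ∀ k : Fin n, ∃ x : Fin (2 * n) → Fin (2 * n) → ℂ,
    V.1 k = Submodule.span ℂ {v | ∃ a ∈ I k, v = Pi.single a 1 +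
      ∑ b ∈ Finset.univ.filter (fun b => height k b < height k a ∧ b ∉ I k),
        x a b • Pi.single b 1}}

/-- `[k:l]` is an initiating disk: `l ∈ I_k`, and `l = k` or `l ∉ I_{k-1}` (with `I_0 = ∅`). -/
abbrev Initiating {n : ℕ} (I : Fin n → Finset (Fin (2 * n))) (k : Fin n) (l : Fin (2 * n)) :
    Prop :=
  l ∈ I k ∧ ((l : ℕ) = k ∨ ∀ j : Fin n, (j : ℕ) + 1 = k → l ∉ I j)

/-- The boxes of the initiating disks. -/
def initiatingBoxes {n : ℕ} (I : Fin n → Finset (Fin (2 * n))) : Finset (Dellac.Box (2 * n)) :=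
  Finset.univ.filter fun p => ∃ k l, Initiating I k l ∧ p = (idx k, height k l)

/-- The diagonal boxes `(i, i)`, `i ≤ n`, such that row `i` has no initiating disk. -/
def diagonalBoxes {n : ℕ} (I : Fin n → Finset (Fin (2 * n))) : Finset (Dellac.Box (2 * n)) :=
  Finset.univ.filter fun p => (p.1 : ℕ) < n ∧ (p.2 : ℕ) = p.1 ∧
    ∀ q ∈ initiatingBoxes I, q.2 ≠ p.2

/-- The configuration `S(𝐈)`: the boxes above, all in the first `n` columns, and their
images under the central reflection. -/
def config {n : ℕ} (I : Fin n → Finset (Fin (2 * n))) : Finset (Dellac.Box (2 * n)) :=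
  (initiatingBoxes I ∪ diagonalBoxes I) ∪
    (initiatingBoxes I ∪ diagonalBoxes I).image Dellac.reflect

end SpFlag

/-! A subspace of `E n` has a unique reduced echelon basis for each total order of the coordinates.
Reducing every `V k` for the order `hgt k` splits the variety into cells indexed by the leading
positions, and the incidence conditions force these to form an index collection (`isIndex_lead`). On
a cell the conditions are polynomial equations that can be solved from the last subspace downwards.
Isotropy pairs the entries of the last echelon matrix, so one entry of each pair determines the
other. The inclusion `pr V_k ⊆ V_{k+1}` determines the entries of `V_k` in all columns outside
`I_{k+1} ∪ {k+1}`. The remaining entries, singled out by `Free`, are arbitrary (`IsCoords.vec_eq`,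
`exists_isCoords`). So a cell is an affine space, by maps that are polynomial one way and quotients
of polynomials the other way (`cellEquiv`). The Nullstellensatz and the Krull dimension of
polynomial rings then give its dimension.

For the cohomology, the cells are ordered by the total height of their leading positions. The locus
where the minors with columns `I_k` do not vanish is open, contains the cell of `I`, and meets only
that cell and cells of larger total height (`totalHeight_le`). Hence the union of an initial segment
of cells is compact (`skeleton_eq`), and successive differences are spaces `ℂ^d`. The cohomology of
a compact pair depends only on the difference (`RelHomeo.nonempty_linearEquiv`), and by iterated
suspension a difference `ℝ^m` contributes one class, in degree `m` (`finrank_H_cell`). As all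
degrees are even, dimensions add up along the filtration (`finrank_H_filtration`).

For the combinatorics, a symmetric configuration is encoded by the column `c r` of the point in row
`r`. It corresponds to `I` when the rows with `c r ≤ k` are the rows `≤ k` together with the heights
of the elements of `I k` (`Fits`); this gives a bijection (`bijective_config`). A free coordinate
`(k, a, b)` is an inversion between the points in the rows of `a` and `b`: the left column is at
most `k` and the right one exceeds `k`, being exactly `k + 1` unless `k` is the last index. Up to
reflection every inversion arises exactly once (`invTilde_eq`): those in the left half with `k` one
less than the right column, and those crossing the middle with the last `k`, where the condition
`b.rev ≤ a` chooses between an inversion and its mirror image. -/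

set_option linter.unusedSectionVars false

/-! ### Cochains on lists of points

A cochain of degree `p` on `M` is regarded as a function on lists of points of length `p + 1`. -/

namespace ListCochain

variable {M M' : Type*}

/-- The coboundary of a function on lists. -/
def delta : (List M → ℚ) → List M → ℚ
  | _, [] => 0
  | f, x :: l => f l - delta (fun m => f (x :: m)) l

@[simp] theorem delta_nil (f : List M → ℚ) : delta f [] = 0 := rfl

theorem delta_cons (f : List M → ℚ) (x : M) (l : List M) :
    delta f (x :: l) = f l - delta (fun m => f (x :: m)) l := rfl

/-- The coboundary at `l` only evaluates its argument on sublists of `l`; every locality estimate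
for `delta` rests on this. -/
theorem delta_congr {f g : List M → ℚ} {l : List M} (h : ∀ m, m.Sublist l → f m = g m) :
    delta f l = delta g l := by
  induction l generalizing f g with
  | nil => rfl
  | cons x l ih =>
    rw [delta_cons, delta_cons, h l (List.sublist_cons_self x l),
      ih fun m hm => h (x :: m) (hm.cons_cons x)]

theorem delta_add (f g : List M → ℚ) : delta (f + g) = delta f + delta g := by
  funext l
  induction l generalizing f g with
  | nil => simp
  | cons x l ih =>
    have := ih (fun m => f (x :: m)) (fun m => g (x :: m))
    simp only [Pi.add_apply, delta_cons] at this ⊢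
    rw [show (fun m => f (x :: m) + g (x :: m)) =
      (fun m => f (x :: m)) + (fun m => g (x :: m)) from rfl, this]
    ring

theorem delta_smul (c : ℚ) (f : List M → ℚ) : delta (c • f) = c • delta f := by
  funext l
  induction l generalizing f with
  | nil => simp
  | cons x l ih =>
    have := ih (fun m => f (x :: m))
    simp only [Pi.smul_apply, delta_cons, smul_eq_mul] at this ⊢
    rw [show (fun m => c * f (x :: m)) = c • (fun m => f (x :: m)) from rfl, this]
    ring

/-- The coboundary as a linear map. -/
def deltaₗ (M : Type*) : (List M → ℚ) →ₗ[ℚ] (List M → ℚ) where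
  toFun := delta
  map_add' := delta_add
  map_smul' := delta_smul

@[simp] theorem deltaₗ_apply (f : List M → ℚ) : deltaₗ M f = delta f := rfl

theorem delta_sub (f g : List M → ℚ) : delta (f - g) = delta f - delta g :=
  (deltaₗ M).map_sub f g

@[simp] theorem delta_zero : delta (0 : List M → ℚ) = 0 := (deltaₗ M).map_zero

theorem delta_eq_zero {f : List M → ℚ} {l : List M} (h : ∀ m, m.Sublist l → f m = 0) :
    delta f l = 0 := by
  rw [delta_congr (g := 0) h, delta_zero, Pi.zero_apply]

@[simp] theorem delta_delta (f : List M → ℚ) : delta (delta f) = 0 := by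
  funext l
  induction l generalizing f with
  | nil => rfl
  | cons x l ih =>
    have h : (fun m => delta f (x :: m)) = f - delta (fun m => f (x :: m)) := rfl
    rw [delta_cons, h, delta_sub, Pi.sub_apply, ih]
    simp

/-- Pullback of cochains along an arbitrary map. -/
def pull (φ : M → M') (f : List M' → ℚ) : List M → ℚ := fun l => f (l.map φ)

theorem delta_pull (φ : M → M') (f : List M' → ℚ) : delta (pull φ f) = pull φ (delta f) := by
  funext l
  induction l generalizing f with
  | nil => rfl
  | cons x l ih =>
    have := ih (fun m => f (φ x :: m))
    have h : (fun m => pull φ f (x :: m)) = pull φ (fun m => f (φ x :: m)) := rfl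
    rw [delta_cons, h, this]
    rfl

/-- The prism operator of two maps. -/
def prism (φ ψ : M → M') : (List M' → ℚ) → List M → ℚ
  | _, [] => 0
  | f, x :: l => f (φ x :: ψ x :: l.map ψ) - prism φ ψ (fun m => f (φ x :: m)) l

theorem prism_cons (φ ψ : M → M') (f : List M' → ℚ) (x : M) (l : List M) :
    prism φ ψ f (x :: l) = f (φ x :: ψ x :: l.map ψ) - prism φ ψ (fun m => f (φ x :: m)) l := rfl

theorem prism_sub (φ ψ : M → M') (f g : List M' → ℚ) :
    prism φ ψ (f - g) = prism φ ψ f - prism φ ψ g := by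
  funext l
  induction l generalizing f g with
  | nil => simp [prism]
  | cons x l ih =>
    have := ih (fun m => f (φ x :: m)) (fun m => g (φ x :: m))
    simp only [Pi.sub_apply, prism_cons] at this ⊢
    rw [show (fun m => f (φ x :: m) - g (φ x :: m)) =
      (fun m => f (φ x :: m)) - (fun m => g (φ x :: m)) from rfl, this]
    ring

/-- The prism operator evaluates `f` only on lists made of points `φ x` and `ψ x` with `x ∈ l`, so
control of the displacement of these points suffices. -/
theorem prism_eq_zero {φ ψ : M → M'} {f : List M' → ℚ} {l : List M}
    (h : ∀ m : List M', (∀ y ∈ m, ∃ x ∈ l, y = φ x ∨ y = ψ x) → f m = 0) :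
    prism φ ψ f l = 0 := by
  induction l generalizing f with
  | nil => rfl
  | cons x l ih =>
    rw [prism_cons, h, ih, sub_zero]
    · intro m hm
      refine h _ fun y hy => ?_
      rcases List.mem_cons.1 hy with rfl | hy
      · exact ⟨x, by simp⟩
      · obtain ⟨z, hz, hyz⟩ := hm y hy
        exact ⟨z, by simp [hz], hyz⟩
    · intro y hy
      simp only [List.mem_cons, List.mem_map] at hy
      rcases hy with rfl | rfl | ⟨z, hz, rfl⟩
      · exact ⟨x, by simp⟩
      · exact ⟨x, by simp⟩
      · exact ⟨z, by simp [hz]⟩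

/-- The prism operator is a homotopy between the pullbacks along the two maps. -/
theorem delta_prism (φ ψ : M → M') (f : List M' → ℚ) :
    delta (prism φ ψ f) + prism φ ψ (delta f) = pull ψ f - pull φ f := by
  funext l
  induction l generalizing f with
  | nil => simp [pull, prism]
  | cons x l ih =>
    have h1 : (fun m => prism φ ψ f (x :: m)) =
        pull ψ (fun m => f (φ x :: ψ x :: m)) - prism φ ψ (fun m => f (φ x :: m)) := rfl
    have h2 : (fun m => delta f (φ x :: m)) = f - delta (fun m => f (φ x :: m)) := rfl
    have h3 := ih (fun m => f (φ x :: m))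
    simp only [Pi.add_apply, Pi.sub_apply] at h3 ⊢
    rw [delta_cons, prism_cons, h1, h2, delta_sub, prism_sub, delta_pull]
    simp only [Pi.sub_apply, delta_cons, pull, List.map_cons] at h3 ⊢
    linarith

/-- The part of a cochain on lists of length `p`. -/
def trunc (p : ℕ) : (List M → ℚ) →ₗ[ℚ] (List M → ℚ) where
  toFun f := fun l => if l.length = p then f l else 0
  map_add' f g := by funext l; by_cases h : l.length = p <;> simp [h]
  map_smul' c f := by funext l; by_cases h : l.length = p <;> simp [h]

theorem trunc_apply (p : ℕ) (f : List M → ℚ) (l : List M) :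
    trunc p f l = if l.length = p then f l else 0 := rfl

theorem mem_range_trunc {p : ℕ} {f : List M → ℚ} :
    f ∈ LinearMap.range (trunc (M := M) p) ↔ trunc p f = f := by
  constructor
  · rintro ⟨g, rfl⟩
    funext l
    simp only [trunc_apply]
    split_ifs <;> rfl
  · exact fun h => ⟨f, h⟩

theorem trunc_zero_delta (f : List M → ℚ) : trunc 0 (delta f) = 0 := by
  funext l
  rw [trunc_apply]
  split_ifs with h
  · rw [List.length_eq_zero_iff.1 h]; rfl
  · rfl

theorem trunc_succ_delta (p : ℕ) (f : List M → ℚ) :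
    trunc (p + 1) (delta f) = delta (trunc p f) := by
  funext l
  induction l generalizing f p with
  | nil => simp [trunc_apply]
  | cons x l ih =>
    rw [trunc_apply, delta_cons, delta_cons, trunc_apply]
    cases p with
    | zero =>
      have : (fun m => trunc 0 f (x :: m)) = 0 := by funext m; simp [trunc_apply]
      rw [this]
      by_cases h : l.length = 0
      · rw [List.length_eq_zero_iff.1 h]; simp
      · simp [h]
    | succ p =>
      have : (fun m => trunc (p + 1) f (x :: m)) = trunc p (fun m => f (x :: m)) := by
        funext m; simp [trunc_apply]
      rw [this, ← ih, trunc_apply]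
      by_cases h : l.length = p + 1 <;> simp [h]

/-! ### Relative cohomology of pairs of subsets of a metric space -/

section Metric

variable [MetricSpace M] [MetricSpace M']

/-- Lists of points of `A` with mutual distances less than `ε`. -/
def Small (ε : ℝ) (A : Set M) (l : List M) : Prop :=
  (∀ x ∈ l, x ∈ A) ∧ ∀ x ∈ l, ∀ y ∈ l, dist x y < ε

theorem small_nil (ε : ℝ) (A : Set M) : Small ε A [] := by simp [Small]

theorem Small.mono {ε ε' : ℝ} {A A' : Set M} {l : List M} (h : Small ε A l) (hε : ε ≤ ε')
    (hA : A ⊆ A') : Small ε' A' l :=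
  ⟨fun x hx => hA (h.1 x hx), fun x hx y hy => (h.2 x hx y hy).trans_le hε⟩

theorem Small.sublist {ε : ℝ} {A : Set M} {l m : List M} (h : Small ε A l) (hm : m.Sublist l) :
    Small ε A m :=
  ⟨fun x hx => h.1 x (hm.subset hx), fun x hx y hy => h.2 x (hm.subset hx) y (hm.subset hy)⟩

/-- Cochains vanishing on all sufficiently small lists in `A`. -/
def Null (A : Set M) : Submodule ℚ (List M → ℚ) where
  carrier := {f | ∃ ε > 0, ∀ l, Small ε A l → f l = 0}
  zero_mem' := ⟨1, one_pos, fun _ _ => rfl⟩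
  add_mem' := by
    rintro f g ⟨ε, hε, hf⟩ ⟨ε', hε', hg⟩
    refine ⟨min ε ε', lt_min hε hε', fun l hl => ?_⟩
    rw [Pi.add_apply, hf l (hl.mono (min_le_left _ _) subset_rfl),
      hg l (hl.mono (min_le_right _ _) subset_rfl), add_zero]
  smul_mem' := by
    rintro c f ⟨ε, hε, hf⟩
    exact ⟨ε, hε, fun l hl => by simp [hf l hl]⟩

theorem null_anti {A B : Set M} (h : B ⊆ A) : (Null A : Submodule ℚ (List M → ℚ)) ≤ Null B := by
  rintro f ⟨ε, hε, hf⟩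
  exact ⟨ε, hε, fun l hl => hf l (hl.mono le_rfl h)⟩

theorem apply_nil_of_mem_null {A : Set M} {f : List M → ℚ} (hf : f ∈ Null A) : f [] = 0 := by
  obtain ⟨ε, _, h⟩ := hf
  exact h [] (small_nil _ _)

theorem delta_mem_null {A : Set M} {f : List M → ℚ} (hf : f ∈ Null A) : delta f ∈ Null A := by
  obtain ⟨ε, hε, h⟩ := hf
  exact ⟨ε, hε, fun l hl => delta_eq_zero fun m hm => h m (hl.sublist hm)⟩

theorem trunc_mem_null {A : Set M} {f : List M → ℚ} (p : ℕ) (hf : f ∈ Null A) :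
    trunc p f ∈ Null A := by
  obtain ⟨ε, hε, h⟩ := hf
  exact ⟨ε, hε, fun l hl => by rw [trunc_apply, h l hl, ite_self]⟩

/-- Relative cocycles of the pair `(A, B)` on lists of length `p`. -/
def Z (p : ℕ) (A B : Set M) : Submodule ℚ (List M → ℚ) :=
  (Null B ⊓ LinearMap.range (trunc p)) ⊓ (Null A).comap (deltaₗ M)

theorem mem_Z {p : ℕ} {A B : Set M} {f : List M → ℚ} :
    f ∈ Z p A B ↔ f ∈ Null B ∧ trunc p f = f ∧ delta f ∈ Null A := by
  rw [Z, Submodule.mem_inf, Submodule.mem_inf, mem_range_trunc, Submodule.mem_comap, deltaₗ_apply,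
    and_assoc]

/-- Relative coboundaries of the pair `(A, B)`. -/
def Bd (A B : Set M) : Submodule ℚ (List M → ℚ) := Null A ⊔ (Null B).map (deltaₗ M)

theorem mem_Bd {A B : Set M} {f : List M → ℚ} :
    f ∈ Bd A B ↔ ∃ g ∈ Null B, f - delta g ∈ Null A := by
  rw [Bd, Submodule.mem_sup]
  constructor
  · rintro ⟨u, hu, _, ⟨g, hg, rfl⟩, rfl⟩
    exact ⟨g, hg, by simpa using hu⟩
  · rintro ⟨g, hg, h⟩
    exact ⟨_, h, _, ⟨g, hg, rfl⟩, by simp⟩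

theorem null_le_Bd (A B : Set M) : (Null A : Submodule ℚ (List M → ℚ)) ≤ Bd A B := le_sup_left

theorem delta_mem_Bd {A B : Set M} {g : List M → ℚ} (hg : g ∈ Null B) : delta g ∈ Bd A B :=
  mem_Bd.2 ⟨g, hg, by simp⟩

theorem trunc_mem_Bd {A B : Set M} {f : List M → ℚ} (p : ℕ) (hf : f ∈ Bd A B) :
    trunc p f ∈ Bd A B := by
  obtain ⟨g, hg, h⟩ := mem_Bd.1 hf
  have h1 := trunc_mem_null p h
  rw [map_sub] at h1
  cases p with
  | zero =>
    rw [trunc_zero_delta, sub_zero] at h1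
    exact null_le_Bd _ _ h1
  | succ p =>
    rw [trunc_succ_delta] at h1
    exact mem_Bd.2 ⟨_, trunc_mem_null p hg, h1⟩

/-- Relative cohomology of the pair `(A, B)`; lists of length `p` give degree `p - 1`. -/
abbrev H (p : ℕ) (A B : Set M) : Type _ := Z p A B ⧸ (Bd A B).comap (Z p A B).subtype

/-- This is the connecting homomorphism of the triple `(A, C, B)` at the level of cochains. -/
theorem delta_mem_Z {p : ℕ} {A B C : Set M} {f : List M → ℚ} (hf : f ∈ Z p C B) :
    delta f ∈ Z (p + 1) A C := by
  rw [mem_Z] at hf ⊢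
  refine ⟨hf.2.2, ?_, ?_⟩
  · rw [trunc_succ_delta, hf.2.1]
  · rw [delta_delta]; exact zero_mem _

/-- A relative cocycle of `(A, B)` can be changed by a coboundary of degree one less. -/
theorem exists_trunc_of_mem_Bd {p : ℕ} {A B : Set M} {f : List M → ℚ}
    (hp : trunc (p + 1) f = f) (hf : f ∈ Bd A B) :
    ∃ g ∈ Null B, trunc p g = g ∧ f - delta g ∈ Null A := by
  obtain ⟨g, hg, h⟩ := mem_Bd.1 hf
  refine ⟨trunc p g, trunc_mem_null p hg, mem_range_trunc.1 ⟨g, rfl⟩, ?_⟩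
  rw [← trunc_succ_delta, ← hp, ← map_sub]
  exact trunc_mem_null _ h

/-- The empty list is small in every set, even in `∅`. So a member of `Null B` vanishes on it, and
the augmented complex has nothing in length `0`. -/
theorem Z_zero_le (A B : Set M) : (Z 0 A B : Submodule ℚ (List M → ℚ)) ≤ Bd A B := by
  intro f hf
  rw [mem_Z] at hf
  have : f = 0 := by
    rw [← hf.2.1]
    funext l
    rw [trunc_apply]
    split_ifs with h
    · rw [List.length_eq_zero_iff.1 h, apply_nil_of_mem_null hf.1]; rfl
    · rfl
  rw [this]; exact zero_mem _

theorem subsingleton_H_iff {p : ℕ} {A B : Set M} :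
    Subsingleton (H p A B) ↔ Z p A B ≤ Bd A B := by
  rw [← Submodule.comap_subtype_eq_top]
  exact Submodule.Quotient.subsingleton_iff

theorem mk_eq_zero_iff {p : ℕ} {A B : Set M} {f : Z p A B} :
    (Submodule.Quotient.mk f : H p A B) = 0 ↔ f.1 ∈ Bd A B :=
  Submodule.Quotient.mk_eq_zero _

/-- Exactness in the middle of the sequence of a triple: after correction by a primitive on `(C,
B)`, a cocycle of `(A, B)` becomes one of `(A, C)`. -/
theorem Z_le_Bd_triple {p : ℕ} {A B C : Set M} (hBC : B ⊆ C) (hCA : C ⊆ A)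
    (h1 : Z p A C ≤ Bd A C) (h2 : Z p C B ≤ Bd C B) : Z p A B ≤ Bd A B := by
  intro f hf
  have hf' := mem_Z.1 hf
  cases p with
  | zero => exact Z_zero_le A B hf
  | succ p =>
    obtain ⟨g, hg, hgp, h⟩ := exists_trunc_of_mem_Bd hf'.2.1
      (h2 (mem_Z.2 ⟨hf'.1, hf'.2.1, null_anti hCA hf'.2.2⟩))
    have : f - delta g ∈ Z (p + 1) A C := mem_Z.2 ⟨h, by
      rw [map_sub, trunc_succ_delta, hgp, hf'.2.1], by
      rw [delta_sub, delta_delta, sub_zero]; exact hf'.2.2⟩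
    obtain ⟨g', hg', h'⟩ := mem_Bd.1 (h1 this)
    exact mem_Bd.2 ⟨g + g', add_mem hg (null_anti hBC hg'), by
      rwa [delta_add, ← sub_sub]⟩

/-- The map `H(A, B) → H(A', B')` induced by an inclusion of cocycles and coboundaries. -/
def incl {p : ℕ} {A B A' B' : Set M} (hZ : Z p A B ≤ Z p A' B') (hB : Bd A B ≤ Bd A' B') :
    H p A B →ₗ[ℚ] H p A' B' :=
  Submodule.mapQ _ _ (Submodule.inclusion hZ) (by
    intro x hx
    exact hB hx)

theorem Z_mono {p : ℕ} {A B A' B' : Set M} (hA : A' ⊆ A) (hB : B' ⊆ B) :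
    (Z p A B : Submodule ℚ (List M → ℚ)) ≤ Z p A' B' := by
  intro f hf
  rw [mem_Z] at hf ⊢
  exact ⟨null_anti hB hf.1, hf.2.1, null_anti hA hf.2.2⟩

theorem Bd_mono {A B A' B' : Set M} (hA : A' ⊆ A) (hB : B' ⊆ B) :
    (Bd A B : Submodule ℚ (List M → ℚ)) ≤ Bd A' B' := by
  intro f hf
  rw [mem_Bd] at hf ⊢
  obtain ⟨g, hg, h⟩ := hf
  exact ⟨g, null_anti hB hg, null_anti hA h⟩

/-- Additivity of the dimension in the long exact sequence of a triple when the neighbouring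
groups vanish. -/
theorem finrank_H_triple {p : ℕ} {A B C : Set M} (hBC : B ⊆ C) (hCA : C ⊆ A)
    (h1 : Z p C B ≤ Bd C B) (h2 : Z (p + 2) A C ≤ Bd A C)
    (hf1 : Module.Finite ℚ (H (p + 1) A C)) (hf2 : Module.Finite ℚ (H (p + 1) C B)) :
    Module.Finite ℚ (H (p + 1) A B) ∧ Module.finrank ℚ (H (p + 1) A B) =
      Module.finrank ℚ (H (p + 1) A C) + Module.finrank ℚ (H (p + 1) C B) := by
  let i : H (p + 1) A C →ₗ[ℚ] H (p + 1) A B :=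
    incl (Z_mono subset_rfl hBC) (Bd_mono subset_rfl hBC)
  let j : H (p + 1) A B →ₗ[ℚ] H (p + 1) C B :=
    incl (Z_mono hCA subset_rfl) (Bd_mono hCA subset_rfl)
  -- If `f` from `(A, C)` bounds `g` relative to `B`, then `g` is a cocycle of `(C, B)`. By `h1` it
  -- is `δu` up to `Null C`, and `g - δu` bounds `f` relative to `C`.
  have hi : Function.Injective i := by
    rw [injective_iff_map_eq_zero]
    intro x
    obtain ⟨⟨f, hf⟩, rfl⟩ := Submodule.Quotient.mk_surjective _ x
    intro hx
    have hx' : f ∈ Bd A B := mk_eq_zero_iff.1 hx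
    obtain ⟨g, hg, hgp, h⟩ := exists_trunc_of_mem_Bd (mem_Z.1 hf).2.1 hx'
    have hgZ : g ∈ Z p C B := mem_Z.2 ⟨hg, hgp, by
      have := sub_mem (mem_Z.1 hf).1 (null_anti hCA h)
      rwa [sub_sub_cancel] at this⟩
    obtain ⟨u, hu, h'⟩ := mem_Bd.1 (h1 hgZ)
    refine mk_eq_zero_iff.2 (mem_Bd.2 ⟨g - delta u, h', ?_⟩)
    rwa [delta_sub, delta_delta, sub_zero]
  -- The obstruction to extending `f` from `C` to `A` is the class of `δf` on `(A, C)`, which is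
  -- zero by `h2`.
  have hj : Function.Surjective j := by
    intro x
    obtain ⟨⟨f, hf⟩, rfl⟩ := Submodule.Quotient.mk_surjective _ x
    obtain ⟨g, hg, hgp, h⟩ := exists_trunc_of_mem_Bd
      (mem_Z.1 (delta_mem_Z (A := A) hf)).2.1 (h2 (delta_mem_Z hf))
    have hZ : f - g ∈ Z (p + 1) A B := mem_Z.2
      ⟨sub_mem (mem_Z.1 hf).1 (null_anti hBC hg), by rw [map_sub, hgp, (mem_Z.1 hf).2.1], by
        rwa [delta_sub]⟩
    refine ⟨Submodule.Quotient.mk ⟨f - g, hZ⟩, ?_⟩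
    refine (Submodule.Quotient.eq _).2 (null_le_Bd _ _ ?_)
    change f - g - f ∈ Null C
    rw [sub_sub_cancel_left]
    exact neg_mem hg
  have hij : LinearMap.range i = LinearMap.ker j := by
    ext x
    obtain ⟨⟨f, hf⟩, rfl⟩ := Submodule.Quotient.mk_surjective _ x
    constructor
    · rintro ⟨y, hy⟩
      rw [← hy]
      obtain ⟨⟨g, hg⟩, rfl⟩ := Submodule.Quotient.mk_surjective _ y
      exact mk_eq_zero_iff.2 (null_le_Bd _ _ (mem_Z.1 hg).1)
    · intro hx
      have hx' : f ∈ Bd C B := mk_eq_zero_iff.1 hx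
      obtain ⟨g, hg, hgp, h⟩ := exists_trunc_of_mem_Bd (mem_Z.1 hf).2.1 hx'
      have hZ : f - delta g ∈ Z (p + 1) A C := mem_Z.2 ⟨h, by
        rw [map_sub, trunc_succ_delta, hgp, (mem_Z.1 hf).2.1], by
        rw [delta_sub, delta_delta, sub_zero]; exact (mem_Z.1 hf).2.2⟩
      refine ⟨Submodule.Quotient.mk ⟨_, hZ⟩, ?_⟩
      refine (Submodule.Quotient.eq _).2 ?_
      change f - delta g - f ∈ Bd A B
      rw [sub_sub_cancel_left]
      exact neg_mem (delta_mem_Bd hg)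
  have hfin : Module.Finite ℚ (H (p + 1) A B) := by
    have e1 : Module.Finite ℚ (LinearMap.range j) := inferInstance
    have e2 : Module.Finite ℚ (LinearMap.ker j) := by rw [← hij]; infer_instance
    have e3 : Module.Finite ℚ (H (p + 1) A B ⧸ LinearMap.ker j) :=
      Module.Finite.equiv j.quotKerEquivRange.symm
    exact Module.Finite.of_submodule_quotient (LinearMap.ker j)
  refine ⟨hfin, ?_⟩
  rw [← LinearMap.finrank_range_add_finrank_ker j, ← hij, LinearMap.finrank_range_of_inj hi,
    LinearMap.range_eq_top.2 hj, finrank_top, add_comm]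

/-- The connecting isomorphism when the cohomology of `(A, B)` vanishes. -/
theorem nonempty_connecting {p : ℕ} {A B C : Set M} (hBC : B ⊆ C) (hCA : C ⊆ A)
    (h1 : Z p A B ≤ Bd A B) (h2 : Z (p + 1) A B ≤ Bd A B) :
    Nonempty (H p C B ≃ₗ[ℚ] H (p + 1) A C) := by
  let d : Z p C B →ₗ[ℚ] H (p + 1) A C :=
    (Submodule.mkQ _).comp ((deltaₗ M).restrict (p := Z p C B) (q := Z (p + 1) A C)
      fun f hf => delta_mem_Z hf)
  have hd : Function.Surjective d := by
    intro x
    obtain ⟨⟨f, hf⟩, rfl⟩ := Submodule.Quotient.mk_surjective _ x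
    obtain ⟨g, hg, hgp, h⟩ := exists_trunc_of_mem_Bd (mem_Z.1 hf).2.1
      (h2 (Z_mono subset_rfl hBC hf))
    have hgZ : g ∈ Z p C B := mem_Z.2 ⟨hg, hgp, by
      have := sub_mem (mem_Z.1 hf).1 (null_anti hCA h)
      rwa [sub_sub_cancel] at this⟩
    refine ⟨⟨g, hgZ⟩, (Submodule.Quotient.eq _).2 (null_le_Bd _ _ ?_)⟩
    change delta g - f ∈ Null A
    rw [← neg_sub]
    exact neg_mem h
  have hk : LinearMap.ker d = (Bd C B).comap (Z p C B).subtype := by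
    ext ⟨f, hf⟩
    rw [LinearMap.mem_ker, Submodule.mem_comap]
    refine mk_eq_zero_iff.trans ?_
    change delta f ∈ Bd A C ↔ f ∈ Bd C B
    rw [mem_Z] at hf
    constructor
    · intro h
      obtain ⟨g, hg, hgp, h⟩ := exists_trunc_of_mem_Bd
        (by rw [trunc_succ_delta, hf.2.1]) h
      have : f - g ∈ Z p A B := mem_Z.2 ⟨sub_mem hf.1 (null_anti hBC hg), by
        rw [map_sub, hf.2.1, hgp], by rwa [delta_sub]⟩
      have := add_mem (Bd_mono hCA subset_rfl (h1 this)) (null_le_Bd C B hg)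
      rwa [sub_add_cancel] at this
    · intro h
      obtain ⟨g, hg, h⟩ := mem_Bd.1 h
      refine mem_Bd.2 ⟨f - delta g, h, ?_⟩
      rw [delta_sub, delta_delta, sub_zero, sub_self]
      exact zero_mem _
  exact ⟨(Submodule.quotEquivOfEq _ _ hk.symm).trans (d.quotKerEquivOfSurjective hd)⟩

end Metric

end ListCochain

/-! ### The cohomology of a compact pair depends only on the difference -/

namespace ListCochain

open Metric Set

section Transport

variable {M M' : Type*} {A B : Set M}

open Classical in
/-- Pullback along a map defined on `A \ B`, extended by zero. -/
noncomputable def transport (A B : Set M) (u : M → M') (f : List M' → ℚ) : List M → ℚ :=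
  fun l => if ∀ x ∈ l, x ∈ A \ B then f (l.map u) else 0

theorem transport_sub (u : M → M') (f g : List M' → ℚ) :
    transport A B u (f - g) = transport A B u f - transport A B u g := by
  funext l
  simp only [transport, Pi.sub_apply]
  split_ifs <;> simp

end Transport

variable {M M' : Type*} [MetricSpace M] [MetricSpace M']

/-- A cochain that vanishes on the boundary `B` and is closed near `B` can be changed by a
coboundary so as to vanish near `B`. -/
theorem exists_vanish_near {A B : Set M} (hB : IsCompact B) (hAB : B ⊆ A) {g : List M → ℚ} (hg : g ∈ Null B)
    {ε : ℝ} (hε : 0 < ε) (h : ∀ l, Small ε (A ∩ thickening ε B) l → delta g l = 0) :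
    ∃ k ∈ Null B, ∃ ε' > 0, ∀ l, Small ε' (A ∩ thickening ε' B) l → (g + delta k) l = 0 := by
  obtain ⟨η, hη, hgη⟩ := hg
  -- A nearest-point map onto `B`. It need not be continuous, since cochains are arbitrary
  -- functions; only the displacement near `B` matters.
  have : ∀ x : M, ∃ y, ∀ b ∈ B, y ∈ B ∧ dist x y ≤ dist x b := by
    intro x
    rcases B.eq_empty_or_nonempty with rfl | hne
    · exact ⟨x, by simp⟩
    · obtain ⟨y, hy, hy'⟩ := hB.exists_isMinOn hne (f := fun y => dist x y) (by fun_prop)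
      exact ⟨y, fun b hb => ⟨hy, hy' hb⟩⟩
  choose r hr using this
  have hrB : ∀ x ∈ B, r x = x := fun x hx => by
    have := (hr x x hx).2
    rw [dist_self] at this
    exact (dist_le_zero.1 this).symm
  -- Two displacements and one original distance add up to less than `3 * ε'`.
  set ε' := min (ε / 3) (η / 3) with hε'
  have hε'0 : 0 < ε' := by positivity
  have h1 : 3 * ε' ≤ ε := by linarith [min_le_left (ε / 3) (η / 3)]
  have h2 : 3 * ε' ≤ η := by linarith [min_le_right (ε / 3) (η / 3)]
  have hnear : ∀ x ∈ thickening ε' B, r x ∈ B ∧ dist x (r x) < ε' := by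
    intro x hx
    obtain ⟨b, hb, hxb⟩ := mem_thickening_iff.1 hx
    exact ⟨(hr x b hb).1, (hr x b hb).2.trans_lt hxb⟩
  -- With `k = prism id r g` the homotopy formula gives `g + δk = pull r g - prism id r (δg)`. Near
  -- `B` the first term vanishes because `g` is null on `B`, the second because `g` is closed there.
  refine ⟨prism id r g, ⟨η, hη, fun l hl => prism_eq_zero fun m hm => hgη m ?_⟩, ε', hε'0,
    fun l hl => ?_⟩
  · have hml : ∀ y ∈ m, y ∈ l := fun y hy => by
      obtain ⟨x, hx, hxy | hxy⟩ := hm y hy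
      · rwa [hxy]
      · rwa [hxy, hrB x (hl.1 x hx)]
    exact ⟨fun y hy => hl.1 y (hml y hy), fun y hy z hz => hl.2 y (hml y hy) z (hml z hz)⟩
  · have key := congrFun (delta_prism id r g) l
    have e1 : prism id r (delta g) l = 0 := by
      refine prism_eq_zero fun m hm => h m ⟨fun y hy => ?_, fun y hy z hz => ?_⟩
      · obtain ⟨x, hx, hxy | hxy⟩ := hm y hy
        · rw [hxy]
          exact ⟨(hl.1 x hx).1, thickening_mono (by linarith) _ (hl.1 x hx).2⟩
        · rw [hxy]
          have := (hnear x (hl.1 x hx).2).1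
          exact ⟨hAB this, self_subset_thickening hε _ this⟩
      · have aux : ∀ y ∈ m, ∃ x ∈ l, dist x y < ε' := fun y hy => by
          obtain ⟨x, hx, hxy | hxy⟩ := hm y hy
          · exact ⟨x, hx, by rw [hxy, id, dist_self]; exact hε'0⟩
          · exact ⟨x, hx, by rw [hxy]; exact (hnear x (hl.1 x hx).2).2⟩
        obtain ⟨x, hx, hxy⟩ := aux y hy
        obtain ⟨w, hw, hwz⟩ := aux z hz
        have := hl.2 x hx w hw
        have t1 := dist_triangle4 y x w z
        rw [dist_comm y x] at t1
        linarith
    have e2 : pull r g l = 0 := by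
      refine hgη _ ⟨fun y hy => ?_, fun y hy z hz => ?_⟩
      · obtain ⟨x, hx, rfl⟩ := List.mem_map.1 hy
        exact (hnear x (hl.1 x hx).2).1
      · obtain ⟨x, hx, rfl⟩ := List.mem_map.1 hy
        obtain ⟨w, hw, rfl⟩ := List.mem_map.1 hz
        have := hl.2 x hx w hw
        have t1 := dist_triangle4 (r x) x w (r w)
        rw [dist_comm (r x) x] at t1
        linarith [(hnear x (hl.1 x hx).2).2, (hnear w (hl.1 w hw).2).2]
    have e3 : pull id g l = g l := by simp [pull]
    simp only [Pi.add_apply, Pi.sub_apply, e1, e2, e3] at key ⊢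
    linarith

/-- `g` vanishes on the lists without points in `A` at distance at least `ε` from `B`. -/
def Supp (ε : ℝ) (A B : Set M) (g : List M → ℚ) : Prop :=
  ∀ l : List M, (∀ x ∈ l, x ∉ A \ thickening ε B) → g l = 0

theorem Supp.delta {ε : ℝ} {A B : Set M} {g : List M → ℚ} (h : Supp ε A B g) :
    Supp ε A B (delta g) :=
  fun _ hl => delta_eq_zero fun m hm => h m fun x hx => hl x (hm.subset hx)

theorem Supp.mono {ε ε' : ℝ} {A B : Set M} {g : List M → ℚ} (h : Supp ε A B g) (hε : ε' ≤ ε) :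
    Supp ε' A B g :=
  fun l hl => h l fun x hx hx' => hl x hx ⟨hx'.1, fun h'' => hx'.2 (thickening_mono hε _ h'')⟩

theorem Supp.trunc {ε : ℝ} {A B : Set M} {g : List M → ℚ} (h : Supp ε A B g) (p : ℕ) :
    Supp ε A B (trunc p g) :=
  fun l hl => by rw [trunc_apply, h l hl, ite_self]

theorem Supp.mem_null {ε : ℝ} (hε : 0 < ε) {A B : Set M} {g : List M → ℚ} (h : Supp ε A B g) :
    g ∈ Null B :=
  ⟨1, one_pos, fun l hl => h l fun x hx hx' => hx'.2 (self_subset_thickening hε _ (hl.1 x hx))⟩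

/-- The cochain is set to zero on lists without a point of `A` far from `B`. A small such list in
`A` lies in the thickening of `B`, where `g` is already zero, so only a null cochain is lost. -/
theorem exists_supp {ε : ℝ} {A B : Set M} {g : List M → ℚ} (hε : 0 < ε)
    (h : ∀ l, Small ε (A ∩ thickening ε B) l → g l = 0) :
    ∃ g', Supp ε A B g' ∧ g - g' ∈ Null A := by
  classical
  refine ⟨fun l => if ∃ x ∈ l, x ∈ A \ thickening ε B then g l else 0, ?_, ε, hε, ?_⟩
  · intro l hl
    exact if_neg fun ⟨x, hx, hx'⟩ => hl x hx hx'
  · intro l hl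
    simp only [Pi.sub_apply]
    split_ifs with hx
    · exact sub_self _
    · push Not at hx
      rw [h l ⟨fun x hx' => ⟨hl.1 x hx', ?_⟩, hl.2⟩, sub_zero]
      by_contra h'
      exact hx x hx' ⟨hl.1 x hx', h'⟩

/-- Every relative class has a representative supported away from `B`. Only such cocycles can be
moved along a homeomorphism of the differences, whose continuity may fail at `B`. -/
theorem exists_supp_of_mem_Z {p : ℕ} {A B : Set M} (hB : IsCompact B) (hBA : B ⊆ A)
    {f : List M → ℚ} (hf : f ∈ Z p A B) :
    ∃ f' ∈ Z p A B, (∃ ε > 0, Supp ε A B f') ∧ f - f' ∈ Bd A B := by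
  obtain ⟨hf1, hf2, ε, hε, hf3⟩ := mem_Z.1 hf
  obtain ⟨k, hk, ε', hε', h⟩ := exists_vanish_near hB hBA hf1 hε
    fun l hl => hf3 l (hl.mono le_rfl inter_subset_left)
  obtain ⟨f', hs, hn⟩ := exists_supp hε' h
  have hb : f - f' ∈ Bd A B := by
    have := sub_mem (null_le_Bd A B hn) (delta_mem_Bd (A := A) hk)
    convert this using 1
    abel
  have hd : delta f' ∈ Null A := by
    have := sub_mem (mem_Z.1 hf).2.2 (delta_mem_null hn)
    convert this using 1
    rw [delta_sub, delta_add, delta_delta]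
    abel
  refine ⟨trunc p f', mem_Z.2 ⟨(hs.trunc p).mem_null hε', ?_, ?_⟩, ⟨ε', hε', hs.trunc p⟩, ?_⟩
  · exact mem_range_trunc.1 ⟨f', rfl⟩
  · rw [← trunc_succ_delta]
    exact trunc_mem_null _ hd
  · rw [← hf2, ← map_sub]
    exact trunc_mem_Bd _ hb

/-- The primitive of a supported coboundary is closed near `B`, so `exists_vanish_near` applies to
it too. -/
theorem exists_supp_of_mem_Bd {A B : Set M} (hB : IsCompact B) (hBA : B ⊆ A)
    {f : List M → ℚ} (hf : f ∈ Bd A B) {ε₀ : ℝ} (hε₀ : 0 < ε₀) (hs : Supp ε₀ A B f) :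
    ∃ g, (∃ ε > 0, Supp ε A B g) ∧ f - delta g ∈ Null A := by
  obtain ⟨g, hg, ε, hε, h⟩ := mem_Bd.1 hf
  obtain ⟨k, hk, ε', hε', h'⟩ := exists_vanish_near hB hBA hg (lt_min hε hε₀) (by
    intro l hl
    have e1 := h l (hl.mono (min_le_left _ _) inter_subset_left)
    have e2 := hs l fun x hx hx' =>
      hx'.2 (thickening_mono (min_le_right _ _) _ (hl.1 x hx).2)
    rw [Pi.sub_apply, e2, zero_sub, neg_eq_zero] at e1
    exact e1)
  obtain ⟨g', hs', hn⟩ := exists_supp hε' h'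
  refine ⟨g', ⟨ε', hε', hs'⟩, ?_⟩
  have h3 : f - delta g ∈ Null A := ⟨ε, hε, h⟩
  have := add_mem h3 (delta_mem_null hn)
  convert this using 1
  rw [delta_sub, delta_add, delta_delta]
  abel

section Transport

variable {A B : Set M} {A' B' : Set M'}

/-- Mutually inverse homeomorphisms between the differences of two pairs. -/
structure RelHomeo (A B : Set M) (A' B' : Set M') (u : M → M') (v : M' → M) : Prop where
  maps : MapsTo u (A \ B) (A' \ B')
  maps' : MapsTo v (A' \ B') (A \ B)
  left : LeftInvOn v u (A \ B)
  right : LeftInvOn u v (A' \ B')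
  cont : ContinuousOn u (A \ B)
  cont' : ContinuousOn v (A' \ B')

theorem RelHomeo.symm {u : M → M'} {v : M' → M} (h : RelHomeo A B A' B' u v) :
    RelHomeo A' B' A B v u :=
  ⟨h.maps', h.maps, h.right, h.left, h.cont', h.cont⟩

/-- Extension by zero fails to commute with `delta` only on lists that meet `B`. When small, these
stay in a thickening of `B`, where everything vanishes. -/
theorem transport_delta_sub_mem {u : M → M'} {f : List M' → ℚ}
    {ε : ℝ} (hε : 0 < ε) (hs : Supp ε A B (transport A B u f)) :
    delta (transport A B u f) - transport A B u (delta f) ∈ Null A := by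
  refine ⟨ε, hε, fun l hl => ?_⟩
  rw [Pi.sub_apply]
  by_cases h : ∀ x ∈ l, x ∈ A \ B
  · have : delta (transport A B u f) l = delta (pull u f) l :=
      delta_congr fun m hm => if_pos fun x hx => h x (hm.subset hx)
    rw [this, transport, if_pos h, delta_pull]
    exact sub_self _
  · rw [transport, if_neg h, sub_zero]
    refine hs.delta l fun y hy hy' => hy'.2 ?_
    push Not at h
    obtain ⟨x, hx, hx'⟩ := h
    have hxB : x ∈ B := by
      by_contra hb
      exact hx' ⟨hl.1 x hx, hb⟩
    exact mem_thickening_iff.2 ⟨x, hxB, hl.2 y hy x hx⟩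

theorem isCompact_diff_thickening (hA : IsCompact A) (ε : ℝ) :
    IsCompact (A \ thickening ε B) :=
  hA.diff isOpen_thickening

theorem diff_thickening_subset {ε : ℝ} (hε : 0 < ε) : A \ thickening ε B ⊆ A \ B :=
  sdiff_subset_sdiff_right (self_subset_thickening hε B)

/-- The part of `A'` far from `B'` is compact, so its image under `v` is compact and disjoint from
`B`, hence at positive distance from it. -/
theorem RelHomeo.supp {u : M → M'} {v : M' → M} (h : RelHomeo A B A' B' u v)
    (hA' : IsCompact A') (hB : IsCompact B) {f : List M' → ℚ} {ε' : ℝ} (hε' : 0 < ε')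
    (hs : Supp ε' A' B' f) : ∃ ε > 0, Supp ε A B (transport A B u f) := by
  have hK : IsCompact (v '' (A' \ thickening ε' B')) :=
    (isCompact_diff_thickening hA' ε').image_of_continuousOn
      (h.cont'.mono (diff_thickening_subset hε'))
  have hd : Disjoint B (v '' (A' \ thickening ε' B')) := by
    rw [Set.disjoint_right]
    rintro _ ⟨y, hy, rfl⟩
    exact (h.maps' (diff_thickening_subset hε' hy)).2
  obtain ⟨ε, hε, hd⟩ := hd.exists_thickenings hB hK.isClosed
  refine ⟨ε, hε, fun l hl => ?_⟩
  rw [transport]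
  split_ifs with hx
  · refine hs _ fun y hy hy' => ?_
    obtain ⟨x, hxl, rfl⟩ := List.mem_map.1 hy
    refine hl x hxl ⟨(hx x hxl).1, fun hxt => ?_⟩
    refine Set.disjoint_left.1 hd hxt (self_subset_thickening hε _ ⟨u x, hy', ?_⟩)
    exact h.left (hx x hxl)
  · rfl

/-- The map `u` is uniformly continuous on the compact part of `A` at distance at least `ε / 2` from
`B`. A list of diameter below `ε / 2` with one point at distance at least `ε` lies in that part. -/
theorem RelHomeo.transport_mem_null {u : M → M'} {v : M' → M} (h : RelHomeo A B A' B' u v)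
    (hA : IsCompact A) {g : List M' → ℚ} {ε : ℝ} (hε : 0 < ε)
    (hs : Supp ε A B (transport A B u g)) (hg : g ∈ Null A') : transport A B u g ∈ Null A := by
  obtain ⟨η, hη, hg⟩ := hg
  have hK : IsCompact (A \ thickening (ε / 2) B) := isCompact_diff_thickening hA _
  have hu : UniformContinuousOn u (A \ thickening (ε / 2) B) :=
    hK.uniformContinuousOn_of_continuous
      (h.cont.mono (diff_thickening_subset (half_pos hε)))
  obtain ⟨ζ, hζ, hu⟩ := Metric.uniformContinuousOn_iff.1 hu η hη
  refine ⟨min ζ (ε / 2), lt_min hζ (half_pos hε), fun l hl => ?_⟩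
  by_cases hx : ∀ x ∈ l, x ∉ A \ thickening ε B
  · exact hs l hx
  push Not at hx
  obtain ⟨x, hxl, hxA, hxB⟩ := hx
  have hl' : ∀ y ∈ l, y ∈ A \ thickening (ε / 2) B := by
    refine fun y hy => ⟨hl.1 y hy, fun hyB => hxB ?_⟩
    obtain ⟨b, hb, hyb⟩ := mem_thickening_iff.1 hyB
    refine mem_thickening_iff.2 ⟨b, hb, ?_⟩
    have := hl.2 x hxl y hy
    linarith [dist_triangle x y b, min_le_right ζ (ε / 2)]
  rw [transport, if_pos fun y hy => diff_thickening_subset (half_pos hε) (hl' y hy)]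
  refine hg _ ⟨fun y hy => ?_, fun y hy z hz => ?_⟩
  · obtain ⟨x, hx, rfl⟩ := List.mem_map.1 hy
    exact (h.maps (diff_thickening_subset (half_pos hε) (hl' x hx))).1
  · obtain ⟨x, hx, rfl⟩ := List.mem_map.1 hy
    obtain ⟨w, hw, rfl⟩ := List.mem_map.1 hz
    exact hu x (hl' x hx) w (hl' w hw) ((hl.2 x hx w hw).trans_le (min_le_left _ _))

theorem RelHomeo.transport_mem_Z {u : M → M'} {v : M' → M} (h : RelHomeo A B A' B' u v)
    (hA : IsCompact A) (hB : IsCompact B) (hA' : IsCompact A') {p : ℕ}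
    {f : List M' → ℚ} (hf : f ∈ Z p A' B') {ε' : ℝ} (hε' : 0 < ε') (hs : Supp ε' A' B' f) :
    transport A B u f ∈ Z p A B := by
  obtain ⟨ε, hε, hs1⟩ := h.supp hA' hB hε' hs
  obtain ⟨ε₂, hε₂, hs2⟩ := h.supp hA' hB hε' hs.delta
  obtain ⟨_, hf2, hf3⟩ := mem_Z.1 hf
  refine mem_Z.2 ⟨hs1.mem_null hε, ?_, ?_⟩
  · rw [← hf2]
    funext l
    simp only [transport, trunc_apply, List.length_map]
    split_ifs <;> rfl
  · have := add_mem (transport_delta_sub_mem hε hs1)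
      (h.transport_mem_null hA hε₂ hs2 hf3)
    rwa [sub_add_cancel] at this

theorem RelHomeo.transport_mem_Bd {u : M → M'} {v : M' → M} (h : RelHomeo A B A' B' u v)
    (hA : IsCompact A) (hB : IsCompact B) (hA' : IsCompact A')
    (hB' : IsCompact B') (hBA' : B' ⊆ A') {f : List M' → ℚ} (hf : f ∈ Bd A' B') {ε' : ℝ} (hε' : 0 < ε')
    (hs : Supp ε' A' B' f) : transport A B u f ∈ Bd A B := by
  obtain ⟨g, ⟨ε, hε, hg⟩, hn⟩ := exists_supp_of_mem_Bd hB' hBA' hf hε' hs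
  obtain ⟨ε₂, hε₂, hs2⟩ := h.supp hA' hB hε hg
  have hm : Supp (min ε' ε) A' B' (f - delta g) := fun l hl => by
    rw [Pi.sub_apply, hs.mono (min_le_left _ _) l hl, hg.delta.mono (min_le_right _ _) l hl,
      sub_zero]
  obtain ⟨ε₃, hε₃, hs3⟩ := h.supp hA' hB (lt_min hε' hε) hm
  have h1 := h.transport_mem_null hA hε₃ hs3 hn
  have h2 := transport_delta_sub_mem hε₂ hs2
  refine mem_Bd.2 ⟨_, hs2.mem_null hε₂, ?_⟩
  have := sub_mem h1 h2
  rw [transport_sub] at this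
  convert this using 1
  abel

theorem RelHomeo.sub_transport_mem_null {u : M → M'} {v : M' → M} (h : RelHomeo A B A' B' u v)
    {f : List M' → ℚ} {ε' : ℝ} (hε' : 0 < ε') (hs : Supp ε' A' B' f) :
    f - transport A' B' v (transport A B u f) ∈ Null A' := by
  refine ⟨ε', hε', fun l hl => ?_⟩
  rw [Pi.sub_apply, transport]
  split_ifs with hx
  · rw [transport, if_pos, List.map_map, List.map_congr_left (g := id), List.map_id, sub_self]
    · exact fun x hxl => h.right (hx x hxl)
    · intro y hy
      obtain ⟨x, hxl, rfl⟩ := List.mem_map.1 hy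
      exact h.maps' (hx x hxl)
  · push Not at hx
    obtain ⟨x, hxl, hx⟩ := hx
    have hxB : x ∈ B' := by
      by_contra hb
      exact hx ⟨hl.1 x hxl, hb⟩
    rw [sub_zero]
    exact hs l fun y hy hy' => hy'.2 (mem_thickening_iff.2 ⟨x, hxB, hl.2 y hy x hxl⟩)

/-- Weakly compactly supported cocycles. -/
def Zs (p : ℕ) (A B : Set M) : Submodule ℚ (List M → ℚ) where
  carrier := {f | f ∈ Z p A B ∧ ∃ ε > 0, Supp ε A B f}
  zero_mem' := ⟨zero_mem _, 1, one_pos, fun _ _ => rfl⟩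
  add_mem' := by
    rintro f g ⟨hf, ε, hε, hsf⟩ ⟨hg, ε', hε', hsg⟩
    refine ⟨add_mem hf hg, min ε ε', lt_min hε hε', fun l hl => ?_⟩
    rw [Pi.add_apply, hsf.mono (min_le_left _ _) l hl, hsg.mono (min_le_right _ _) l hl, add_zero]
  smul_mem' := by
    rintro c f ⟨hf, ε, hε, hs⟩
    exact ⟨Submodule.smul_mem _ c hf, ε, hε, fun l hl => by simp [hs l hl]⟩

/-- The transport of supported cocycles into cohomology. -/
noncomputable def RelHomeo.map {u : M → M'} {v : M' → M} (h : RelHomeo A B A' B' u v)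
    (hA : IsCompact A) (hB : IsCompact B) (hA' : IsCompact A') (p : ℕ) :
    Zs p A' B' →ₗ[ℚ] H p A B where
  toFun f := Submodule.Quotient.mk ⟨transport A B u f.1, by
    obtain ⟨ε, hε, hs⟩ := f.2.2
    exact h.transport_mem_Z hA hB hA' f.2.1 hε hs⟩
  map_add' f g := by
    rw [← Submodule.Quotient.mk_add]
    congr 2
    funext l
    change transport A B u (f.1 + g.1) l = transport A B u f.1 l + transport A B u g.1 l
    simp only [transport, Pi.add_apply]
    split_ifs <;> simp
  map_smul' c f := by
    rw [RingHom.id_apply, ← Submodule.Quotient.mk_smul]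
    congr 2
    funext l
    change transport A B u (c • f.1) l = c * transport A B u f.1 l
    simp only [transport, Pi.smul_apply, smul_eq_mul]
    split_ifs <;> simp

/-- Transport along `u` and then `v` changes a supported cochain by a null one. Together with
supported representatives and primitives this gives surjectivity and the kernel. -/
theorem RelHomeo.nonempty_linearEquiv_quot {u : M → M'} {v : M' → M}
    (h : RelHomeo A B A' B' u v) (hA : IsCompact A) (hB : IsCompact B) (hBA : B ⊆ A)
    (hA' : IsCompact A') (hB' : IsCompact B') (hBA' : B' ⊆ A') (p : ℕ) :
    Nonempty ((Zs p A' B' ⧸ (Bd A' B').comap (Zs p A' B').subtype) ≃ₗ[ℚ] H p A B) := by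
  have hsurj : Function.Surjective (h.map hA hB hA' p) := by
    intro x
    obtain ⟨⟨f, hf⟩, rfl⟩ := Submodule.Quotient.mk_surjective _ x
    obtain ⟨f', hf', ⟨ε, hε, hs⟩, hb⟩ := exists_supp_of_mem_Z hB hBA hf
    have hm := h.symm.transport_mem_Z hA' hB' hA hf' hε hs
    refine ⟨⟨transport A' B' v f', hm, h.symm.supp hA hB' hε hs⟩, ?_⟩
    refine (Submodule.Quotient.eq _).2 ?_
    change transport A B u (transport A' B' v f') - f ∈ Bd A B
    have := neg_mem (add_mem hb (null_le_Bd A B (h.symm.sub_transport_mem_null hε hs)))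
    convert this using 1
    abel
  have hker : LinearMap.ker (h.map hA hB hA' p) =
      (Bd A' B').comap (Zs p A' B').subtype := by
    ext ⟨f, hf, ε, hε, hs⟩
    rw [LinearMap.mem_ker, Submodule.mem_comap]
    refine mk_eq_zero_iff.trans ?_
    change transport A B u f ∈ Bd A B ↔ f ∈ Bd A' B'
    constructor
    · intro hb
      obtain ⟨ε₂, hε₂, hs2⟩ := h.supp hA' hB hε hs
      have := add_mem (null_le_Bd A' B' (h.sub_transport_mem_null hε hs))
        (h.symm.transport_mem_Bd hA' hB' hA hB hBA hb hε₂ hs2)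
      rwa [sub_add_cancel] at this
    · exact fun hb => h.transport_mem_Bd hA hB hA' hB' hBA' hb hε hs
  exact ⟨(Submodule.quotEquivOfEq _ _ hker.symm).trans
    ((h.map hA hB hA' p).quotKerEquivOfSurjective hsurj)⟩

theorem relHomeo_id (A B : Set M) : RelHomeo A B A B id id :=
  ⟨mapsTo_id _, mapsTo_id _, fun _ _ => rfl, fun _ _ => rfl, continuousOn_id, continuousOn_id⟩

/-- The cohomology of a compact pair depends only on the difference. -/
theorem RelHomeo.nonempty_linearEquiv {u : M → M'} {v : M' → M}
    (h : RelHomeo A B A' B' u v) (hA : IsCompact A) (hB : IsCompact B) (hBA : B ⊆ A)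
    (hA' : IsCompact A') (hB' : IsCompact B') (hBA' : B' ⊆ A') (p : ℕ) :
    Nonempty (H p A' B' ≃ₗ[ℚ] H p A B) := by
  obtain ⟨e⟩ := h.nonempty_linearEquiv_quot hA hB hBA hA' hB' hBA' p
  -- The identity map shows that the supported cocycles compute the cohomology of `(A', B')` itself.
  obtain ⟨e'⟩ := (relHomeo_id A' B').nonempty_linearEquiv_quot hA' hB' hBA' hA' hB' hBA' p
  exact ⟨e'.symm.trans e⟩

theorem nonempty_linearEquiv_of_homeomorph [Nonempty M] [Nonempty M']
    (e : ↥(A \ B) ≃ₜ ↥(A' \ B')) (hA : IsCompact A) (hB : IsCompact B) (hBA : B ⊆ A)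
    (hA' : IsCompact A') (hB' : IsCompact B') (hBA' : B' ⊆ A') (p : ℕ) :
    Nonempty (H p A' B' ≃ₗ[ℚ] H p A B) := by
  classical
  -- Values outside the difference are never used.
  let u : M → M' := fun x => if hx : x ∈ A \ B then e ⟨x, hx⟩ else Classical.arbitrary M'
  let v : M' → M := fun x => if hx : x ∈ A' \ B' then e.symm ⟨x, hx⟩ else Classical.arbitrary M
  have hu : ∀ x (hx : x ∈ A \ B), u x = e ⟨x, hx⟩ := fun x hx => dif_pos hx
  have hv : ∀ x (hx : x ∈ A' \ B'), v x = e.symm ⟨x, hx⟩ := fun x hx => dif_pos hx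
  have h : RelHomeo A B A' B' u v := by
    refine ⟨fun x hx => ?_, fun x hx => ?_, fun x hx => ?_, fun x hx => ?_, ?_, ?_⟩
    · rw [hu x hx]; exact (e ⟨x, hx⟩).2
    · rw [hv x hx]; exact (e.symm ⟨x, hx⟩).2
    · rw [hu x hx, hv _ (e ⟨x, hx⟩).2]; simp
    · rw [hv x hx, hu _ (e.symm ⟨x, hx⟩).2]; simp
    · rw [continuousOn_iff_continuous_domRestrict]
      have : (A \ B).domRestrict u = fun x => (e x : M') := by
        funext x; exact hu x.1 x.2
      rw [this]
      exact continuous_subtype_val.comp e.continuous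
    · rw [continuousOn_iff_continuous_domRestrict]
      have : (A' \ B').domRestrict v = fun x => (e.symm x : M) := by
        funext x; exact hv x.1 x.2
      rw [this]
      exact continuous_subtype_val.comp e.symm.continuous
  exact h.nonempty_linearEquiv hA hB hBA hA' hB' hBA' p

end Transport

end ListCochain

/-! ### Homotopy, suspension and filtrations by even-dimensional cells -/

namespace ListCochain

open Metric Set

variable {M : Type*} [MetricSpace M]

/-- Pullbacks of a cocycle along two non-expanding maps of pairs that are close to each other
are cohomologous. -/
theorem pull_sub_pull_mem_Bd {A B : Set M} {φ ψ : M → M} (hφA : MapsTo φ A A)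
    (hφB : MapsTo φ B B) (hψA : MapsTo ψ A A) (hψB : MapsTo ψ B B)
    (hφ : ∀ x y, dist (φ x) (φ y) ≤ dist x y) (hψ : ∀ x y, dist (ψ x) (ψ y) ≤ dist x y)
    {ε : ℝ} (hε : 0 < ε) (hd : ∀ x, dist (φ x) (ψ x) ≤ ε / 2) {f : List M → ℚ}
    (hf : ∀ l, Small ε B l → f l = 0) (hdf : ∀ l, Small ε A l → delta f l = 0) :
    pull ψ f - pull φ f ∈ Bd A B := by
  have key : ∀ C : Set M, MapsTo φ C C → MapsTo ψ C C → ∀ g : List M → ℚ,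
      (∀ l, Small ε C l → g l = 0) → prism φ ψ g ∈ Null C := by
    intro C hφC hψC g hg
    refine ⟨ε / 2, half_pos hε, fun l hl => prism_eq_zero fun m hm => hg m ⟨fun y hy => ?_,
      fun y hy z hz => ?_⟩⟩
    · obtain ⟨x, hx, rfl | rfl⟩ := hm y hy
      · exact hφC (hl.1 x hx)
      · exact hψC (hl.1 x hx)
    · obtain ⟨x, hx, hxy⟩ := hm y hy
      obtain ⟨w, hw, hwz⟩ := hm z hz
      have h0 := hl.2 x hx w hw
      have h1 := hφ x w
      have h2 := hψ x w
      have h3 := hd x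
      have h4 := hd w
      rcases hxy with rfl | rfl <;> rcases hwz with rfl | rfl
      · linarith
      · linarith [dist_triangle (φ x) (φ w) (ψ w)]
      · linarith [dist_triangle (ψ x) (φ x) (φ w), dist_comm (ψ x) (φ x)]
      · linarith
  rw [← delta_prism]
  exact add_mem (delta_mem_Bd (key B hφB hψB f hf)) (null_le_Bd _ _ (key A hφA hψA _ hdf))

/-- The pair `[0,1] × (A, B)` relative to the bottom has no cohomology. -/
theorem Z_le_Bd_cylinder (p : ℕ) (A B : Set M) :
    Z p (Icc (0 : ℝ) 1 ×ˢ A) (Icc (0 : ℝ) 1 ×ˢ B ∪ {0} ×ˢ A) ≤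
      Bd (Icc (0 : ℝ) 1 ×ˢ A) (Icc (0 : ℝ) 1 ×ˢ B ∪ {0} ×ˢ A) := by
  intro f hf
  set A' := Icc (0 : ℝ) 1 ×ˢ A
  set B' := Icc (0 : ℝ) 1 ×ˢ B ∪ {0} ×ˢ A
  obtain ⟨⟨ε₁, hε₁, hf1⟩, -, ε₂, hε₂, hf2⟩ := mem_Z.1 hf
  set ε := min ε₁ ε₂
  have hε : 0 < ε := lt_min hε₁ hε₂
  have hf1' : ∀ l, Small ε B' l → f l = 0 := fun l hl =>
    hf1 l (hl.mono (min_le_left _ _) subset_rfl)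
  have hf2' : ∀ l, Small ε A' l → delta f l = 0 := fun l hl =>
    hf2 l (hl.mono (min_le_right _ _) subset_rfl)
  obtain ⟨N, hN⟩ := exists_nat_one_div_lt (half_pos hε)
  -- The contraction to the bottom is cut into steps of size `1 / (N + 1) < ε / 2`, so that
  -- `pull_sub_pull_mem_Bd` applies to each. The map `φ 0` lands in the bottom, and `φ (N + 1)` is
  -- the identity on `A'`.
  let φ : ℕ → ℝ × M → ℝ × M := fun k x => (min x.1 (k / (N + 1 : ℝ)), x.2)
  have hpos : (0 : ℝ) < N + 1 := by positivity
  have hA : ∀ k, MapsTo (φ k) A' A' := fun k x hx =>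
    ⟨⟨le_min hx.1.1 (by positivity), (min_le_left _ _).trans hx.1.2⟩, hx.2⟩
  have hB : ∀ k, MapsTo (φ k) B' B' := by
    rintro k x (hx | hx)
    · exact Or.inl ⟨⟨le_min hx.1.1 (by positivity), (min_le_left _ _).trans hx.1.2⟩, hx.2⟩
    · refine Or.inr ⟨?_, hx.2⟩
      have : x.1 = 0 := hx.1
      change min x.1 _ = 0
      rw [this]
      exact min_eq_left (by positivity)
  have hφ : ∀ k x y, dist (φ k x) (φ k y) ≤ dist x y := by
    intro k x y
    refine max_le_max ?_ le_rfl
    rw [Real.dist_eq, Real.dist_eq]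
    simpa using abs_min_sub_min_le_max x.1 (k / (N + 1 : ℝ)) y.1 (k / (N + 1 : ℝ))
  have hd : ∀ k x, dist (φ k x) (φ (k + 1) x) ≤ ε / 2 := by
    intro k x
    refine max_le ?_ (by simp [φ, (half_pos hε).le])
    rw [Real.dist_eq]
    refine (abs_min_sub_min_le_max _ _ _ _).trans (max_le (by simp [(half_pos hε).le]) ?_)
    rw [abs_sub_comm, ← sub_div]
    push_cast
    rw [add_sub_cancel_left, abs_of_pos (by positivity)]
    exact hN.le
  have hk : ∀ k, pull (φ k) f ∈ Bd A' B' := by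
    intro k
    induction k with
    | zero =>
      refine null_le_Bd _ _ ⟨ε, hε, fun l hl => hf1' _ ⟨fun y hy => ?_, fun y hy z hz => ?_⟩⟩
      · obtain ⟨x, hx, rfl⟩ := List.mem_map.1 hy
        have := hl.1 x hx
        refine Or.inr ⟨?_, this.2⟩
        change min x.1 _ = 0
        rw [Nat.cast_zero, zero_div]
        exact min_eq_right this.1.1
      · obtain ⟨x, hx, rfl⟩ := List.mem_map.1 hy
        obtain ⟨w, hw, rfl⟩ := List.mem_map.1 hz
        exact (hφ 0 x w).trans_lt (hl.2 x hx w hw)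
    | succ k ih =>
      have := pull_sub_pull_mem_Bd (hA k) (hB k) (hA (k + 1)) (hB (k + 1)) (hφ k) (hφ (k + 1)) hε
        (hd k) hf1' hf2'
      have := add_mem this ih
      rwa [sub_add_cancel] at this
  have h1 : pull (φ (N + 1)) f - f ∈ Null A' := by
    refine ⟨1, one_pos, fun l hl => ?_⟩
    rw [Pi.sub_apply, pull, List.map_congr_left (g := id), List.map_id, sub_self]
    intro x hx
    refine Prod.ext ?_ rfl
    change min x.1 _ = x.1
    rw [Nat.cast_add, Nat.cast_one, div_self hpos.ne']
    exact min_eq_left (hl.1 x hx).1.2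
  have := sub_mem (hk (N + 1)) (null_le_Bd A' B' h1)
  rwa [sub_sub_cancel] at this

/-- The suspension isomorphism for compact pairs. -/
theorem nonempty_suspension [Nonempty M] {A B : Set M} (hA : IsCompact A) (hB : IsCompact B)
    (hBA : B ⊆ A) (p : ℕ) :
    Nonempty (H p A B ≃ₗ[ℚ]
      H (p + 1) (Icc (0 : ℝ) 1 ×ˢ A) (Icc (0 : ℝ) 1 ×ˢ B ∪ {0, 1} ×ˢ A)) := by
  set A' := Icc (0 : ℝ) 1 ×ˢ A
  set B' := Icc (0 : ℝ) 1 ×ˢ B ∪ {0, 1} ×ˢ A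
  set C := Icc (0 : ℝ) 1 ×ˢ B ∪ {0} ×ˢ A
  have hCB : C ⊆ B' := union_subset_union_right _ (prod_mono (by simp) subset_rfl)
  have hBA' : B' ⊆ A' := by
    refine union_subset (prod_mono subset_rfl hBA) (prod_mono ?_ subset_rfl)
    rintro x (rfl | rfl) <;> simp
  -- The subset `C` is `B'` without the interior of its top face. The cylinder is acyclic relative
  -- to `C`, so the cohomology of `(B', C)` shifts to that of `(A', B')`; and `B' \ C` is a copy of
  -- `A \ B`.
  obtain ⟨e1⟩ := nonempty_connecting hCB hBA' (Z_le_Bd_cylinder p A B)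
    (Z_le_Bd_cylinder (p + 1) A B)
  have hC : IsCompact C := (isCompact_Icc.prod hB).union (isCompact_singleton.prod hA)
  have hB' : IsCompact B' :=
    (isCompact_Icc.prod hB).union ((Set.toFinite {(0 : ℝ), 1}).isCompact.prod hA)
  have hr : RelHomeo B' C A B Prod.snd (fun x => ((1 : ℝ), x)) := by
    have hmem : ∀ x ∈ B' \ C, x.1 = 1 ∧ x.2 ∈ A \ B := by
      rintro ⟨t, x⟩ ⟨h | h, hC⟩
      · exact absurd (Or.inl h) hC
      · rcases h.1 with h0 | h1
        · exact absurd (Or.inr ⟨h0, h.2⟩) hC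
        · refine ⟨h1, h.2, fun hx => hC (Or.inl ⟨?_, hx⟩)⟩
          have h1' : t = 1 := h1
          simp [h1']
    refine ⟨fun x hx => (hmem x hx).2, fun x hx => ⟨Or.inr ⟨by simp, hx.1⟩, ?_⟩,
      fun x hx => Prod.ext (hmem x hx).1.symm rfl, fun x hx => rfl, continuous_snd.continuousOn,
      (by fun_prop)⟩
    rintro (h | h)
    · exact hx.2 h.2
    · exact one_ne_zero h.1
  obtain ⟨e2⟩ := hr.nonempty_linearEquiv hB' hC hCB hA hB hBA p
  exact ⟨e2.trans e1⟩

/-- The cohomology of a point. -/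
theorem finrank_H_point (p : ℕ) :
    Module.Finite ℚ (H p (univ : Set Unit) ∅) ∧
      Module.finrank ℚ (H p (univ : Set Unit) ∅) = if p = 1 then 1 else 0 := by
  by_cases hp : p = 1
  · subst hp
    let ev : Z 1 (univ : Set Unit) ∅ →ₗ[ℚ] ℚ :=
      { toFun := fun f => f.1 [()]
        map_add' := fun _ _ => rfl
        map_smul' := fun _ _ => rfl }
    have hsurj : Function.Surjective ev := by
      intro c
      refine ⟨⟨fun l => if l.length = 1 then c else 0, mem_Z.2 ⟨⟨1, one_pos, fun l hl => ?_⟩, ?_,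
        ⟨1, one_pos, fun l hl => ?_⟩⟩⟩, by simp [ev]⟩
      · cases l with
        | nil => simp
        | cons x l => exact absurd (hl.1 x (by simp)) (by simp)
      · funext l
        simp only [trunc_apply]
        split_ifs <;> rfl
      · rcases l with - | ⟨x, - | ⟨y, - | ⟨z, l⟩⟩⟩
        · rfl
        · simp [delta_cons]
        · simp [delta_cons]
        · change delta (trunc 1 fun _ => c) _ = 0
          rw [← trunc_succ_delta]
          simp [trunc_apply]
    have hker : LinearMap.ker ev = (Bd univ ∅).comap (Z 1 (univ : Set Unit) ∅).subtype := by
      ext ⟨f, hf⟩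
      rw [LinearMap.mem_ker, Submodule.mem_comap]
      change f [()] = 0 ↔ f ∈ Bd univ ∅
      constructor
      · intro h
        have : f = 0 := by
          rw [← (mem_Z.1 hf).2.1]
          funext l
          rw [trunc_apply]
          split_ifs with hl
          · obtain ⟨x, rfl⟩ := List.length_eq_one_iff.1 hl
            exact h
          · rfl
        rw [this]; exact zero_mem _
      · intro h
        obtain ⟨g, hg, hn⟩ := mem_Bd.1 h
        obtain ⟨ε, hε, hn⟩ := hn
        have := hn [()] ⟨by simp, by simpa using hε⟩
        simpa [delta_cons, apply_nil_of_mem_null hg] using this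
    let e := (Submodule.quotEquivOfEq _ _ hker.symm).trans (ev.quotKerEquivOfSurjective hsurj)
    exact ⟨Module.Finite.equiv e.symm, by rw [e.finrank_eq]; simp⟩
  · have : Z p (univ : Set Unit) ∅ ≤ Bd univ ∅ := by
      intro f hf
      obtain ⟨hf1, hf2, ε, hε, hf3⟩ := mem_Z.1 hf
      have h1 : f [()] = 0 := by
        rw [← hf2, trunc_apply, if_neg]
        exact fun h => hp h.symm
      -- Prepending the point is a contraction: `f l - δ(f (() :: ·)) l = δf (() :: l)`. The
      -- primitive must vanish on the empty list, which is where `p ≠ 1` enters.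
      refine mem_Bd.2 ⟨fun m => f (() :: m), ⟨1, one_pos, fun l hl => ?_⟩, 1, one_pos,
        fun l hl => ?_⟩
      · cases l with
        | nil => exact h1
        | cons x l => exact absurd (hl.1 x (by simp)) (by simp)
      · have := hf3 (() :: l) ⟨fun _ _ => mem_univ _, fun x _ y _ => by simpa using hε⟩
        rwa [delta_cons] at this
    have := subsingleton_H_iff.2 this
    exact ⟨inferInstance, by rw [if_neg hp]; exact Module.finrank_zero_of_subsingleton⟩

/-- A compact pair whose difference is `ℝ^m`, with its cohomology. -/
theorem exists_model (m : ℕ) : ∃ (M : Type) (_ : MetricSpace M) (_ : Nonempty M) (A B : Set M),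
    IsCompact A ∧ IsCompact B ∧ B ⊆ A ∧ Nonempty (↥(A \ B) ≃ₜ (Fin m → ℝ)) ∧
    ∀ p, Module.Finite ℚ (H p A B) ∧
      Module.finrank ℚ (H p A B) = if p = m + 1 then 1 else 0 := by
  induction m with
  | zero =>
    refine ⟨Unit, inferInstance, inferInstance, univ, ∅, isCompact_univ, isCompact_empty,
      empty_subset _, ?_, finrank_H_point⟩
    rw [sdiff_empty]
    exact ⟨(Homeomorph.Set.univ Unit).trans (Homeomorph.homeomorphOfUnique _ _)⟩
  | succ m ih =>
    obtain ⟨M, _, _, A, B, hA, hB, hBA, ⟨e⟩, h⟩ := ih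
    refine ⟨ℝ × M, inferInstance, inferInstance, Icc (0 : ℝ) 1 ×ˢ A,
      Icc (0 : ℝ) 1 ×ˢ B ∪ {0, 1} ×ˢ A, isCompact_Icc.prod hA,
      (isCompact_Icc.prod hB).union ((Set.toFinite {(0 : ℝ), 1}).isCompact.prod hA), ?_, ?_, ?_⟩
    · refine union_subset (prod_mono subset_rfl hBA) (prod_mono ?_ subset_rfl)
      rintro x (rfl | rfl) <;> simp
    · have hset : Icc (0 : ℝ) 1 ×ˢ A \ (Icc (0 : ℝ) 1 ×ˢ B ∪ {0, 1} ×ˢ A) =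
          Ioo (0 : ℝ) 1 ×ˢ (A \ B) := by
        ext ⟨t, x⟩
        simp only [mem_sdiff, mem_prod, mem_union, mem_Icc, mem_Ioo, mem_insert_iff,
          mem_singleton_iff]
        constructor
        · rintro ⟨⟨⟨h0, h1⟩, hx⟩, h2⟩
          push Not at h2
          refine ⟨⟨lt_of_le_of_ne h0 fun h => ?_, lt_of_le_of_ne h1 fun h => ?_⟩, hx,
            h2.1 ⟨h0, h1⟩⟩
          · exact h2.2 (Or.inl h.symm) hx
          · exact h2.2 (Or.inr h) hx
        · rintro ⟨⟨h0, h1⟩, hx, hxB⟩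
          refine ⟨⟨⟨h0.le, h1.le⟩, hx⟩, ?_⟩
          rintro (h | h)
          · exact hxB h.2
          · rcases h.1 with h | h <;> linarith
      rw [hset]
      -- The map `t ↦ 2t - 1` carries the interval to the unit ball of `ℝ`.
      have e1 : ↥(Ioo (0 : ℝ) 1) ≃ₜ ℝ :=
        ((affineHomeomorph (2 : ℝ) (-1) two_ne_zero).subtype (q := (· ∈ ball (0 : ℝ) 1)) (by
          intro x
          simp only [Real.ball_eq_Ioo, mem_Ioo, affineHomeomorph_apply]
          constructor <;> rintro ⟨h0, h1⟩ <;> constructor <;> linarith)).trans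
            Homeomorph.unitBall.symm
      have e2 : ℝ × (Fin m → ℝ) ≃ₜ (Fin (m + 1) → ℝ) :=
        ((Homeomorph.prodComm _ _).trans ((Homeomorph.refl _).prodCongr
          (Homeomorph.funUnique (Fin 1) ℝ).symm)).trans (Fin.appendHomeomorph m 1)
      exact ⟨((Homeomorph.Set.prod _ _).trans (e1.prodCongr e)).trans e2⟩
    · intro p
      cases p with
      | zero =>
        have := subsingleton_H_iff.2 (Z_zero_le (Icc (0 : ℝ) 1 ×ˢ A)
          (Icc (0 : ℝ) 1 ×ˢ B ∪ {0, 1} ×ˢ A))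
        exact ⟨inferInstance, by simpa using Module.finrank_zero_of_subsingleton⟩
      | succ p =>
        obtain ⟨e'⟩ := nonempty_suspension hA hB hBA p
        have := (h p).1
        refine ⟨Module.Finite.equiv e', ?_⟩
        rw [← e'.finrank_eq, (h p).2]
        simp

/-- The cohomology of a compact pair whose difference is `ℝ^m`. -/
theorem finrank_H_cell [Nonempty M] {A B : Set M} (hA : IsCompact A) (hB : IsCompact B)
    (hBA : B ⊆ A) {m : ℕ} (e : ↥(A \ B) ≃ₜ (Fin m → ℝ)) (p : ℕ) :
    Module.Finite ℚ (H p A B) ∧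
      Module.finrank ℚ (H p A B) = if p = m + 1 then 1 else 0 := by
  obtain ⟨M', _, _, A', B', hA', hB', hBA', ⟨e'⟩, h⟩ := exists_model m
  obtain ⟨i⟩ := nonempty_linearEquiv_of_homeomorph (e'.trans e.symm) hA' hB' hBA' hA hB hBA p
  have := (h p).1
  exact ⟨Module.Finite.equiv i.symm, by rw [i.finrank_eq, (h p).2]⟩

theorem Z_le_Bd_of_finrank {A B : Set M} {p : ℕ} (h : Module.Finite ℚ (H p A B))
    (h0 : Module.finrank ℚ (H p A B) = 0) : Z p A B ≤ Bd A B :=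
  subsingleton_H_iff.1 (Module.finrank_zero_iff.1 h0)

/-- The cohomology of a compact space with a filtration by even-dimensional cells. -/
theorem finrank_H_filtration [Nonempty M] {A : ℕ → Set M} (N : ℕ) (d : ℕ → ℕ) (h0 : A 0 = ∅)
    (hA : ∀ i ≤ N, IsCompact (A i)) (hmono : ∀ i < N, A i ⊆ A (i + 1))
    (e : ∀ i < N, Nonempty (↥(A (i + 1) \ A i) ≃ₜ (Fin (2 * d i) → ℝ))) (p : ℕ) :
    Module.Finite ℚ (H p (A N) ∅) ∧ Module.finrank ℚ (H p (A N) ∅) =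
      ((Finset.range N).filter fun i => p = 2 * d i + 1).card := by
  induction N generalizing p with
  | zero =>
    have : Z p (A 0) ∅ ≤ Bd (A 0) ∅ := by
      intro f hf
      rw [h0] at hf ⊢
      exact null_le_Bd _ _ (mem_Z.1 hf).1
    have := subsingleton_H_iff.2 this
    exact ⟨inferInstance, by simpa using Module.finrank_zero_of_subsingleton⟩
  | succ N ih =>
    have ih := ih (fun i hi => hA i (by omega)) (fun i hi => hmono i (by omega))
      (fun i hi => e i (by omega))
    obtain ⟨e'⟩ := e N (by omega)
    have hm := hmono N (by omega)
    have hc := finrank_H_cell (hA (N + 1) le_rfl) (hA N (by omega)) hm e'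
    -- Lists of length `q` have degree `q - 1`, so even `q` means odd degree.
    have hodd : ∀ q, q % 2 = 0 → Z q (A N) ∅ ≤ Bd (A N) ∅ := by
      intro q hq
      refine Z_le_Bd_of_finrank (ih q).1 ?_
      rw [(ih q).2, Finset.card_eq_zero, Finset.filter_eq_empty_iff]
      intro i _ h
      omega
    have hodd' : ∀ q, q % 2 = 0 → Z q (A (N + 1)) (A N) ≤ Bd (A (N + 1)) (A N) := by
      intro q hq
      refine Z_le_Bd_of_finrank (hc q).1 ?_
      rw [(hc q).2, if_neg]
      omega
    have hcard : ((Finset.range (N + 1)).filter fun i => p = 2 * d i + 1).card =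
        (if p = 2 * d N + 1 then 1 else 0) +
          ((Finset.range N).filter fun i => p = 2 * d i + 1).card := by
      rw [Finset.range_add_one, Finset.filter_insert]
      split_ifs
      · rw [Finset.card_insert_of_notMem (by simp), add_comm]
      · rw [zero_add]
    rw [hcard]
    rcases Nat.even_or_odd' p with ⟨q, rfl | rfl⟩
    · have := subsingleton_H_iff.2 (Z_le_Bd_triple (empty_subset _) hm
        (hodd' (2 * q) (by omega)) (hodd (2 * q) (by omega)))
      refine ⟨inferInstance, ?_⟩
      rw [Module.finrank_zero_of_subsingleton, ← (ih _).2, ← (hc _).2]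
      have h1 := subsingleton_H_iff.2 (hodd' (2 * q) (by omega))
      have h2 := subsingleton_H_iff.2 (hodd (2 * q) (by omega))
      rw [Module.finrank_zero_of_subsingleton, Module.finrank_zero_of_subsingleton]
    · rw [← (ih _).2, ← (hc _).2]
      exact finrank_H_triple (empty_subset _) hm (hodd (2 * q) (by omega))
        (hodd' (2 * q + 2) (by omega)) (hc _).1 (ih _).1

end ListCochain

/-! ### Comparison with the cohomology of tuples of points -/

namespace ListCochain

open Metric Set

variable {M : Type*}

theorem delta_ofFn {q : ℕ} (g : List M → ℚ) (y : Fin (q + 1) → M) :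
    delta g (List.ofFn y) =
      ∑ i : Fin (q + 1), (-1) ^ (i : ℕ) * g (List.ofFn fun j => y (i.succAbove j)) := by
  induction q generalizing g with
  | zero => simp [delta_cons]
  | succ q ih =>
    rw [List.ofFn_succ, delta_cons, ih, Fin.sum_univ_succ (n := q + 1), sub_eq_add_neg,
      ← Finset.sum_neg_distrib]
    congr 1
    · simp [Fin.zero_succAbove]
    · refine Finset.sum_congr rfl fun i _ => ?_
      rw [List.ofFn_succ]
      simp only [Fin.succ_succAbove_zero, Fin.succ_succAbove_succ, Fin.val_succ]
      ring

variable {X : Type} (j : X → M)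

/-- Restriction of functions on lists of points of `M` to tuples of points of `X`. -/
def restr (p : ℕ) : (List M → ℚ) →ₗ[ℚ] RatCoh.Cochain X p where
  toFun g := fun x => g (List.ofFn fun i => j (x i))
  map_add' _ _ := rfl
  map_smul' _ _ := rfl

theorem restr_apply (p : ℕ) (g : List M → ℚ) (x : Fin (p + 1) → X) :
    restr j p g x = g (List.ofFn fun i => j (x i)) := rfl

theorem restr_delta (p : ℕ) (g : List M → ℚ) :
    restr j (p + 1) (delta g) = RatCoh.coboundary X p (restr j p g) := by
  funext x
  exact delta_ofFn g fun i => j (x i)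

variable {j}

/-- Extension by zero from lists of points in the image of `j`; injectivity makes the chosen
preimage the right one. -/
theorem exists_restr_eq (hj : Function.Injective j) (p : ℕ) (f : RatCoh.Cochain X p) :
    ∃ g : List M → ℚ, trunc (p + 1) g = g ∧ restr j p g = f := by
  classical
  refine ⟨fun l => if h : ∃ x : Fin (p + 1) → X, l = List.ofFn fun i => j (x i) then f h.choose
    else 0, ?_, ?_⟩
  · funext l
    rw [trunc_apply]
    split_ifs with h1 h2 h2
    · rfl
    · rfl
    · obtain ⟨x, rfl⟩ := h2
      simp at h1
    · rfl
  · funext x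
    have h : ∃ y : Fin (p + 1) → X, (List.ofFn fun i => j (x i)) = List.ofFn fun i => j (y i) :=
      ⟨x, rfl⟩
    refine (dif_pos h).trans ?_
    congr 1
    funext i
    exact (hj (congrFun (List.ofFn_injective h.choose_spec) i)).symm

variable [MetricSpace M] [TopologicalSpace X]

theorem restr_mem_locallyZero (hj : Continuous j) {p : ℕ} {g : List M → ℚ}
    (hg : g ∈ Null (range j)) : restr j p g ∈ RatCoh.locallyZero X p := by
  obtain ⟨ε, hε, h⟩ := hg
  intro x
  refine ⟨j ⁻¹' ball (j x) (ε / 2), hj.continuousAt.preimage_mem_nhds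
    (ball_mem_nhds _ (half_pos hε)), fun s hs => h _ ⟨fun y hy => ?_, fun y hy z hz => ?_⟩⟩
  · obtain ⟨i, rfl⟩ := List.mem_ofFn.1 hy
    exact mem_range_self _
  · obtain ⟨i, rfl⟩ := List.mem_ofFn.1 hy
    obtain ⟨k, rfl⟩ := List.mem_ofFn.1 hz
    have h1 := mem_ball.1 (hs i)
    have h2 := mem_ball'.1 (hs k)
    linarith [dist_triangle (j (s i)) (j x) (j (s k))]

/-- A Lebesgue number of the cover on which the cochain vanishes turns local vanishing into
vanishing below a uniform diameter. -/
theorem mem_null_of_restr [CompactSpace X] (hj : Topology.IsEmbedding j) {p : ℕ}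
    {g : List M → ℚ} (hp : trunc (p + 1) g = g) (hg : restr j p g ∈ RatCoh.locallyZero X p) :
    g ∈ Null (range j) := by
  choose U hU h using hg
  have : ∀ x, ∃ V : Set M, IsOpen V ∧ j x ∈ V ∧ j ⁻¹' V ⊆ U x := by
    intro x
    have := hU x
    rw [hj.nhds_eq_comap, Filter.mem_comap] at this
    obtain ⟨W, hW, hWU⟩ := this
    obtain ⟨V, hVW, hV, hx⟩ := _root_.mem_nhds_iff.1 hW
    exact ⟨V, hV, hx, (preimage_mono hVW).trans hWU⟩
  choose V hV hxV hVU using this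
  obtain ⟨δ, hδ, hL⟩ := lebesgue_number_lemma_of_metric (isCompact_range hj.continuous) hV
    (by rintro _ ⟨x, rfl⟩; exact mem_iUnion.2 ⟨x, hxV x⟩)
  refine ⟨δ, hδ, fun l hl => ?_⟩
  rw [← hp, trunc_apply]
  split_ifs with hlen
  swap
  · rfl
  obtain ⟨y, rfl⟩ : ∃ y : Fin (p + 1) → M, l = List.ofFn y :=
    ⟨fun i => l.get (i.cast hlen.symm), by
      simp only [Fin.cast, List.get_eq_getElem]
      apply List.ext_getElem
      · rw [List.length_ofFn, hlen]
      · intros; rw [List.getElem_ofFn]⟩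
  have hy : ∀ i, ∃ x, j x = y i := fun i => hl.1 _ (List.mem_ofFn.2 ⟨i, rfl⟩)
  choose x hx using hy
  obtain ⟨x₀, h₀⟩ := hL (y 0) ⟨x 0, hx 0⟩
  have := h x₀ x fun i => hVU x₀ (by
    rw [mem_preimage, hx]
    exact h₀ (mem_ball.2 (hl.2 _ (List.mem_ofFn.2 ⟨i, rfl⟩) _ (List.mem_ofFn.2 ⟨0, rfl⟩))))
  rw [restr_apply] at this
  simpa only [hx] using this

theorem mem_null_empty {p : ℕ} {g : List M → ℚ} (hp : trunc (p + 1) g = g) :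
    g ∈ Null (∅ : Set M) := by
  refine ⟨1, one_pos, fun l hl => ?_⟩
  cases l with
  | nil => rw [← hp, trunc_apply, if_neg (by simp)]
  | cons x l => exact absurd (hl.1 x (by simp)) (by simp)

/-- The cohomology of a compact space embedded in a metric space, computed with lists. -/
theorem nonempty_equiv_ratCoh [CompactSpace X] (hj : Topology.IsEmbedding j) (p : ℕ) :
    Nonempty (H (p + 1) (range j) ∅ ≃ₗ[ℚ] RatCoh.H X p) := by
  have hmem : ∀ g ∈ Z (p + 1) (range j) ∅, restr j p g ∈ RatCoh.cocycles X p := by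
    intro g hg
    change RatCoh.coboundary X p (restr j p g) ∈ RatCoh.locallyZero X (p + 1)
    rw [← restr_delta]
    exact restr_mem_locallyZero hj.continuous (mem_Z.1 hg).2.2
  let d : Z (p + 1) (range j) ∅ →ₗ[ℚ] RatCoh.H X p :=
    (Submodule.mkQ _).comp ((restr j p).restrict hmem)
  have hd : Function.Surjective d := by
    intro x
    obtain ⟨⟨f, hf⟩, rfl⟩ := Submodule.Quotient.mk_surjective _ x
    obtain ⟨g, hg, rfl⟩ := exists_restr_eq hj.injective p f
    refine ⟨⟨g, mem_Z.2 ⟨mem_null_empty hg, hg, ?_⟩⟩, rfl⟩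
    refine mem_null_of_restr hj (p := p + 1) (by rw [trunc_succ_delta, hg]) ?_
    rw [restr_delta]
    exact hf
  have hk : LinearMap.ker d = (Bd (range j) ∅).comap (Z (p + 1) (range j) ∅).subtype := by
    ext ⟨g, hg⟩
    rw [LinearMap.mem_ker, Submodule.mem_comap]
    refine (Submodule.Quotient.mk_eq_zero _).trans ?_
    change restr j p g ∈ RatCoh.coboundaries X p ↔ g ∈ Bd (range j) ∅
    have hgp := (mem_Z.1 hg).2.1
    cases p with
    | zero =>
      constructor
      · exact fun h => null_le_Bd _ _ (mem_null_of_restr hj hgp h)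
      · intro h
        obtain ⟨k, hk, hkp, h⟩ := exists_trunc_of_mem_Bd hgp h
        have : k = 0 := by
          rw [← hkp]
          funext l
          rw [trunc_apply]
          split_ifs with hl
          · rw [List.length_eq_zero_iff.1 hl, apply_nil_of_mem_null hk]; rfl
          · rfl
        rw [this, delta_zero, sub_zero] at h
        exact restr_mem_locallyZero hj.continuous h
    | succ p =>
      constructor
      · intro h
        obtain ⟨u, hu, _, ⟨v, rfl⟩, huv⟩ := Submodule.mem_sup.1 h
        obtain ⟨w, hw, rfl⟩ := exists_restr_eq hj.injective p v
        refine mem_Bd.2 ⟨w, mem_null_empty hw, mem_null_of_restr hj (p := p + 1) ?_ ?_⟩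
        · rw [map_sub, hgp, trunc_succ_delta, hw]
        · rw [map_sub, restr_delta, ← huv, add_sub_cancel_right]
          exact hu
      · intro h
        obtain ⟨k, hk, h⟩ := mem_Bd.1 h
        have := restr_mem_locallyZero hj.continuous (p := p + 1) h
        rw [map_sub, restr_delta] at this
        exact Submodule.mem_sup.2 ⟨_, this, _, ⟨_, rfl⟩, sub_add_cancel _ _⟩
  exact ⟨(Submodule.quotEquivOfEq _ _ hk.symm).trans (d.quotKerEquivOfSurjective hd)⟩

end ListCochain

/-! ### The topology of the product of Grassmannians -/

namespace SpFlag

open Matrix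

section Projection

theorem mem_span_row_iff {m ι : Type*} [Fintype m] {A : Matrix m ι ℂ} {v : ι → ℂ} :
    v ∈ Submodule.span ℂ (Set.range A) ↔ ∃ y : m → ℂ, y ᵥ* A = v := by
  have : Submodule.span ℂ (Set.range A) = LinearMap.range A.vecMulLinear :=
    (range_vecMulLinear A).symm
  rw [this]
  rfl

variable {m ι : Type*} [Fintype m] [DecidableEq m] [Fintype ι]

/-- The matrix of the orthogonal projection onto the row space. -/
noncomputable def projMat (A : Matrix m ι ℂ) : Matrix ι ι ℂ := Aᴴ * (A * Aᴴ)⁻¹ * A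

open scoped ComplexOrder in
theorem isUnit_det_mul_conjTranspose {A : Matrix m ι ℂ} (hA : LinearIndependent ℂ A) :
    IsUnit (A * Aᴴ).det :=
  (Matrix.isUnit_iff_isUnit_det _).1
    (PosDef.mul_conjTranspose_self A (Matrix.vecMul_injective_iff.2 hA)).isUnit

theorem linearIndependent_of_mul_conjTranspose {A : Matrix m ι ℂ} (h : A * Aᴴ = 1) :
    LinearIndependent ℂ A := by
  refine Matrix.vecMul_injective_iff.1 fun x y hxy => ?_
  have := congrArg (fun v => v ᵥ* Aᴴ) hxy
  simpa only [Matrix.vecMul_vecMul, h, Matrix.vecMul_one] using this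

theorem mul_projMat {A : Matrix m ι ℂ} (hA : LinearIndependent ℂ A) : A * projMat A = A := by
  rw [projMat, ← Matrix.mul_assoc, ← Matrix.mul_assoc,
    Matrix.mul_nonsing_inv _ (isUnit_det_mul_conjTranspose hA), Matrix.one_mul]

theorem projMat_conjTranspose (A : Matrix m ι ℂ) : (projMat A)ᴴ = projMat A := by
  simp only [projMat, conjTranspose_mul, conjTranspose_conjTranspose, conjTranspose_nonsing_inv,
    Matrix.mul_assoc]

theorem mem_span_iff_vecMul_projMat {A : Matrix m ι ℂ} (hA : LinearIndependent ℂ A) {v : ι → ℂ} :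
    v ∈ Submodule.span ℂ (Set.range A) ↔ v ᵥ* projMat A = v := by
  rw [mem_span_row_iff]
  constructor
  · rintro ⟨y, rfl⟩
    rw [Matrix.vecMul_vecMul, mul_projMat hA]
  · intro h
    refine ⟨v ᵥ* (Aᴴ * (A * Aᴴ)⁻¹), ?_⟩
    rw [Matrix.vecMul_vecMul]
    exact h

theorem vecMul_projMat_mem (A : Matrix m ι ℂ) (v : ι → ℂ) :
    v ᵥ* projMat A ∈ Submodule.span ℂ (Set.range A) := by
  rw [mem_span_row_iff]
  exact ⟨v ᵥ* (Aᴴ * (A * Aᴴ)⁻¹), by rw [Matrix.vecMul_vecMul]; rfl⟩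

/-- Equal row spaces give `P * P' = P` and `P' * P = P'`; the adjoint of the second identity reads
`P * P' = P'`. -/
theorem projMat_eq_of_span_eq {A A' : Matrix m ι ℂ} (hA : LinearIndependent ℂ A)
    (hA' : LinearIndependent ℂ A')
    (h : Submodule.span ℂ (Set.range A) = Submodule.span ℂ (Set.range A')) :
    projMat A = projMat A' := by
  have key : ∀ B B' : Matrix m ι ℂ, LinearIndependent ℂ B' →
      Submodule.span ℂ (Set.range B) = Submodule.span ℂ (Set.range B') →
      projMat B * projMat B' = projMat B := by
    intro B B' hB' h
    classical
    refine Matrix.ext_of_single_vecMul fun i => ?_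
    rw [← Matrix.vecMul_vecMul]
    exact (mem_span_iff_vecMul_projMat hB').1 (h ▸ vecMul_projMat_mem B _)
  have h1 := key A A' hA' h
  have h2 := congrArg conjTranspose (key A' A hA h.symm)
  rw [conjTranspose_mul, projMat_conjTranspose, projMat_conjTranspose] at h2
  rw [← h1, h2]

end Projection

variable {n : ℕ}

/-- A tuple of vectors as a matrix. -/
abbrev toMat {m : ℕ} (A : Fin m → E n) : Matrix (Fin m) (Fin (2 * n)) ℂ := A

noncomputable instance : TopologicalSpace (Frames n) :=
  TopologicalSpace.induced (fun A : Frames n => A.1) Pi.topologicalSpace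

theorem continuous_frames_val : Continuous (fun A : Frames n => A.1) := continuous_induced_dom

theorem span_surjective : Function.Surjective (Frames.span : Frames n → GrProd n) := by
  intro V
  have b : ∀ k : Fin n, Module.Basis (Fin ((k : ℕ) + 1)) ℂ (V.1 k) := fun k =>
    Module.finBasisOfFinrankEq ℂ _ (V.2 k)
  refine ⟨⟨fun k i => b k i, fun k => (b k).linearIndependent.map' (V.1 k).subtype (by simp)⟩, ?_⟩
  refine Subtype.ext (funext fun k => ?_)
  change Submodule.span ℂ (Set.range fun i => ((b k i : V.1 k) : E n)) = V.1 k
  have := congrArg (Submodule.map (V.1 k).subtype) (b k).span_eq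
  rw [Submodule.map_span, ← Set.range_comp, Submodule.map_top, Submodule.range_subtype] at this
  exact this

theorem isQuotientMap_span :
    Topology.IsQuotientMap (Frames.span : Frames n → GrProd n) :=
  ⟨⟨rfl⟩, span_surjective⟩

/-- The orthogonal projections onto the components. -/
noncomputable def proj (V : GrProd n) (k : Fin n) : Matrix (Fin (2 * n)) (Fin (2 * n)) ℂ :=
  projMat (toMat ((span_surjective V).choose.1 k))

theorem proj_span (A : Frames n) (k : Fin n) :
    proj A.span k = projMat (toMat (A.1 k)) := by
  have h := (span_surjective A.span).choose_spec
  exact projMat_eq_of_span_eq ((span_surjective A.span).choose.2 k) (A.2 k) (congrFun (congrArg Subtype.val h) k)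

theorem mem_iff_proj {V : GrProd n} {k : Fin n} {v : E n} :
    v ∈ V.1 k ↔ v ᵥ* proj V k = v := by
  obtain ⟨A, rfl⟩ := span_surjective V
  rw [proj_span]
  exact mem_span_iff_vecMul_projMat (A.2 k)

theorem vecMul_proj_mem (V : GrProd n) (k : Fin n) (v : E n) : v ᵥ* proj V k ∈ V.1 k := by
  obtain ⟨A, rfl⟩ := span_surjective V
  rw [proj_span]
  exact vecMul_projMat_mem _ v

/-- The topology is a quotient of the frames, on which the projection is the explicit expression `Aᴴ
(A Aᴴ)⁻¹ A` with invertible Gram matrix. -/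
theorem continuous_proj : Continuous (proj : GrProd n → _) := by
  rw [isQuotientMap_span.continuous_iff]
  refine continuous_pi fun k => ?_
  have : ((fun V : GrProd n => proj V k) ∘ Frames.span) =
      fun A : Frames n => projMat (toMat (A.1 k)) :=
    funext fun A => proj_span A k
  change Continuous ((fun V : GrProd n => proj V k) ∘ Frames.span)
  rw [this]
  have hA : Continuous fun A : Frames n => toMat (A.1 k) :=
    (continuous_apply k).comp continuous_frames_val
  have hAA := hA.matrix_mul hA.matrix_conjTranspose
  have hinv : Continuous fun A : Frames n =>
      (toMat (A.1 k) * (toMat (A.1 k))ᴴ)⁻¹ := by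
    simp only [Matrix.inv_def, Ring.inverse_eq_inv']
    refine Continuous.smul (Continuous.inv₀ hAA.matrix_det fun A => ?_) hAA.matrix_adjugate
    exact (isUnit_det_mul_conjTranspose (A.2 k)).ne_zero
  exact (hA.matrix_conjTranspose.matrix_mul hinv).matrix_mul hA

theorem proj_injective : Function.Injective (proj : GrProd n → _) := by
  intro V W h
  refine Subtype.ext (funext fun k => Submodule.ext fun v => ?_)
  rw [mem_iff_proj, mem_iff_proj, h]

theorem exists_orthonormal_frame (V : GrProd n) : ∃ A : Frames n, A.span = V ∧
    ∀ k : Fin n, toMat (A.1 k) * (toMat (A.1 k))ᴴ = 1 := by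
  let L := (WithLp.linearEquiv 2 ℂ (E n)).symm
  have key : ∀ k : Fin n, ∃ A : Matrix (Fin ((k : ℕ) + 1)) (Fin (2 * n)) ℂ,
      Submodule.span ℂ (Set.range A) = V.1 k ∧ A * Aᴴ = 1 := by
    intro k
    let V' : Submodule ℂ (EuclideanSpace ℂ (Fin (2 * n))) := (V.1 k).map L.toLinearMap
    have hV' : Module.finrank ℂ V' = (k : ℕ) + 1 := by
      rw [← V.2 k]
      exact LinearEquiv.finrank_map_eq L (V.1 k)
    let b := (stdOrthonormalBasis ℂ V').reindex (finCongr hV')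
    refine ⟨fun i => (WithLp.ofLp (b i : EuclideanSpace ℂ (Fin (2 * n)))), ?_, ?_⟩
    · have h1 := congrArg (Submodule.map V'.subtype) b.toBasis.span_eq
      rw [Submodule.map_span, ← Set.range_comp, Submodule.map_top, Submodule.range_subtype] at h1
      have h2 := congrArg (Submodule.map L.symm.toLinearMap) h1
      rw [Submodule.map_span, ← Set.range_comp] at h2
      have h3 : Submodule.map L.symm.toLinearMap V' = V.1 k := by
        change Submodule.map L.symm.toLinearMap (Submodule.map L.toLinearMap (V.1 k)) = V.1 k
        rw [← Submodule.map_comp]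
        simp
      rw [h3] at h2
      rw [← h2]
      congr 2
    · ext i j
      have := orthonormal_iff_ite.1 b.orthonormal j i
      rw [Submodule.coe_inner, EuclideanSpace.inner_eq_star_dotProduct] at this
      rw [Matrix.one_apply]
      simp only [eq_comm (a := i)]
      exact this
  choose A hA hA' using key
  refine ⟨⟨A, fun k => ?_⟩, Subtype.ext (funext hA), hA'⟩
  exact linearIndependent_of_mul_conjTranspose (hA' k)

/-- The orthonormal frames form a closed bounded set that maps onto the product of Grassmannians. -/
instance : CompactSpace (GrProd n) := by
  let K : Set ((k : Fin n) → Fin ((k : ℕ) + 1) → E n) :=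
    {A | ∀ k : Fin n, toMat (A k) * (toMat (A k))ᴴ = 1}
  have hli : ∀ A ∈ K, ∀ k, LinearIndependent ℂ (A k) := fun A hA k =>
    linearIndependent_of_mul_conjTranspose (hA k)
  have hK : IsCompact K := by
    refine Metric.isCompact_of_isClosed_isBounded ?_ ?_
    · have : K = ⋂ k, {A | toMat (A k) *
          (toMat (A k))ᴴ = 1} := by
        ext A; simp [K]
      rw [this]
      refine isClosed_iInter fun k => isClosed_eq ?_ continuous_const
      have hA : Continuous fun A : (k : Fin n) → Fin ((k : ℕ) + 1) → E n =>
        toMat (A k) := continuous_apply k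
      exact hA.matrix_mul hA.matrix_conjTranspose
    · refine (Metric.isBounded_closedBall (x := 0) (r := 1)).subset fun A hA => ?_
      rw [mem_closedBall_zero_iff, pi_norm_le_iff_of_nonneg zero_le_one]
      intro k
      rw [pi_norm_le_iff_of_nonneg zero_le_one]
      intro i
      rw [pi_norm_le_iff_of_nonneg zero_le_one]
      intro c
      have h := congrFun (congrFun (hA k) i) i
      rw [Matrix.mul_apply, Matrix.one_apply_eq] at h
      have h2 : ∑ c, ‖A k i c‖ ^ 2 = 1 := by
        have h3 : ((∑ c, ‖A k i c‖ ^ 2 : ℝ) : ℂ) = 1 := by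
          rw [← h]
          push_cast
          refine Finset.sum_congr rfl fun c _ => ?_
          exact (RCLike.mul_conj (A k i c)).symm
        exact_mod_cast h3
      have h4 := Finset.single_le_sum (f := fun c => ‖A k i c‖ ^ 2) (fun c _ => sq_nonneg _)
        (Finset.mem_univ c)
      rw [h2] at h4
      exact (sq_le_one_iff₀ (norm_nonneg _)).1 h4
  have : CompactSpace K := isCompact_iff_compactSpace.1 hK
  let g : K → GrProd n := fun A => Frames.span ⟨A.1, hli A.1 A.2⟩
  have hg : Continuous g := isQuotientMap_span.continuous.comp
    (continuous_induced_rng.2 continuous_subtype_val)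
  have hs : Function.Surjective g := by
    intro V
    obtain ⟨A, hA, hA'⟩ := exists_orthonormal_frame V
    exact ⟨⟨A.1, hA'⟩, hA⟩
  exact hs.compactSpace hg

/-- This places the variety in a metric space of matrices, where the list cochains compute its
cohomology. -/
theorem isClosedEmbedding_proj :
    Topology.IsClosedEmbedding (proj : GrProd n → Fin n → Matrix (Fin (2 * n)) (Fin (2 * n)) ℂ) :=
  continuous_proj.isClosedEmbedding proj_injective

/-- Each condition on vectors of `V k` is tested on the projections `v ᵥ* proj V k` of all vectors
`v`, which turns it into an equation continuous in `V`. -/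
theorem isClosed_SpF : IsClosed (SpF n) := by
  have hp : ∀ (k : Fin n) (v : E n), Continuous fun V : GrProd n => v ᵥ* proj V k := fun k v =>
    Continuous.matrix_vecMul continuous_const ((continuous_apply k).comp continuous_proj)
  have hpr : ∀ a : Fin (2 * n), Continuous (pr a : E n → E n) := fun a =>
    LinearMap.continuous_of_finiteDimensional _
  have : SpF n = (⋂ (k : Fin n) (l : Fin n) (_ : (k : ℕ) + 1 = l) (v : E n),
        {V | pr (idx l) (v ᵥ* proj V k) ᵥ* proj V l = pr (idx l) (v ᵥ* proj V k)}) ∩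
      ⋂ (k : Fin n) (_ : (k : ℕ) + 1 = n) (v : E n) (w : E n),
        {V | form (v ᵥ* proj V k) (w ᵥ* proj V k) = 0} := by
    ext V
    simp only [SpF, Set.mem_ofPred_eq, Set.mem_inter_iff, Set.mem_iInter, Submodule.map_le_iff_le_comap]
    constructor
    · rintro ⟨h1, h2⟩
      refine ⟨fun k l hkl v => mem_iff_proj.1 (h1 k l hkl (vecMul_proj_mem V k v)),
        fun k hk v w => h2 k hk _ (vecMul_proj_mem V k v) _ (vecMul_proj_mem V k w)⟩
    · rintro ⟨h1, h2⟩
      refine ⟨fun k l hkl v hv => ?_, fun k hk v hv w hw => ?_⟩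
      · have := h1 k l hkl v
        rw [mem_iff_proj.1 hv] at this
        exact mem_iff_proj.2 this
      · have := h2 k hk v w
        rwa [mem_iff_proj.1 hv, mem_iff_proj.1 hw] at this
  rw [this]
  refine IsClosed.inter ?_ ?_
  · refine isClosed_iInter fun k => isClosed_iInter fun l => isClosed_iInter fun _ =>
      isClosed_iInter fun v => isClosed_eq ?_ ((hpr _).comp (hp k v))
    exact Continuous.matrix_vecMul ((hpr _).comp (hp k v))
      ((continuous_apply l).comp continuous_proj)
  · refine isClosed_iInter fun k => isClosed_iInter fun _ => isClosed_iInter fun v =>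
      isClosed_iInter fun w => isClosed_eq ?_ continuous_const
    unfold form
    refine continuous_finsetSum _ fun a _ => continuous_const.mul ?_
    exact ((continuous_apply a).comp (hp k v)).mul ((continuous_apply a.rev).comp (hp k w))

instance : CompactSpace (SpF n) := isCompact_iff_compactSpace.1 isClosed_SpF.isCompact

end SpFlag

/-! ### Reduced echelon forms -/

namespace Echelon

open Matrix

variable {ι : Type*} [Fintype ι] [DecidableEq ι]

/-- The vector `e_a + ∑ x_{a,b} e_b`, the sum over `b ∉ I` of smaller height than `a`. -/
def vec {R : Type*} [Zero R] [One R] (h : ι → ℕ) (I : Finset ι) (x : ι → ι → R) (a : ι) : ι → R :=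
  fun c => if c = a then 1 else if h c < h a ∧ c ∉ I then x a c else 0

section vec

variable {R : Type*} [Zero R] [One R] {h : ι → ℕ} {I : Finset ι} {x : ι → ι → R} {a c : ι}

theorem vec_self : vec h I x a a = 1 := if_pos rfl

theorem vec_of_mem (hc : c ∈ I) (hca : c ≠ a) : vec h I x a c = 0 := by
  rw [vec, if_neg hca, if_neg fun h => h.2 hc]

theorem vec_of_lt (hca : h a < h c) : vec h I x a c = 0 := by
  rw [vec, if_neg, if_neg]
  · exact fun h' => by omega
  · rintro rfl; omega

theorem vec_of_not_mem (hc : c ∉ I) (hlt : h c < h a) : vec h I x a c = x a c := by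
  rw [vec, if_neg, if_pos ⟨hlt, hc⟩]
  rintro rfl; omega

end vec

/-- The span of the vectors `vec h I x a`, `a ∈ I`. -/
def space (h : ι → ℕ) (I : Finset ι) (x : ι → ι → ℂ) : Submodule ℂ (ι → ℂ) :=
  Submodule.span ℂ (vec h I x '' I)

open Classical in
/-- The set of leading positions of the vectors of a subspace. -/
noncomputable def lead (h : ι → ℕ) (V : Submodule ℂ (ι → ℂ)) : Finset ι :=
  Finset.univ.filter fun a => ∃ v ∈ V, v a = 1 ∧ ∀ b, h a < h b → v b = 0

variable {h : ι → ℕ} {V : Submodule ℂ (ι → ℂ)}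

theorem mem_lead {a : ι} : a ∈ lead h V ↔ ∃ v ∈ V, v a = 1 ∧ ∀ b, h a < h b → v b = 0 := by
  classical simp [lead]

theorem exists_mem_lead {v : ι → ℂ} (hv : v ∈ V) (h0 : v ≠ 0) :
    ∃ a ∈ lead h V, v a ≠ 0 ∧ ∀ b, h a < h b → v b = 0 := by
  obtain ⟨c, hc⟩ := Function.ne_iff.1 h0
  obtain ⟨a, ha, hmax⟩ := Finset.exists_max_image (Finset.univ.filter fun b => v b ≠ 0) h
    ⟨c, by simpa using hc⟩
  simp only [Finset.mem_filter, Finset.mem_univ, true_and] at ha hmax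
  have hz : ∀ b, h a < h b → v b = 0 := fun b hb => by
    by_contra hb'
    exact absurd (hmax b hb') (by omega)
  exact ⟨a, mem_lead.2 ⟨(v a)⁻¹ • v, V.smul_mem _ hv, by simp [ha], fun b hb => by simp [hz b hb]⟩,
    ha, hz⟩

/-- Gaussian elimination by induction on the height: from a vector with leading position `a`, the
already reduced vectors with lower leading positions are subtracted. -/
theorem exists_reduced (hh : Function.Injective h) (m : ℕ) : ∀ a ∈ lead h V, h a = m → ∃ v ∈ V, v a = 1 ∧
    (∀ b ∈ lead h V, b ≠ a → v b = 0) ∧ ∀ b, h a < h b → v b = 0 := by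
  induction m using Nat.strong_induction_on with
  | _ m ih =>
    intro a ha ham
    obtain ⟨v, hv, hva, hvb⟩ := mem_lead.1 ha
    have := fun b (hb : b ∈ (lead h V).filter fun b => h b < h a) =>
      ih (h b) (ham ▸ (Finset.mem_filter.1 hb).2) b (Finset.mem_filter.1 hb).1 rfl
    choose! w hw hwb hwc hwd using this
    set L := (lead h V).filter fun b => h b < h a
    have hsum : ∀ c, (∀ b ∈ L, w b c = 0) → (v - ∑ b ∈ L, v b • w b) c = v c := by
      intro c hc
      rw [Pi.sub_apply, Finset.sum_apply, Finset.sum_eq_zero, sub_zero]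
      intro b hb
      rw [Pi.smul_apply, hc b hb, smul_zero]
    refine ⟨v - ∑ b ∈ L, v b • w b, V.sub_mem hv (V.sum_mem fun b hb => V.smul_mem _ (hw b hb)),
      ?_, fun c hc hca => ?_, fun c hc => ?_⟩
    · rw [hsum, hva]
      exact fun b hb => hwd b hb a (Finset.mem_filter.1 hb).2
    · by_cases hlt : h c < h a
      · have hcL : c ∈ L := Finset.mem_filter.2 ⟨hc, hlt⟩
        rw [Pi.sub_apply, Finset.sum_apply, Finset.sum_eq_single_of_mem c hcL]
        · simp [hwb c hcL]
        · intro b hb hbc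
          rw [Pi.smul_apply, hwc b hb c hc hbc.symm, smul_zero]
      · rw [hsum]
        · exact hvb c (lt_of_le_of_ne (not_lt.1 hlt) fun h' => hca (hh h').symm)
        · intro b hb
          exact hwc b hb c hc fun h' => hlt (h' ▸ (Finset.mem_filter.1 hb).2)
    · rw [hsum, hvb c hc]
      exact fun b hb => hwd b hb c ((Finset.mem_filter.1 hb).2.trans hc)

/-- Every subspace has a reduced echelon basis. -/
theorem exists_eq_space (hh : Function.Injective h) (V : Submodule ℂ (ι → ℂ)) :
    ∃ x, V = space h (lead h V) x := by
  have := fun a (ha : a ∈ lead h V) => exists_reduced hh (h a) a ha rfl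
  choose! r hr hra hrb hrc using this
  refine ⟨r, ?_⟩
  have hvec : ∀ a ∈ lead h V, vec h (lead h V) r a = r a := by
    intro a ha
    funext c
    rw [vec]
    split_ifs with h1 h2
    · rw [h1, hra a ha]
    · rfl
    · by_cases hc : c ∈ lead h V
      · rw [hrb a ha c hc h1]
      · rw [hrc a ha]
        have : h c ≠ h a := fun h' => h1 (hh h')
        by_contra h3
        exact h2 ⟨by omega, hc⟩
  apply le_antisymm
  · intro v hv
    have hmem : ∀ a ∈ lead h V, r a ∈ space h (lead h V) r := fun a ha =>
      Submodule.subset_span ⟨a, ha, hvec a ha⟩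
    -- The difference vanishes at all leading positions, while a nonzero vector of `V` is nonzero at
    -- one of them.
    have : v - ∑ a ∈ lead h V, v a • r a = 0 := by
      by_contra h0
      obtain ⟨b, hb, hb0, -⟩ := exists_mem_lead (h := h) (V.sub_mem hv
        (V.sum_mem fun a ha => V.smul_mem (v a) (hr a ha))) h0
      apply hb0
      rw [Pi.sub_apply, Finset.sum_apply, Finset.sum_eq_single_of_mem b hb]
      · simp [hra b hb]
      · intro a ha hab
        simp [hrb a ha b hb hab.symm]
    rw [sub_eq_zero.1 this]
    exact Submodule.sum_mem _ fun a ha => Submodule.smul_mem _ _ (hmem a ha)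
  · rw [space, Submodule.span_le]
    rintro _ ⟨a, ha, rfl⟩
    rw [hvec a ha]
    exact hr a ha

variable {I : Finset ι} {x : ι → ι → ℂ}

theorem vec_mem_space {a : ι} (ha : a ∈ I) : vec h I x a ∈ space h I x :=
  Submodule.subset_span ⟨a, ha, rfl⟩

theorem eq_sum_of_mem_space {v : ι → ℂ} (hv : v ∈ space h I x) :
    v = ∑ a ∈ I, v a • vec h I x a := by
  refine Submodule.span_induction (p := fun v _ => v = ∑ a ∈ I, v a • vec h I x a) ?_ ?_ ?_ ?_ hv
  · rintro _ ⟨a, ha, rfl⟩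
    rw [Finset.sum_eq_single_of_mem a ha]
    · rw [vec_self, one_smul]
    · intro b hb hba
      rw [vec_of_mem hb hba, zero_smul]
  · simp
  · intro u v _ _ hu hv
    simp only [Pi.add_apply, add_smul, Finset.sum_add_distrib]
    rw [← hu, ← hv]
  · intro c v _ hv
    simp only [Pi.smul_apply, smul_assoc, ← Finset.smul_sum]
    rw [← hv]

theorem mem_space_iff {v : ι → ℂ} : v ∈ space h I x ↔ v = ∑ a ∈ I, v a • vec h I x a := by
  refine ⟨eq_sum_of_mem_space, fun h => ?_⟩
  rw [h]
  exact Submodule.sum_mem _ fun a ha => Submodule.smul_mem _ _ (vec_mem_space ha)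

/-- The coefficients of a vector are its entries in `I`. The leading position of the vector is
therefore the highest element of `I` with a nonzero coefficient. -/
theorem lead_space (hh : Function.Injective h) : lead h (space h I x) = I := by
  ext a
  constructor
  · intro ha
    obtain ⟨v, hv, hva, hvb⟩ := mem_lead.1 ha
    have hv' := eq_sum_of_mem_space hv
    obtain ⟨b, hb, hbmax⟩ : ∃ b ∈ I.filter (fun b => v b ≠ 0), ∀ c ∈ I.filter (fun b => v b ≠ 0),
        h c ≤ h b := by
      refine Finset.exists_max_image _ h ?_
      by_contra hne
      rw [Finset.not_nonempty_iff_eq_empty, Finset.filter_eq_empty_iff] at hne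
      rw [Finset.sum_eq_zero fun b hb => by rw [not_not.1 (hne hb), zero_smul]] at hv'
      rw [hv'] at hva
      simp at hva
    simp only [Finset.mem_filter] at hb hbmax
    have h1 : h b ≤ h a := by
      by_contra hlt
      exact hb.2 (hvb b (by omega))
    have h2 : h a ≤ h b := by
      by_contra hlt
      have := congrFun hv' a
      rw [hva, Finset.sum_apply, Finset.sum_eq_zero] at this
      · exact one_ne_zero this
      · intro c hc
        by_cases hvc : v c = 0
        · simp [hvc]
        · rw [Pi.smul_apply, vec_of_lt, smul_zero]
          have := hbmax c ⟨hc, hvc⟩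
          omega
    rw [hh (le_antisymm h2 h1)]
    exact hb.1
  · exact fun ha => mem_lead.2 ⟨_, vec_mem_space ha, vec_self, fun b hb => vec_of_lt hb⟩

theorem linearIndependent_vec : LinearIndependent ℂ fun a : I => vec h I x a := by
  rw [Fintype.linearIndependent_iff]
  intro g hg a
  have := congrFun hg a
  rw [Finset.sum_apply, Finset.sum_eq_single a] at this
  · simpa [vec_self] using this
  · intro b _ hba
    rw [Pi.smul_apply, vec_of_mem a.2 fun h => hba (Subtype.ext h.symm), smul_zero]
  · simp

theorem finrank_space : Module.finrank ℂ (space h I x) = I.card := by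
  have : space h I x = Submodule.span ℂ (Set.range fun a : I => vec h I x a) := by
    rw [space]
    congr 1
    ext v
    simp
  rw [this, finrank_span_eq_card linearIndependent_vec, Fintype.card_coe]

/-- The rows `vec h I x a` in some order. -/
noncomputable def frame (h : ι → ℕ) {I : Finset ι} {m : ℕ} (hI : I.card = m) {R : Type*} [Zero R]
    [One R] (x : ι → ι → R) : Matrix (Fin m) ι R :=
  fun i => vec h I x (I.equivFinOfCardEq hI |>.symm i)

theorem span_frame {m : ℕ} (hI : I.card = m) :
    Submodule.span ℂ (Set.range (frame h hI x)) = space h I x := by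
  rw [space]
  congr 1
  ext v
  constructor
  · rintro ⟨i, rfl⟩
    exact ⟨_, (I.equivFinOfCardEq hI |>.symm i).2, rfl⟩
  · rintro ⟨a, ha, rfl⟩
    refine ⟨I.equivFinOfCardEq hI ⟨a, ha⟩, ?_⟩
    simp [frame]

theorem linearIndependent_frame {m : ℕ} (hI : I.card = m) :
    LinearIndependent ℂ (frame h hI x) :=
  (linearIndependent_vec (h := h) (I := I) (x := x)).comp _
    (I.equivFinOfCardEq hI).symm.injective

/-- The square submatrix with columns `I`. -/
noncomputable def minor {R : Type*} {m : ℕ} (hI : I.card = m) (A : Matrix (Fin m) ι R) :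
    Matrix (Fin m) (Fin m) R :=
  A.submatrix id fun i => (I.equivFinOfCardEq hI).symm i

theorem minor_mul {m : ℕ} (hI : I.card = m) (B : Matrix (Fin m) (Fin m) ℂ)
    (A : Matrix (Fin m) ι ℂ) : minor hI (B * A) = B * minor hI A := rfl

theorem minor_frame {m : ℕ} (hI : I.card = m) : minor hI (frame h hI x) = 1 := by
  ext i j
  rw [Matrix.one_apply]
  change vec h I x _ _ = _
  split_ifs with hij
  · rw [hij]; exact vec_self
  · refine vec_of_mem (Subtype.coe_prop _) fun h' => hij ?_
    exact ((I.equivFinOfCardEq hI).symm.injective (Subtype.ext h')).symm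

theorem exists_mul_eq {m : ℕ} {A A' : Matrix (Fin m) ι ℂ}
    (hs : Submodule.span ℂ (Set.range A) ≤ Submodule.span ℂ (Set.range A')) :
    ∃ B : Matrix (Fin m) (Fin m) ℂ, A = B * A' := by
  have : ∀ i, ∃ y : Fin m → ℂ, y ᵥ* A' = A i := fun i =>
    SpFlag.mem_span_row_iff.1 (hs (Submodule.subset_span ⟨i, rfl⟩))
  choose B hB using this
  refine ⟨B, ?_⟩
  funext i
  rw [← hB i]
  rfl

theorem det_minor_ne_zero_of_span_le {m : ℕ} (hI : I.card = m) {A A' : Matrix (Fin m) ι ℂ}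
    (hs : Submodule.span ℂ (Set.range A) ≤ Submodule.span ℂ (Set.range A'))
    (hA : (minor hI A).det ≠ 0) : (minor hI A').det ≠ 0 := by
  obtain ⟨B, rfl⟩ := exists_mul_eq hs
  rw [minor_mul, Matrix.det_mul] at hA
  exact right_ne_zero_of_mul hA

theorem det_minor_ne_zero {m : ℕ} (hI : I.card = m) {A : Matrix (Fin m) ι ℂ}
    (hs : Submodule.span ℂ (Set.range A) = space h I x) : (minor hI A).det ≠ 0 := by
  refine det_minor_ne_zero_of_span_le hI (A := frame h hI x) ?_ ?_
  · rw [span_frame, hs]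
  · rw [minor_frame, Matrix.det_one]; exact one_ne_zero

theorem eq_minor_mul_frame {m : ℕ} (hI : I.card = m) {A : Matrix (Fin m) ι ℂ}
    (hs : Submodule.span ℂ (Set.range A) = space h I x) : A = minor hI A * frame h hI x := by
  obtain ⟨B, hB⟩ := exists_mul_eq (A := A) (A' := frame h hI x) (by rw [span_frame, hs])
  have : minor hI A = B := by
    rw [hB, minor_mul, minor_frame, Matrix.mul_one]
  rw [this]
  exact hB

/-- A change of frame multiplies the matrix and its minor by the same matrix on the left, which
cancels. -/
theorem inv_minor_mul_eq_of_span_eq {m : ℕ} (hI : I.card = m) {A A' : Matrix (Fin m) ι ℂ}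
    (hs : Submodule.span ℂ (Set.range A) = Submodule.span ℂ (Set.range A'))
    (hA : (minor hI A).det ≠ 0) : (minor hI A)⁻¹ * A = (minor hI A')⁻¹ * A' := by
  obtain ⟨B, rfl⟩ := exists_mul_eq hs.le
  rw [minor_mul, Matrix.det_mul] at hA
  rw [minor_mul, Matrix.mul_inv_rev, Matrix.mul_assoc, ← Matrix.mul_assoc B⁻¹,
    Matrix.nonsing_inv_mul _ (Ne.isUnit (left_ne_zero_of_mul hA)), Matrix.one_mul]

/-- The leading positions of a subspace have the largest total height among the sets of columns
with a non-vanishing minor. -/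
theorem sum_height_le {m : ℕ} (hh : Function.Injective h) {J : Finset ι} (hI : I.card = m)
    (hJ : J.card = m) {A : Matrix (Fin m) ι ℂ}
    (hs : Submodule.span ℂ (Set.range A) = space h J x) (hA : (minor hI A).det ≠ 0) :
    ∑ a ∈ I, h a ≤ ∑ a ∈ J, h a ∧ (∑ a ∈ I, h a = ∑ a ∈ J, h a → I = J) := by
  have hA := det_minor_ne_zero_of_span_le hI (A' := frame h hJ x) (by rw [span_frame, hs]) hA
  rw [Matrix.det_apply] at hA
  -- A nonzero term of the determinant matches `I` with `J`; a nonzero entry of an echelon row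
  -- cannot lie above the leading position.
  obtain ⟨τ, -, hτ⟩ := Finset.exists_ne_zero_of_sum_ne_zero hA
  have hτ : ∏ i, minor hI (frame h hJ x) (τ i) i ≠ 0 := fun h0 => hτ (by rw [h0, smul_zero])
  rw [Finset.prod_ne_zero_iff] at hτ
  set σ := (I.equivFinOfCardEq hI).symm
  set ρ := (J.equivFinOfCardEq hJ).symm
  have hle : ∀ i, h (σ i) ≤ h (ρ (τ i)) := by
    intro i
    by_contra hlt
    exact hτ i (Finset.mem_univ _) (vec_of_lt (by simpa using hlt))
  have hsI : ∑ a ∈ I, h a = ∑ i, h (σ i) := by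
    rw [← Finset.sum_coe_sort, ← Equiv.sum_comp σ]
  have hsJ : ∑ a ∈ J, h a = ∑ i, h (ρ (τ i)) := by
    rw [← Finset.sum_coe_sort, ← Equiv.sum_comp (τ.trans ρ)]
    rfl
  rw [hsI, hsJ]
  refine ⟨Finset.sum_le_sum fun i _ => hle i, fun heq => ?_⟩
  have heq := (Finset.sum_eq_sum_iff_of_le fun i _ => hle i).1 heq
  refine Finset.eq_of_subset_of_card_le (fun a ha => ?_) (by rw [hI, hJ])
  have := hh (heq (σ.symm ⟨a, ha⟩) (Finset.mem_univ _))
  rw [Equiv.apply_symm_apply] at this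
  change a = _ at this
  rw [this]
  exact Subtype.coe_prop _

end Echelon

/-! ### Coordinates on the cells -/

namespace SpFlag

open Echelon

variable {n : ℕ}

/-- The height as a natural number. -/
def hgt (k : Fin n) (l : Fin (2 * n)) : ℕ := height k l

theorem hgt_eq (k : Fin n) (l : Fin (2 * n)) :
    hgt k l = if (k : ℕ) < l then (l : ℕ) else 2 * n + l := by
  rw [hgt, height]
  split_ifs <;> rfl

theorem hgt_injective (k : Fin n) : Function.Injective (hgt k) := by
  intro a b hab
  rw [hgt_eq, hgt_eq] at hab
  ext
  split_ifs at hab <;> omega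

/-- Between consecutive orders only the vector `idx l`, which `pr` kills, moves: from the bottom to
the top. -/
theorem hgt_succ {k l : Fin n} (hkl : (k : ℕ) + 1 = l) {b : Fin (2 * n)} (hb : b ≠ idx l) :
    hgt l b = hgt k b := by
  have : (b : ℕ) ≠ l := fun h => hb (Fin.ext h)
  rw [hgt_eq, hgt_eq]
  split_ifs <;> omega

theorem hgt_lt_idx (l : Fin n) {b : Fin (2 * n)} (hb : b ≠ idx l) : hgt l b < hgt l (idx l) := by
  have : (b : ℕ) ≠ l := fun h => hb (Fin.ext h)
  have hl : ((idx l : Fin (2 * n)) : ℕ) = l := rfl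
  rw [hgt_eq, hgt_eq]
  split_ifs <;> omega

/-- For the last index the pairing of basis vectors under the form reverses the order; this makes
echelon forms compatible with isotropy. -/
theorem hgt_rev {k : Fin n} (hk : (k : ℕ) + 1 = n) (a : Fin (2 * n)) :
    hgt k a.rev + hgt k a + 1 = 4 * n := by
  rw [hgt_eq, hgt_eq, Fin.val_rev]
  split_ifs <;> omega

theorem single_add_sum_eq_vec (k : Fin n) (I : Finset (Fin (2 * n)))
    (x : Fin (2 * n) → Fin (2 * n) → ℂ) (a : Fin (2 * n)) :
    (Pi.single a 1 + ∑ b ∈ Finset.univ.filter (fun b => height k b < height k a ∧ b ∉ I),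
        x a b • Pi.single b 1 : E n) = vec (hgt k) I x a := by
  funext c
  rw [Pi.add_apply, Finset.sum_apply, vec]
  simp only [Pi.smul_apply, Pi.single_apply, smul_eq_mul, mul_ite, mul_one, mul_zero,
    Finset.sum_ite_eq, Finset.mem_filter, Finset.mem_univ, true_and]
  by_cases hc : c = a
  · subst hc
    simp
  · rw [if_neg hc, if_neg hc, zero_add]
    rfl

theorem mem_cell_iff {I : Fin n → Finset (Fin (2 * n))} {V : GrProd n} :
    V ∈ cell I ↔ V ∈ SpF n ∧ ∀ k, ∃ x, V.1 k = space (hgt k) (I k) x := by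
  refine and_congr_right fun _ => forall_congr' fun k => exists_congr fun x => ?_
  have : {v | ∃ a ∈ I k, v = (Pi.single a 1 +
      ∑ b ∈ Finset.univ.filter (fun b => height k b < height k a ∧ b ∉ I k),
        x a b • Pi.single b 1 : E n)} = vec (hgt k) (I k) x '' (I k) := by
    ext v
    simp only [single_add_sum_eq_vec, Set.mem_ofPred_eq, Set.mem_image, Finset.mem_coe, eq_comm]
  rw [this]
  rfl

theorem lead_of_mem_cell {I : Fin n → Finset (Fin (2 * n))} {V : GrProd n} (hV : V ∈ cell I)
    (k : Fin n) : lead (hgt k) (V.1 k) = I k := by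
  obtain ⟨x, hx⟩ := (mem_cell_iff.1 hV).2 k
  rw [hx, lead_space (hgt_injective k)]

/-- The sign in the skew-symmetric form. -/
def sgn (R : Type*) [Ring R] (a : Fin (2 * n)) : R := if (a : ℕ) < n then 1 else -1

theorem sgn_rev (R : Type*) [Ring R] (a : Fin (2 * n)) : sgn R a.rev = -sgn R a := by
  rw [sgn, sgn, Fin.val_rev]
  split_ifs <;> first | omega | simp

theorem sgn_mul_self (R : Type*) [Ring R] (a : Fin (2 * n)) : sgn R a * sgn R a = 1 := by
  rw [sgn]
  split_ifs <;> simp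

theorem form_eq (v w : E n) : form v w = ∑ a, sgn ℂ a * (v a * w a.rev) := rfl

/-- Projection keeps the leading position unless it is killed. If `a` and `a.rev` were both leading
in the isotropic subspace, the form of the two vectors would reduce to the single term at `a`, which
is a sign. -/
theorem isIndex_lead {V : GrProd n} (hV : V ∈ SpF n) :
    IsIndex fun k => lead (hgt k) (V.1 k) := by
  refine ⟨fun k => ?_, fun k l hkl a ha => ?_, fun k hk a ha ha' => ?_⟩
  · obtain ⟨x, hx⟩ := exists_eq_space (hgt_injective k) (V.1 k)
    rw [← V.2 k]
    exact ((congrArg (fun W : Submodule ℂ (E n) => Module.finrank ℂ W) hx).trans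
      finrank_space).symm
  · rw [Finset.mem_insert, or_iff_not_imp_left]
    intro hal
    obtain ⟨v, hv, hva, hvb⟩ := mem_lead.1 ha
    refine mem_lead.2 ⟨pr (idx l) v, hV.1 k l hkl ⟨v, hv, rfl⟩, ?_, fun b hb => ?_⟩
    · exact (if_neg hal).trans hva
    · change (if b = idx l then 0 else v b) = 0
      split_ifs with hbl
      · rfl
      · rw [hgt_succ hkl hal, hgt_succ hkl hbl] at hb
        exact hvb b hb
  · obtain ⟨v, hv, hva, hvb⟩ := mem_lead.1 ha
    obtain ⟨w, hw, hwa, hwb⟩ := mem_lead.1 ha'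
    have := hV.2 k hk v hv w hw
    rw [form_eq, Finset.sum_eq_single a, hva, hwa] at this
    · have h2 := sgn_mul_self ℂ a
      rw [mul_one, mul_one] at this
      rw [this, zero_mul] at h2
      exact zero_ne_one h2
    · intro b _ hba
      rcases lt_trichotomy (hgt k a) (hgt k b) with h | h | h
      · rw [hvb b h, zero_mul, mul_zero]
      · exact absurd (hgt_injective k h).symm hba
      · rw [hwb b.rev, mul_zero, mul_zero]
        have h1 := hgt_rev hk a
        have h2 := hgt_rev hk b
        omega
    · simp

theorem exists_mem_cell {V : GrProd n} (hV : V ∈ SpF n) :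
    V ∈ cell fun k => lead (hgt k) (V.1 k) :=
  mem_cell_iff.2 ⟨hV, fun k => exists_eq_space (hgt_injective k) (V.1 k)⟩

/-- The last set has `n` elements and is disjoint from its reflection, so the two exhaust all `2 *
n` positions. -/
theorem IsIndex.rev_mem_iff {I : Fin n → Finset (Fin (2 * n))} (hI : IsIndex I) {k : Fin n}
    (hk : (k : ℕ) + 1 = n) (a : Fin (2 * n)) : a.rev ∈ I k ↔ a ∉ I k := by
  refine ⟨fun h h' => hI.lagrangian k hk a h' h, fun h => ?_⟩
  have hd : Disjoint (I k) ((I k).map Fin.revPerm.toEmbedding) := by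
    rw [Finset.disjoint_left]
    intro b hb hb'
    obtain ⟨c, hc, rfl⟩ := Finset.mem_map.1 hb'
    exact hI.lagrangian k hk c hc hb
  have hu : I k ∪ (I k).map Fin.revPerm.toEmbedding = Finset.univ := by
    rw [← Finset.card_eq_iff_eq_univ, Finset.card_union_of_disjoint hd, Finset.card_map,
      hI.card, Fintype.card_fin]
    omega
  have := Finset.mem_univ a
  rw [← hu, Finset.mem_union] at this
  obtain ⟨c, hc, rfl⟩ := Finset.mem_map.1 (this.resolve_left h)
  simpa using hc

/-! ### Solving the equations of a cell -/

section Coordinates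

variable {R : Type*} [CommRing R] {I : Fin n → Finset (Fin (2 * n))}

/-- The image of `vec` under the projection killing `e_c`. -/
def prVec (c : Fin (2 * n)) (v : Fin (2 * n) → R) : Fin (2 * n) → R :=
  fun b => if b = c then 0 else v b

/-- The condition `pr V_k ⊆ V_l` in coordinates. -/
def StepCond (I : Fin n → Finset (Fin (2 * n))) (x : Fin n → Fin (2 * n) → Fin (2 * n) → R)
    (k l : Fin n) : Prop :=
  ∀ a ∈ I k, ∀ b, prVec (idx l) (vec (hgt k) (I k) (x k) a) b =
    ∑ c ∈ I l, prVec (idx l) (vec (hgt k) (I k) (x k) a) c * vec (hgt l) (I l) (x l) c b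

/-- The condition that `V_k` is isotropic in coordinates. -/
def IsotropicCond (I : Fin n → Finset (Fin (2 * n)))
    (x : Fin n → Fin (2 * n) → Fin (2 * n) → R) (k : Fin n) : Prop :=
  ∀ a ∈ I k, ∀ a' ∈ I k, sgn R a * vec (hgt k) (I k) (x k) a' a.rev +
    sgn R a'.rev * vec (hgt k) (I k) (x k) a a'.rev = 0

/-- The equations of a cell. -/
structure IsCoords (I : Fin n → Finset (Fin (2 * n)))
    (x : Fin n → Fin (2 * n) → Fin (2 * n) → R) : Prop where
  step : ∀ k l : Fin n, (k : ℕ) + 1 = l → StepCond I x k l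
  isotropic : ∀ k : Fin n, (k : ℕ) + 1 = n → IsotropicCond I x k

theorem map_vec {S : Type*} [CommRing S] (φ : R →+* S) (h : Fin (2 * n) → ℕ)
    (J : Finset (Fin (2 * n))) (x : Fin (2 * n) → Fin (2 * n) → R) (a b : Fin (2 * n)) :
    φ (vec h J x a b) = vec h J (fun a b => φ (x a b)) a b := by
  rw [vec, vec]
  split_ifs <;> simp

theorem IsCoords.map {S : Type*} [CommRing S] (φ : R →+* S)
    {x : Fin n → Fin (2 * n) → Fin (2 * n) → R} (hx : IsCoords I x) :
    IsCoords I fun k a b => φ (x k a b) := by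
  refine ⟨fun k l hkl a ha b => ?_, fun k hk a ha a' ha' => ?_⟩
  · have := congrArg φ (hx.step k l hkl a ha b)
    rw [map_sum] at this
    simp only [prVec, map_mul, map_vec, apply_ite φ, map_zero] at this
    exact this
  · have := congrArg φ (hx.isotropic k hk a ha a' ha')
    simp only [map_add, map_mul, map_vec, sgn, apply_ite φ, map_one, map_neg, map_zero] at this
    exact this

/-- The positions of the free coordinates of a cell. -/
def Free (I : Fin n → Finset (Fin (2 * n))) (k : Fin n) (a b : Fin (2 * n)) : Prop :=
  a ∈ I k ∧ b ∉ I k ∧ hgt k b < hgt k a ∧ ((k : ℕ) + 1 = n → b.rev ≤ a) ∧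
    ∀ l : Fin n, (k : ℕ) + 1 = l → b ∈ I l ∨ b = idx l

/-- The coordinates of a point of a cell are determined by the free ones. -/
theorem IsCoords.vec_eq (hI : IsIndex I) {x x' : Fin n → Fin (2 * n) → Fin (2 * n) → R}
    (hx : IsCoords I x) (hx' : IsCoords I x')
    (h : ∀ k a b, Free I k a b → x k a b = x' k a b) (m : ℕ) :
    ∀ k : Fin n, n = k + m + 1 → ∀ a ∈ I k, ∀ b,
      vec (hgt k) (I k) (x k) a b = vec (hgt k) (I k) (x' k) a b := by
  have key : ∀ k a, a ∈ I k → ∀ b, (b ∉ I k → hgt k b < hgt k a → 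
      vec (hgt k) (I k) (x k) a b = vec (hgt k) (I k) (x' k) a b) →
      vec (hgt k) (I k) (x k) a b = vec (hgt k) (I k) (x' k) a b := by
    intro k a ha b hb
    by_cases h1 : b ∉ I k ∧ hgt k b < hgt k a
    · exact hb h1.1 h1.2
    · simp only [vec]
      rw [if_neg (c := _ ∧ _) fun h2 => h1 ⟨h2.2, h2.1⟩,
        if_neg (c := _ ∧ _) fun h2 => h1 ⟨h2.2, h2.1⟩]
  have free : ∀ k a b, Free I k a b →
      vec (hgt k) (I k) (x k) a b = vec (hgt k) (I k) (x' k) a b := by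
    intro k a b hf
    rw [vec_of_not_mem hf.2.1 hf.2.2.1, vec_of_not_mem hf.2.1 hf.2.2.1, h k a b hf]
  induction m with
  | zero =>
    intro k hk a ha b
    have hk : (k : ℕ) + 1 = n := by omega
    have hnl : ∀ l : Fin n, (k : ℕ) + 1 ≠ l := fun l hl => by omega
    refine key k a ha b fun hb hlt => ?_
    -- Isotropy links the entries at `(a, b)` and `(b.rev, a.rev)` by a sign, and at least one of
    -- these positions is free.
    by_cases hba : b.rev ≤ a
    · exact free k a b ⟨ha, hb, hlt, fun _ => hba, fun l hl => absurd hl (hnl l)⟩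
    · have hrb := (hI.rev_mem_iff hk b).2 hb
      have e := free k b.rev a.rev ⟨hrb, fun h => (hI.rev_mem_iff hk a).1 h ha, by
        have := hgt_rev hk a
        have := hgt_rev hk b
        omega, fun _ => by rw [Fin.rev_rev]; exact (not_le.1 hba).le, fun l hl => absurd hl (hnl l)⟩
      have e1 := hx.isotropic k hk a ha b.rev hrb
      have e2 := hx'.isotropic k hk a ha b.rev hrb
      rw [Fin.rev_rev, e] at e1
      rw [Fin.rev_rev] at e2
      have e3 : sgn R b * vec (hgt k) (I k) (x k) a b = sgn R b * vec (hgt k) (I k) (x' k) a b := by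
        linear_combination e1 - e2
      have e4 := congrArg (sgn R b * ·) e3
      simpa only [← mul_assoc, sgn_mul_self, one_mul] using e4
  | succ m ih =>
    intro k hk a ha b
    let l : Fin n := ⟨k + 1, by omega⟩
    have hkl : (k : ℕ) + 1 = l := rfl
    have hfree : ∀ c, c ∉ I k → hgt k c < hgt k a → c ∈ I l ∨ c = idx l → Free I k a c :=
      fun c h1 h2 h3 => ⟨ha, h1, h2, fun h => by omega, fun l' hl' => by
        have : l' = l := Fin.ext (hl'.symm.trans hkl)
        rwa [this]⟩
    refine key k a ha b fun hb hlt => ?_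
    -- In the remaining columns the entry is a combination of rows of `V l`, known by induction,
    -- with coefficients from the free columns in `I l`.
    by_cases hbl : b ∈ I l ∨ b = idx l
    · exact free k a b (hfree b hb hlt hbl)
    · have e1 := hx.step k l hkl a ha b
      have e2 := hx'.step k l hkl a ha b
      have hpr : ∀ v : Fin (2 * n) → R, prVec (idx l) v b = v b :=
        fun v => if_neg fun h => hbl (Or.inr h)
      rw [hpr] at e1 e2
      rw [e1, e2]
      refine Finset.sum_congr rfl fun c hc => ?_
      rw [ih l (by omega) c hc b]
      congr 1
      rw [prVec, prVec]
      split_ifs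
      · rfl
      · exact key k a ha c fun h1 h2 => free k a c (hfree c h1 h2 (Or.inl hc))

/-- The entries with `b.rev ≤ a` are kept and the others are filled in by reflection. On the
diagonal `b = a.rev` the equation is void because the two signs cancel, so these entries are free.
-/
theorem isotropicCond_of_eq (hI : IsIndex I) {k : Fin n} (hk : (k : ℕ) + 1 = n)
    (y : Fin (2 * n) → Fin (2 * n) → R) {x : Fin n → Fin (2 * n) → Fin (2 * n) → R}
    (hx : x k = fun a b => if b.rev ≤ a then y a b else -sgn R b * sgn R a * y b.rev a.rev) :
    IsotropicCond I x k := by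
  intro a ha a' ha'
  have hv : ∀ c ∈ I k, ∀ d ∈ I k, vec (hgt k) (I k) (x k) c d.rev =
      if hgt k d.rev < hgt k c then x k c d.rev else 0 := by
    intro c hc d hd
    have hd' : d.rev ∉ I k := hI.lagrangian k hk d hd
    rw [vec, if_neg]
    · split_ifs with h1 h2 h2
      · rfl
      · exact absurd h1.1 h2
      · exact absurd ⟨h2, hd'⟩ h1
      · rfl
    · rintro rfl; exact hd' hc
  rw [hv a' ha' a ha, hv a ha a' ha', hx]
  have h1 := hgt_rev hk a
  have h2 := hgt_rev hk a'
  simp only [Fin.rev_rev, sgn_rev]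
  have s1 := sgn_mul_self R a
  have s2 := sgn_mul_self R a'
  by_cases hlt : hgt k a.rev < hgt k a'
  · have hlt' : hgt k a'.rev < hgt k a := by omega
    rw [if_pos hlt, if_pos hlt']
    rcases lt_trichotomy a a' with h | h | h
    · rw [if_pos h.le, if_neg (not_le.2 h)]
      linear_combination (-sgn R a * y a' a.rev) * s2
    · subst h
      simp
    · rw [if_neg (not_le.2 h), if_pos h.le]
      linear_combination (sgn R a' * y a a'.rev) * s1
  · have hlt' : ¬hgt k a'.rev < hgt k a := by omega
    rw [if_neg hlt, if_neg hlt']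
    simp

/-- The formula is not circular: its coefficients are entries in columns of `I l`, where `x k`
agrees with `y`. Where the echelon shape of `V k` demands a zero, the sum vanishes as well, since
the two orders agree away from `idx l`. -/
theorem stepCond_of_eq (hI : IsIndex I) {k l : Fin n} (hkl : (k : ℕ) + 1 = l)
    (y : Fin (2 * n) → Fin (2 * n) → R) {x : Fin n → Fin (2 * n) → Fin (2 * n) → R}
    (hx : x k = fun a b => if b ∈ I l ∨ b = idx l then y a b else
      ∑ c ∈ I l, prVec (idx l) (vec (hgt k) (I k) y a) c * vec (hgt l) (I l) (x l) c b) :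
    StepCond I x k l := by
  intro a ha b
  have hw : ∀ c ∈ I l, prVec (idx l) (vec (hgt k) (I k) (x k) a) c =
      prVec (idx l) (vec (hgt k) (I k) y a) c := by
    intro c hc
    simp only [prVec, vec, hx, if_pos (Or.inl hc : c ∈ I l ∨ c = idx l)]
  by_cases hbl : b = idx l
  · rw [prVec, if_pos hbl, Finset.sum_eq_zero]
    intro c hc
    by_cases hcl : c = idx l
    · rw [prVec, if_pos hcl, zero_mul]
    · rw [hbl, vec_of_lt (hgt_lt_idx l hcl), mul_zero]
  by_cases hb : b ∈ I l
  · rw [Finset.sum_eq_single_of_mem b hb, vec_self, mul_one]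
    intro c hc hcb
    rw [vec_of_mem hb hcb.symm, mul_zero]
  rw [Finset.sum_congr rfl fun c hc => by rw [hw c hc]]
  have hbk : b ∉ I k := fun h => by
    rcases Finset.mem_insert.1 (hI.step k l hkl h) with h' | h'
    · exact hbl h'
    · exact hb h'
  rw [prVec, if_neg hbl]
  by_cases hlt : hgt k b < hgt k a
  · rw [vec_of_not_mem hbk hlt, hx]
    simp only [hbl, hb, or_self, if_false]
  · rw [vec, if_neg, if_neg fun h => hlt h.1, Finset.sum_eq_zero]
    · intro c hc
      rw [prVec]
      split_ifs with hcl
      · rw [zero_mul]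
      rw [vec, vec]
      have hcb : b ≠ c := by rintro rfl; exact hb hc
      rw [if_neg hcb]
      split_ifs with h1 h2 h2 h3
      · exact absurd h2.1 (by rw [hgt_succ hkl hbl, hgt_succ hkl hcl, h1]; omega)
      · simp
      · exact absurd h3.1 (by rw [hgt_succ hkl hbl, hgt_succ hkl hcl]; omega)
      all_goals simp
    · rintro rfl; exact hbk ha

/-- There is a solution of the equations of a cell with given free coordinates. -/
theorem exists_isCoords (hI : IsIndex I) (y : Fin n → Fin (2 * n) → Fin (2 * n) → R) :
    ∃ x, IsCoords I x ∧ ∀ k a b, Free I k a b → x k a b = y k a b := by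
  -- The solution is built downwards: after `m` steps the equations hold for the last `m` indices.
  -- Step `m + 1` changes only `x k₀`, which no earlier equation involves.
  have key : ∀ m, m ≤ n → ∃ x : Fin n → Fin (2 * n) → Fin (2 * n) → R,
      (∀ k l : Fin n, n ≤ k + m → (k : ℕ) + 1 = l → StepCond I x k l) ∧
      (∀ k : Fin n, n ≤ k + m → (k : ℕ) + 1 = n → IsotropicCond I x k) ∧
      ∀ (k : Fin n) (a b : Fin (2 * n)), n ≤ (k : ℕ) + m → Free I k a b → x k a b = y k a b := by
    intro m
    induction m with
    | zero => exact fun _ => ⟨y, fun k l h => by omega, fun k h => by omega, fun k _ _ h => by omega⟩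
    | succ m ih =>
      intro hm
      obtain ⟨x, h1, h2, h3⟩ := ih (by omega)
      let k₀ : Fin n := ⟨n - 1 - m, by omega⟩
      have hk₀ : (k₀ : ℕ) = n - 1 - m := rfl
      have hne : ∀ k : Fin n, n ≤ k + m → k ≠ k₀ := by rintro k hk rfl; omega
      have heq : ∀ k : Fin n, n ≤ k + (m + 1) → ¬n ≤ k + m → k = k₀ := fun k hk hk' =>
        Fin.ext (by omega)
      have hold : ∀ z, (∀ k l : Fin n, n ≤ k + m → (k : ℕ) + 1 = l →
            StepCond I (Function.update x k₀ z) k l) ∧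
          (∀ k : Fin n, n ≤ k + m → (k : ℕ) + 1 = n →
            IsotropicCond I (Function.update x k₀ z) k) ∧
          ∀ (k : Fin n) (a b : Fin (2 * n)), n ≤ (k : ℕ) + m → Free I k a b → Function.update x k₀ z k a b = y k a b := by
        intro z
        refine ⟨fun k l hk hkl => ?_, fun k hk hkn => ?_, fun k a b hk hf => ?_⟩
        · have := h1 k l hk hkl
          rw [StepCond, Function.update_of_ne (hne k hk),
            Function.update_of_ne (hne l (by omega))]
          exact this
        · have := h2 k hk hkn
          rw [IsotropicCond, Function.update_of_ne (hne k hk)]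
          exact this
        · rw [Function.update_of_ne (hne k hk)]
          exact h3 k a b hk hf
      by_cases hm0 : (k₀ : ℕ) + 1 = n
      · let z : Fin (2 * n) → Fin (2 * n) → R := fun a b =>
          if b.rev ≤ a then y k₀ a b else -sgn R b * sgn R a * y k₀ b.rev a.rev
        refine ⟨Function.update x k₀ z, fun k l hk hkl => ?_, fun k hk hkn => ?_,
          fun k a b hk hf => ?_⟩
        · exact (hold z).1 k l (by omega) hkl
        · have : k = k₀ := Fin.ext (by omega)
          rw [this]
          exact isotropicCond_of_eq hI hm0 (y k₀) (Function.update_self ..)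
        · by_cases hk' : n ≤ (k : ℕ) + m
          · exact (hold z).2.2 k a b hk' hf
          · obtain rfl := heq k hk hk'
            rw [Function.update_self]
            exact if_pos (hf.2.2.2.1 hm0)
      · let l : Fin n := ⟨k₀ + 1, by omega⟩
        have hl : (k₀ : ℕ) + 1 = l := rfl
        have hlk : l ≠ k₀ := fun h => by rw [h] at hl; omega
        let z : Fin (2 * n) → Fin (2 * n) → R := fun a b =>
          if b ∈ I l ∨ b = idx l then y k₀ a b else ∑ c ∈ I l,
            prVec (idx l) (vec (hgt k₀) (I k₀) (y k₀) a) c * vec (hgt l) (I l) (x l) c b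
        refine ⟨Function.update x k₀ z, fun k l' hk hkl => ?_, fun k hk hkn => ?_,
          fun k a b hk hf => ?_⟩
        · by_cases hk' : n ≤ (k : ℕ) + m
          · exact (hold z).1 k l' hk' hkl
          · obtain rfl := heq k hk hk'
            obtain rfl : l' = l := Fin.ext (hkl.symm.trans hl)
            refine stepCond_of_eq hI hl (y k₀) ?_
            rw [Function.update_self, Function.update_of_ne hlk]
        · exact (hold z).2.1 k (by omega) hkn
        · by_cases hk' : n ≤ (k : ℕ) + m
          · exact (hold z).2.2 k a b hk' hf
          · obtain rfl := heq k hk hk'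
            rw [Function.update_self]
            exact if_pos (hf.2.2.2.2 l hl)
  obtain ⟨x, h1, h2, h3⟩ := key n le_rfl
  exact ⟨x, ⟨fun k l => h1 k l (by omega), fun k => h2 k (by omega)⟩,
    fun k a b => h3 k a b (by omega)⟩

end Coordinates

/-- For every `c` one of `c` and `c.rev` lies in `I k`, where a row vanishes unless it leads there.
Only the terms at `a` and at `a'.rev` survive. -/
theorem form_vec {I : Fin n → Finset (Fin (2 * n))} (hI : IsIndex I) {k : Fin n}
    (hk : (k : ℕ) + 1 = n) (x : Fin (2 * n) → Fin (2 * n) → ℂ) {a a' : Fin (2 * n)}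
    (ha : a ∈ I k) (ha' : a' ∈ I k) :
    form (vec (hgt k) (I k) x a) (vec (hgt k) (I k) x a') =
      sgn ℂ a * vec (hgt k) (I k) x a' a.rev + sgn ℂ a'.rev * vec (hgt k) (I k) x a a'.rev := by
  rw [form_eq, Finset.sum_eq_add a a'.rev]
  · rw [vec_self, Fin.rev_rev, vec_self, one_mul, mul_one]
  · rintro rfl
    exact hI.lagrangian k hk _ ha' ha
  · rintro c - ⟨hca, hca'⟩
    by_cases hc : c ∈ I k
    · rw [vec_of_mem hc hca, zero_mul, mul_zero]
    · rw [vec_of_mem (a := a') ((hI.rev_mem_iff hk c).2 hc), mul_zero, mul_zero]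
      rintro rfl
      simp at hca'
  · simp
  · simp

/-- The form as a bilinear map. -/
noncomputable def formₗ (n : ℕ) : E n →ₗ[ℂ] E n →ₗ[ℂ] ℂ :=
  LinearMap.mk₂ ℂ form
    (fun u v w => by simp only [form_eq, Pi.add_apply, ← Finset.sum_add_distrib]
                     exact Finset.sum_congr rfl fun _ _ => by ring)
    (fun c v w => by simp only [form_eq, Pi.smul_apply, smul_eq_mul, Finset.mul_sum]
                     exact Finset.sum_congr rfl fun _ _ => by ring)
    (fun u v w => by simp only [form_eq, Pi.add_apply, ← Finset.sum_add_distrib]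
                     exact Finset.sum_congr rfl fun _ _ => by ring)
    (fun c v w => by simp only [form_eq, Pi.smul_apply, smul_eq_mul, Finset.mul_sum]
                     exact Finset.sum_congr rfl fun _ _ => by ring)

theorem mem_SpF_iff {I : Fin n → Finset (Fin (2 * n))} (hI : IsIndex I) {V : GrProd n}
    {x : Fin n → Fin (2 * n) → Fin (2 * n) → ℂ}
    (hV : ∀ k, V.1 k = space (hgt k) (I k) (x k)) : V ∈ SpF n ↔ IsCoords I x := by
  have hstep : ∀ k l : Fin n, (V.1 k).map (pr (idx l)) ≤ V.1 l ↔ StepCond I x k l := by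
    intro k l
    rw [hV k, hV l, space, Submodule.map_span, Submodule.span_le]
    constructor
    · intro h a ha b
      have := mem_space_iff.1 (h ⟨_, ⟨a, ha, rfl⟩, rfl⟩)
      have := congrFun this b
      rw [Finset.sum_apply] at this
      exact this
    · rintro h _ ⟨_, ⟨a, ha, rfl⟩, rfl⟩
      refine mem_space_iff.2 (funext fun b => ?_)
      rw [Finset.sum_apply]
      exact h a ha b
  have hform : ∀ k : Fin n, (k : ℕ) + 1 = n →
      ((∀ v ∈ V.1 k, ∀ w ∈ V.1 k, form v w = 0) ↔ IsotropicCond I x k) := by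
    intro k hk
    rw [hV k]
    constructor
    · intro h a ha a' ha'
      rw [← form_vec hI hk (x k) ha ha']
      exact h _ (vec_mem_space ha) _ (vec_mem_space ha')
    · intro h v hv w hw
      change formₗ n v w = 0
      rw [mem_space_iff.1 hv, mem_space_iff.1 hw]
      simp only [map_sum, map_smul, LinearMap.sum_apply, LinearMap.smul_apply]
      refine Finset.sum_eq_zero fun a ha => ?_
      rw [Finset.sum_eq_zero, smul_zero]
      intro a' ha'
      have := form_vec hI hk (x k) ha' ha
      rw [h a' ha' a ha] at this
      change v a' • form _ _ = 0
      rw [this, smul_zero]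
  constructor
  · intro h
    exact ⟨fun k l hkl => (hstep k l).1 (h.1 k l hkl), fun k hk => (hform k hk).1 (h.2 k hk)⟩
  · intro h
    exact ⟨fun k l hkl => (hstep k l).2 (h.step k l hkl),
      fun k hk => (hform k hk).2 (h.isotropic k hk)⟩

end SpFlag

/-! ### The Zariski topology of an affine space -/

/-- The points of complex affine space, with the Zariski topology. -/
def ZariskiSpace (σ : Type*) : Type _ := σ → ℂ

namespace ZariskiSpace

open MvPolynomial TopologicalSpace

variable {σ : Type*}

/-- The non-vanishing locus of a polynomial. -/
def basicOpen (p : MvPolynomial σ ℂ) : Set (ZariskiSpace σ) := {x | eval x p ≠ 0}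

instance : TopologicalSpace (ZariskiSpace σ) := generateFrom (Set.range basicOpen)

theorem isOpen_basicOpen (p : MvPolynomial σ ℂ) : IsOpen (basicOpen p) :=
  isOpen_generateFrom_of_mem ⟨p, rfl⟩

theorem exists_basicOpen {U : Set (ZariskiSpace σ)} (hU : IsOpen U) {x : ZariskiSpace σ}
    (hx : x ∈ U) : ∃ p, x ∈ basicOpen p ∧ basicOpen p ⊆ U := by
  induction hU with
  | basic s hs =>
    obtain ⟨p, rfl⟩ := hs
    exact ⟨p, hx, subset_rfl⟩
  | univ => exact ⟨1, by simp [basicOpen], Set.subset_univ _⟩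
  | inter s t _ _ ihs iht =>
    obtain ⟨p, hp, hps⟩ := ihs hx.1
    obtain ⟨q, hq, hqt⟩ := iht hx.2
    refine ⟨p * q, ?_, fun y hy => ?_⟩
    · exact (map_mul (eval x) p q).trans_ne (mul_ne_zero hp hq)
    · have hy : eval y (p * q) ≠ 0 := hy
      rw [map_mul] at hy
      exact ⟨hps (left_ne_zero_of_mul hy), hqt (right_ne_zero_of_mul hy)⟩
  | sUnion S _ ih =>
    obtain ⟨s, hs, hxs⟩ := hx
    obtain ⟨p, hp, hps⟩ := ih s hs hxs
    exact ⟨p, hp, hps.trans (Set.subset_sUnion_of_mem hs)⟩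

/-- The common zeros of the polynomials in an ideal. -/
def zeros (J : Ideal (MvPolynomial σ ℂ)) : Set (ZariskiSpace σ) := zeroLocus ℂ J

/-- The ideal of polynomials vanishing on a set. -/
noncomputable def ideal (Z : Set (ZariskiSpace σ)) : Ideal (MvPolynomial σ ℂ) :=
  vanishingIdeal ℂ (K := ℂ) (σ := σ) Z

theorem mem_ideal {Z : Set (ZariskiSpace σ)} {p : MvPolynomial σ ℂ} :
    p ∈ ideal Z ↔ ∀ x ∈ Z, eval x p = 0 := mem_vanishingIdeal_iff

theorem isClosed_zeros (J : Ideal (MvPolynomial σ ℂ)) : IsClosed (zeros J) := by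
  rw [← isOpen_compl_iff]
  have : (zeros J)ᶜ = ⋃ p ∈ J, basicOpen p := by
    ext x
    simp only [Set.mem_compl_iff, Set.mem_iUnion, exists_prop]
    refine (not_congr mem_zeroLocus_iff).trans ?_
    push Not
    rfl
  rw [this]
  exact isOpen_biUnion fun p _ => isOpen_basicOpen p

/-- A point outside the closed set has a basic open neighbourhood off it, whose polynomial lies in
the ideal but is nonzero at the point. -/
theorem zeros_ideal {Z : Set (ZariskiSpace σ)} (hZ : IsClosed Z) :
    zeros (ideal Z) = Z := by
  refine subset_antisymm (fun x hx => ?_) (zeroLocus_vanishingIdeal_le _)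
  by_contra hxZ
  obtain ⟨p, hp, hpZ⟩ := exists_basicOpen hZ.isOpen_compl hxZ
  refine hp (mem_zeroLocus_iff.1 hx p (mem_ideal.2 fun y hy => ?_))
  by_contra hy'
  exact hpZ hy' hy

theorem isPrime_ideal {Z : Set (ZariskiSpace σ)} (hZ : IsIrreducible Z) :
    (ideal Z).IsPrime := by
  refine ⟨fun h => ?_, fun {p q} hpq => ?_⟩
  · obtain ⟨x, hx⟩ := hZ.1
    have := mem_ideal.1 ((Ideal.eq_top_iff_one _).1 h) x hx
    simp at this
  · by_contra! h
    rw [mem_ideal, mem_ideal] at h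
    rw [mem_ideal] at hpq
    push Not at h
    obtain ⟨⟨x, hx, hxp⟩, y, hy, hyq⟩ := h
    obtain ⟨z, hz, hzp, hzq⟩ := hZ.2 _ _ (isOpen_basicOpen p) (isOpen_basicOpen q)
      ⟨x, hx, hxp⟩ ⟨y, hy, hyq⟩
    have := hpq z hz
    rw [map_mul] at this
    exact mul_ne_zero hzp hzq this

variable [Finite σ]

/-- The Nullstellensatz provides a zero of `P` outside the zeros of any polynomial not in `P`;
primality then handles products. -/
theorem isIrreducible_zeros (P : Ideal (MvPolynomial σ ℂ)) [hP : P.IsPrime] :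
    IsIrreducible (zeros P) := by
  have hv : ideal (zeros P) = P := IsPrime.vanishingIdeal_zeroLocus (K := ℂ) P
  have hmem : ∀ p, p ∉ P → ∃ x ∈ zeros P, eval x p ≠ 0 := by
    intro p hp
    rw [← hv, mem_ideal] at hp
    push Not at hp
    exact hp
  constructor
  · obtain ⟨x, hx, -⟩ := hmem 1 fun h => hP.ne_top ((Ideal.eq_top_iff_one _).2 h)
    exact ⟨x, hx⟩
  · rintro u v hu hv' ⟨x, hx, hxu⟩ ⟨y, hy, hyv⟩
    obtain ⟨p, hp, hpu⟩ := exists_basicOpen hu hxu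
    obtain ⟨q, hq, hqv⟩ := exists_basicOpen hv' hyv
    have hpq : p * q ∉ P := by
      intro h
      rcases hP.mem_or_mem h with h | h
      · exact hp (mem_zeroLocus_iff.1 hx p h)
      · exact hq (mem_zeroLocus_iff.1 hy q h)
    obtain ⟨z, hz, hzpq⟩ := hmem _ hpq
    rw [map_mul] at hzpq
    exact ⟨z, hz, hpu (left_ne_zero_of_mul hzpq), hqv (right_ne_zero_of_mul hzpq)⟩

/-- Irreducible closed subsets correspond to prime ideals. -/
noncomputable def irreducibleClosedsEquiv :
    IrreducibleCloseds (ZariskiSpace σ) ≃o (PrimeSpectrum (MvPolynomial σ ℂ))ᵒᵈ where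
  toFun Z := OrderDual.toDual ⟨ideal Z.carrier,
    isPrime_ideal Z.isIrreducible'⟩
  invFun P := ⟨zeros (OrderDual.ofDual P).asIdeal, isIrreducible_zeros _,
    isClosed_zeros _⟩
  left_inv Z := IrreducibleCloseds.ext (zeros_ideal Z.isClosed')
  right_inv P := OrderDual.ofDual_inj.1
    (PrimeSpectrum.ext (IsPrime.vanishingIdeal_zeroLocus (OrderDual.ofDual P).asIdeal))
  map_rel_iff' := by
    intro Z W
    change ideal W.carrier ≤ ideal Z.carrier ↔ _
    constructor
    · intro h
      have : zeros _ ⊆ zeros _ := zeroLocus_anti_mono (K := ℂ) h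
      rw [zeros_ideal Z.isClosed', zeros_ideal W.isClosed'] at this
      exact this
    · exact fun h => vanishingIdeal_anti_mono h

/-- The correspondence with primes reverses inclusions, which does not change the length of chains.
-/
theorem topologicalKrullDim_eq : topologicalKrullDim (ZariskiSpace σ) = Nat.card σ := by
  rw [topologicalKrullDim, Order.krullDim_eq_of_orderIso irreducibleClosedsEquiv,
    Order.krullDim_orderDual]
  change ringKrullDim _ = _
  rw [ringKrullDim_of_isNoetherianRing, ringKrullDim_eq_zero_of_field, zero_add]

end ZariskiSpace

/-! ### The cells are affine spaces -/

namespace SpFlag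

open Echelon MvPolynomial

variable {n : ℕ}

theorem eval_bind₁ {σ τ R : Type*} [CommRing R] (y : τ → R) (q : σ → MvPolynomial τ R)
    (p : MvPolynomial σ R) : eval y (bind₁ q p) = eval (fun s => eval y (q s)) p := by
  induction p using MvPolynomial.induction_on with
  | C c => simp
  | add p q hp hq => rw [map_add, map_add, hp, hq, map_add]
  | mul_X p s hp => rw [map_mul, map_mul, hp, map_mul, bind₁_X_right, eval_X]

/-- The index type of the coordinates of a tuple of frames. -/
abbrev CoordIdx (n : ℕ) : Type := Σ k : Fin n, Fin ((k : ℕ) + 1) × Fin (2 * n)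

/-- The generic matrix. -/
noncomputable def genMat (k : Fin n) :
    Matrix (Fin ((k : ℕ) + 1)) (Fin (2 * n)) (MvPolynomial (CoordIdx n) ℂ) :=
  fun i b => X ⟨k, i, b⟩

theorem map_genMat (A : Frames n) (k : Fin n) :
    (genMat k).map (eval A.coord) = toMat (A.1 k) := by
  ext i b
  simp [genMat, Frames.coord]

theorem map_minor_genMat (A : Frames n) (k : Fin n) {J : Finset (Fin (2 * n))}
    (hJ : J.card = (k : ℕ) + 1) :
    (minor hJ (genMat k)).map (eval A.coord) = minor hJ (toMat (A.1 k)) := by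
  rw [← map_genMat]
  rfl

theorem continuous_coord : Continuous (Frames.coord : Frames n → CoordIdx n → ℂ) := by
  refine continuous_pi fun s => ?_
  exact (continuous_apply s.2.2).comp ((continuous_apply s.2.1).comp
    ((continuous_apply s.1).comp continuous_frames_val))

/-- The index type of the free coordinates of a cell. -/
abbrev FreeIdx (I : Fin n → Finset (Fin (2 * n))) : Type :=
  {s : Fin n × Fin (2 * n) × Fin (2 * n) // Free I s.1 s.2.1 s.2.2}

namespace IsIndex

variable {I : Fin n → Finset (Fin (2 * n))} (hI : IsIndex I)

/-- The product of the minors with columns `I_k`. -/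
noncomputable def den (A : Frames n) : ℂ := ∏ k, (minor (hI.card k) (toMat (A.1 k))).det

/-- The polynomial defining `den`. -/
noncomputable def denPoly : MvPolynomial (CoordIdx n) ℂ :=
  ∏ k, (minor (hI.card k) (genMat k)).det

theorem eval_det_minor (A : Frames n) (k : Fin n) :
    eval A.coord (minor (hI.card k) (genMat k)).det = (minor (hI.card k) (toMat (A.1 k))).det := by
  rw [RingHom.map_det]
  congr 1
  exact map_minor_genMat A k (hI.card k)

theorem eval_denPoly (A : Frames n) : eval A.coord hI.denPoly = hI.den A := by
  rw [denPoly, map_prod, den]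
  exact Finset.prod_congr rfl fun k _ => hI.eval_det_minor A k

theorem span_range_eq {A A' : Frames n} (h : A.span = A'.span) (k : Fin n) :
    Submodule.span ℂ (Set.range (A.1 k)) = Submodule.span ℂ (Set.range (A'.1 k)) :=
  congrFun (congrArg Subtype.val h) k

theorem den_ne_zero_iff {A : Frames n} :
    hI.den A ≠ 0 ↔ ∀ k, (minor (hI.card k) (toMat (A.1 k))).det ≠ 0 := by
  rw [den, Finset.prod_ne_zero_iff]
  simp

theorem den_ne_zero_of_span_eq {A A' : Frames n} (h : A.span = A'.span) (hA : hI.den A ≠ 0) :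
    hI.den A' ≠ 0 := by
  rw [den_ne_zero_iff] at hA ⊢
  exact fun k => det_minor_ne_zero_of_span_le (hI.card k) (span_range_eq h k).le (hA k)

/-- The set of points at which the minors with columns `I_k` do not vanish. -/
def chartDomain : Set (GrProd n) := {V | ∃ A : Frames n, A.span = V ∧ hI.den A ≠ 0}

theorem span_mem_chartDomain {A : Frames n} : A.span ∈ hI.chartDomain ↔ hI.den A ≠ 0 :=
  ⟨fun ⟨_, h, hA⟩ => hI.den_ne_zero_of_span_eq h hA, fun h => ⟨A, rfl, h⟩⟩

theorem cell_subset_chartDomain : cell I ⊆ hI.chartDomain := by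
  intro V hV
  obtain ⟨A, rfl⟩ := span_surjective V
  refine hI.span_mem_chartDomain.2 (hI.den_ne_zero_iff.2 fun k => ?_)
  obtain ⟨x, hx⟩ := (mem_cell_iff.1 hV).2 k
  exact det_minor_ne_zero (hI.card k) hx

theorem isOpen_chartDomain : IsOpen hI.chartDomain := by
  rw [← isQuotientMap_span.isOpen_preimage]
  have : Frames.span ⁻¹' hI.chartDomain = {A : Frames n | eval A.coord hI.denPoly ≠ 0} := by
    ext A
    rw [Set.mem_preimage, span_mem_chartDomain, Set.mem_ofPred_eq, eval_denPoly]
  rw [this]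
  exact isOpen_ne.preimage ((MvPolynomial.continuous_eval _).comp continuous_coord)

/-- The reduced frames of a point. -/
noncomputable def reduced (V : GrProd n) (k : Fin n) :
    Matrix (Fin ((k : ℕ) + 1)) (Fin (2 * n)) ℂ :=
  (minor (hI.card k) (toMat ((span_surjective V).choose.1 k)))⁻¹ *
    toMat ((span_surjective V).choose.1 k)

/-- On the chart domain the normalised frame does not depend on the frame chosen in `reduced`. -/
theorem reduced_span {A : Frames n} (hA : hI.den A ≠ 0) (k : Fin n) :
    hI.reduced A.span k = (minor (hI.card k) (toMat (A.1 k)))⁻¹ * toMat (A.1 k) :=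
  (inv_minor_mul_eq_of_span_eq (hI.card k)
    (span_range_eq (span_surjective A.span).choose_spec.symm k)
    (hI.den_ne_zero_iff.1 hA k)).symm

theorem reduced_of_eq_space {V : GrProd n} (hV : V ∈ cell I) {k : Fin n}
    {x : Fin (2 * n) → Fin (2 * n) → ℂ} (hx : V.1 k = space (hgt k) (I k) x) :
    hI.reduced V k = frame (hgt k) (hI.card k) x := by
  obtain ⟨A, rfl⟩ := span_surjective V
  have hA := hI.span_mem_chartDomain.1 (hI.cell_subset_chartDomain hV)
  rw [reduced_span hI hA]
  have h := eq_minor_mul_frame (hI.card k) (A := toMat (A.1 k)) hx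
  nth_rewrite 2 [h]
  rw [← Matrix.mul_assoc, Matrix.nonsing_inv_mul _ (Ne.isUnit (hI.den_ne_zero_iff.1 hA k)),
    Matrix.one_mul]

/-- The free coordinates of a point. -/
noncomputable def chart (V : GrProd n) (s : FreeIdx I) : ℂ :=
  hI.reduced V s.1.1 ((I s.1.1).equivFinOfCardEq (hI.card _) ⟨s.1.2.1, s.2.1⟩) s.1.2.2

theorem chart_of_eq_space {V : GrProd n} (hV : V ∈ cell I)
    {x : Fin n → Fin (2 * n) → Fin (2 * n) → ℂ}
    (hx : ∀ k, V.1 k = space (hgt k) (I k) (x k)) (s : FreeIdx I) :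
    hI.chart V s = x s.1.1 s.1.2.1 s.1.2.2 := by
  rw [chart, hI.reduced_of_eq_space hV (hx _)]
  simp only [frame, Equiv.symm_apply_apply]
  exact vec_of_not_mem s.2.2.1 s.2.2.2.1

/-- The numerators of the coordinates. -/
noncomputable def numPoly (s : FreeIdx I) : MvPolynomial (CoordIdx n) ℂ :=
  (∏ k ∈ Finset.univ.erase s.1.1, (minor (hI.card k) (genMat k)).det) *
    ((minor (hI.card s.1.1) (genMat s.1.1)).adjugate * genMat s.1.1)
      ((I s.1.1).equivFinOfCardEq (hI.card _) ⟨s.1.2.1, s.2.1⟩) s.1.2.2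

/-- Cramer's rule: the adjugate replaces the inverse of the minor, at the cost of its determinant.
-/
theorem eval_numPoly {A : Frames n} (hA : hI.den A ≠ 0) (s : FreeIdx I) :
    eval A.coord (hI.numPoly s) = hI.den A * hI.chart A.span s := by
  have hk := hI.den_ne_zero_iff.1 hA s.1.1
  have h1 : eval A.coord (((minor (hI.card s.1.1) (genMat s.1.1)).adjugate * genMat s.1.1)
      ((I s.1.1).equivFinOfCardEq (hI.card _) ⟨s.1.2.1, s.2.1⟩) s.1.2.2) =
      ((minor (hI.card s.1.1) (toMat (A.1 s.1.1))).adjugate * toMat (A.1 s.1.1))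
      ((I s.1.1).equivFinOfCardEq (hI.card _) ⟨s.1.2.1, s.2.1⟩) s.1.2.2 := by
    rw [← map_minor_genMat, ← map_genMat A s.1.1, ← RingHom.mapMatrix_apply,
      ← RingHom.map_adjugate, RingHom.mapMatrix_apply, ← Matrix.map_mul, Matrix.map_apply]
  rw [numPoly, map_mul, map_prod, h1, chart, hI.reduced_span hA, den,
    ← Finset.mul_prod_erase _ _ (Finset.mem_univ s.1.1), Matrix.inv_def, Ring.inverse_eq_inv',
    Matrix.smul_mul, Matrix.smul_apply, smul_eq_mul]
  rw [Finset.prod_congr rfl fun k _ => hI.eval_det_minor A k]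
  field_simp

/-- Denominators are cleared by a power of `den`, so that non-vanishing of `g` on the chart is a
polynomial condition on frames. -/
theorem exists_eval_chart (g : MvPolynomial (FreeIdx I) ℂ) :
    ∃ (G : MvPolynomial (CoordIdx n) ℂ) (N : ℕ), ∀ A : Frames n, hI.den A ≠ 0 →
      eval A.coord G = hI.den A ^ N * eval (hI.chart A.span) g := by
  induction g using MvPolynomial.induction_on with
  | C c => exact ⟨C c, 0, fun A _ => by simp⟩
  | add p q hp hq =>
    obtain ⟨G, N, hG⟩ := hp
    obtain ⟨G', N', hG'⟩ := hq
    refine ⟨hI.denPoly ^ N' * G + hI.denPoly ^ N * G', N + N', fun A hA => ?_⟩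
    rw [map_add, map_mul, map_mul, map_pow, map_pow, eval_denPoly, hG A hA, hG' A hA, map_add]
    ring
  | mul_X p s hp =>
    obtain ⟨G, N, hG⟩ := hp
    refine ⟨G * hI.numPoly s, N + 1, fun A hA => ?_⟩
    rw [map_mul, hG A hA, hI.eval_numPoly hA, map_mul, eval_X]
    ring

theorem continuousOn_chart : ContinuousOn hI.chart hI.chartDomain := by
  refine continuousOn_pi.2 fun s => ?_
  rw [isQuotientMap_span.continuousOn_isOpen_iff hI.isOpen_chartDomain]
  have hden : Continuous fun A : Frames n => hI.den A := by
    simp only [← eval_denPoly]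
    exact (MvPolynomial.continuous_eval _).comp continuous_coord
  have hnum : Continuous fun A : Frames n => eval A.coord (hI.numPoly s) :=
    (MvPolynomial.continuous_eval _).comp continuous_coord
  refine (hnum.continuousOn.div hden.continuousOn fun A hA =>
    hI.span_mem_chartDomain.1 hA).congr fun A hA => ?_
  have hA := hI.span_mem_chartDomain.1 hA
  change hI.chart A.span s = _
  rw [Pi.div_apply, hI.eval_numPoly hA, mul_div_cancel_left₀ _ hA]

open Classical in
/-- The generic solution of the equations of the cell. -/
noncomputable def polyCoords : Fin n → Fin (2 * n) → Fin (2 * n) → MvPolynomial (FreeIdx I) ℂ :=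
  (exists_isCoords hI fun k a b => if h : Free I k a b then X ⟨(k, a, b), h⟩ else 0).choose

theorem isCoords_polyCoords : IsCoords I hI.polyCoords :=
  (exists_isCoords hI _).choose_spec.1

theorem polyCoords_apply (s : FreeIdx I) : hI.polyCoords s.1.1 s.1.2.1 s.1.2.2 = X s := by
  refine ((exists_isCoords hI _).choose_spec.2 _ _ _ s.2).trans ?_
  exact dif_pos s.2

/-- The coordinates of the point with given free coordinates. -/
noncomputable def coords (y : FreeIdx I → ℂ) (k : Fin n) (a b : Fin (2 * n)) : ℂ :=
  eval y (hI.polyCoords k a b)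

theorem isCoords_coords (y : FreeIdx I → ℂ) : IsCoords I (hI.coords y) :=
  hI.isCoords_polyCoords.map (eval y)

/-- The frames of the point with given free coordinates. -/
noncomputable def paramFrame (y : FreeIdx I → ℂ) : Frames n :=
  ⟨fun k => frame (hgt k) (hI.card k) (hI.coords y k), fun k =>
    linearIndependent_frame (hI.card k)⟩

theorem paramFrame_coord (y : FreeIdx I → ℂ) (s : CoordIdx n) :
    (hI.paramFrame y).coord s =
      eval y (frame (hgt s.1) (hI.card s.1) (hI.polyCoords s.1) s.2.1 s.2.2) := by
  exact (map_vec (eval y) _ _ _ _ _).symm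

theorem paramFrame_span (y : FreeIdx I → ℂ) (k : Fin n) :
    (hI.paramFrame y).span.1 k = space (hgt k) (I k) (hI.coords y k) :=
  span_frame (hI.card k)

theorem paramFrame_span_mem (y : FreeIdx I → ℂ) : (hI.paramFrame y).span ∈ cell I :=
  mem_cell_iff.2 ⟨(mem_SpF_iff hI (hI.paramFrame_span y)).2 (hI.isCoords_coords y),
    fun k => ⟨_, hI.paramFrame_span y k⟩⟩

/-- The parametrization of a cell. -/
noncomputable def cellEquiv : (FreeIdx I → ℂ) ≃ cell I where
  toFun y := ⟨(hI.paramFrame y).span, hI.paramFrame_span_mem y⟩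
  invFun V := hI.chart V
  left_inv y := by
    funext s
    change hI.chart (hI.paramFrame y).span s = y s
    rw [hI.chart_of_eq_space (hI.paramFrame_span_mem y) (hI.paramFrame_span y) s, coords,
      polyCoords_apply, eval_X]
  right_inv V := by
    obtain ⟨V, hV⟩ := V
    obtain ⟨hV1, hV2⟩ := mem_cell_iff.1 hV
    choose x hx using hV2
    refine Subtype.ext (Subtype.ext (funext fun k => ?_))
    change (hI.paramFrame (hI.chart V)).span.1 k = V.1 k
    rw [paramFrame_span, hx k, space, space]
    congr 1
    refine Set.image_congr fun a ha => funext fun b => ?_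
    -- Two solutions of the cell equations with equal free coordinates agree; `n - 1 - k` is the
    -- distance to the last index.
    refine (hI.isCoords_coords _).vec_eq hI ((mem_SpF_iff hI hx).1 hV1) ?_ (n - 1 - k) k
      (by omega) a ha b
    intro k a b hf
    rw [coords, hI.polyCoords_apply ⟨(k, a, b), hf⟩, eval_X, hI.chart_of_eq_space hV hx]

/-- The parametrization of a cell is a homeomorphism for the Euclidean topology. -/
noncomputable def cellHomeomorph : (FreeIdx I → ℂ) ≃ₜ cell I where
  toEquiv := hI.cellEquiv
  continuous_toFun := by
    refine Continuous.subtype_mk ?_ _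
    refine isQuotientMap_span.continuous.comp (continuous_induced_rng.2 ?_)
    refine continuous_pi fun k => continuous_pi fun i => continuous_pi fun b => ?_
    have := fun y => hI.paramFrame_coord y ⟨k, i, b⟩
    refine Continuous.congr (MvPolynomial.continuous_eval _) fun y => (this y).symm
  continuous_invFun :=
    continuousOn_iff_continuous_domRestrict.1
      (hI.continuousOn_chart.mono hI.cell_subset_chartDomain)

theorem continuous_cellEquiv_zariski :
    @Continuous (ZariskiSpace (FreeIdx I)) (cell I) _
      (@instTopologicalSpaceSubtype (GrProd n) (· ∈ cell I) (zariski n)) hI.cellEquiv := by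
  let _ : TopologicalSpace (Frames n) := framesZariski n
  let _ : TopologicalSpace (GrProd n) := zariski n
  have h1 : Continuous (Frames.span : Frames n → GrProd n) := continuous_coinduced_rng
  refine continuous_induced_rng.2 (h1.comp
    (g := Frames.span) (f := fun y : ZariskiSpace (FreeIdx I) => hI.paramFrame y) ?_)
  refine continuous_generateFrom_iff.2 ?_
  rintro _ ⟨p, rfl⟩
  convert ZariskiSpace.isOpen_basicOpen (bind₁ (fun s : CoordIdx n =>
    frame (hgt s.1) (hI.card s.1) (hI.polyCoords s.1) s.2.1 s.2.2) p) using 1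
  ext y
  change eval (hI.paramFrame y).coord p ≠ 0 ↔ eval y (bind₁ _ p) ≠ 0
  have : (hI.paramFrame y).coord = fun s => eval y
      (frame (hgt s.1) (hI.card s.1) (hI.polyCoords s.1) s.2.1 s.2.2) :=
    funext (hI.paramFrame_coord y)
  rw [this]
  exact not_congr (by rw [eval_bind₁ (σ := CoordIdx n) (y : FreeIdx I → ℂ)])

theorem continuous_cellEquiv_symm_zariski :
    @Continuous (cell I) (ZariskiSpace (FreeIdx I))
      (@instTopologicalSpaceSubtype (GrProd n) (· ∈ cell I) (zariski n)) _ hI.cellEquiv.symm := by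
  let _ : TopologicalSpace (Frames n) := framesZariski n
  let _ : TopologicalSpace (GrProd n) := zariski n
  refine continuous_generateFrom_iff.2 ?_
  rintro _ ⟨g, rfl⟩
  obtain ⟨G, N, hG⟩ := hI.exists_eval_chart g
  let W : Set (GrProd n) := {V | V ∈ hI.chartDomain ∧ eval (hI.chart V) g ≠ 0}
  have hW : IsOpen W := by
    refine isOpen_coinduced.2 ?_
    have : Frames.span ⁻¹' W = {A : Frames n | eval A.coord (hI.denPoly * G) ≠ 0} := by
      ext A
      change A.span ∈ hI.chartDomain ∧ eval (hI.chart A.span) g ≠ 0 ↔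
        eval A.coord (hI.denPoly * G) ≠ 0
      rw [span_mem_chartDomain, map_mul, eval_denPoly, mul_ne_zero_iff]
      refine and_congr_right fun hA => ?_
      rw [hG A hA, mul_ne_zero_iff, and_iff_right (pow_ne_zero N hA)]
    rw [this]
    exact TopologicalSpace.isOpen_generateFrom_of_mem ⟨_, rfl⟩
  refine isOpen_induced_iff.2 ⟨W, hW, ?_⟩
  ext V
  exact and_iff_right (hI.cell_subset_chartDomain V.2)

theorem dim_cell {I : Fin n → Finset (Fin (2 * n))} (hI : IsIndex I) : dim (cell I) = Nat.card (FreeIdx I) := by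
  let _ : TopologicalSpace (GrProd n) := zariski n
  let e : ZariskiSpace (FreeIdx I) ≃ₜ cell I :=
    ⟨hI.cellEquiv, hI.continuous_cellEquiv_zariski, hI.continuous_cellEquiv_symm_zariski⟩
  rw [← ZariskiSpace.topologicalKrullDim_eq]
  exact (IsHomeomorph.topologicalKrullDim_eq e e.isHomeomorph).symm

end IsIndex

end SpFlag

/-! ### The cell decomposition -/

namespace SpFlag

open Echelon

variable {n : ℕ}

/-- The set of index collections, as a type. -/
abbrev IndexSet (n : ℕ) : Type := {I : Fin n → Finset (Fin (2 * n)) // IsIndex I}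

noncomputable instance : Fintype (IndexSet n) := Fintype.ofFinite _

/-- The total height of an index collection. -/
def totalHeight (I : Fin n → Finset (Fin (2 * n))) : ℕ := ∑ k, ∑ a ∈ I k, hgt k a

/-- For each component the leading positions are the unique highest set of columns with nonzero
minor (`sum_height_le`). -/
theorem totalHeight_le {I J : Fin n → Finset (Fin (2 * n))} (hI : IsIndex I) (hJ : IsIndex J)
    {V : GrProd n} (hV : V ∈ hI.chartDomain) (hVJ : V ∈ cell J) :
    totalHeight I ≤ totalHeight J ∧ (totalHeight I = totalHeight J → I = J) := by
  obtain ⟨A, rfl⟩ := span_surjective V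
  have hA := hI.den_ne_zero_iff.1 (hI.span_mem_chartDomain.1 hV)
  have key : ∀ k, ∑ a ∈ I k, hgt k a ≤ ∑ a ∈ J k, hgt k a ∧
      (∑ a ∈ I k, hgt k a = ∑ a ∈ J k, hgt k a → I k = J k) := fun k => by
    obtain ⟨x, hx⟩ := (mem_cell_iff.1 hVJ).2 k
    exact sum_height_le (hgt_injective k) (hI.card k) (hJ.card k) (A := toMat (A.1 k)) hx (hA k)
  refine ⟨Finset.sum_le_sum fun k _ => (key k).1, fun h => funext fun k => (key k).2 ?_⟩
  exact (Finset.sum_eq_sum_iff_of_le fun k _ => (key k).1).1 h k (Finset.mem_univ k)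

theorem eq_of_mem_cell {I J : Fin n → Finset (Fin (2 * n))} {V : GrProd n} (hI : V ∈ cell I)
    (hJ : V ∈ cell J) : I = J :=
  funext fun k => (lead_of_mem_cell hI k).symm.trans (lead_of_mem_cell hJ k)

theorem exists_mem_cell_indexSet {V : GrProd n} (hV : V ∈ SpF n) :
    ∃ I : IndexSet n, V ∈ cell I.1 :=
  ⟨⟨_, isIndex_lead hV⟩, exists_mem_cell hV⟩

theorem exists_monotone_equiv (n : ℕ) : ∃ (N : ℕ) (e : Fin N ≃ IndexSet n),
    Monotone fun i => totalHeight (e i).1 := by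
  let e₀ := (Fintype.equivFin (IndexSet n)).symm
  exact ⟨_, (Tuple.sort fun i => totalHeight (e₀ i).1).trans e₀,
    Tuple.monotone_sort fun i => totalHeight (e₀ i).1⟩

/-- The union of the first `i` cells. -/
def skeleton {N : ℕ} (e : Fin N ≃ IndexSet n) (i : ℕ) : Set (GrProd n) :=
  {V | ∃ j : Fin N, (j : ℕ) < i ∧ V ∈ cell (e j).1}

/-- A point of an early cell cannot lie in the chart of a later one: the total heights would be
equal, hence the indices too. A point outside all later charts is in no later cell. -/
theorem skeleton_eq {N : ℕ} {e : Fin N ≃ IndexSet n}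
    (he : Monotone fun i => totalHeight (e i).1) (i : ℕ) : skeleton e i =
      SpF n ∩ ⋂ j : {j : Fin N // i ≤ (j : ℕ)}, (e j.1).2.chartDomainᶜ := by
  ext V
  rw [Set.mem_inter_iff, Set.mem_iInter]
  constructor
  · rintro ⟨j, hj, hV⟩
    refine ⟨hV.1, fun j' h => ?_⟩
    obtain ⟨h1, h2⟩ := totalHeight_le (e j'.1).2 (e j).2 h hV
    have hjj : (j : ℕ) < j'.1 := hj.trans_le j'.2
    have h3 := h2 (h1.antisymm (he hjj.le))
    exact absurd (congrArg Fin.val (e.injective (Subtype.ext h3))) hjj.ne'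
  · rintro ⟨hV, h⟩
    obtain ⟨J, hJ⟩ := exists_mem_cell_indexSet hV
    obtain ⟨j, rfl⟩ := e.surjective J
    refine ⟨j, ?_, hJ⟩
    by_contra! hlt
    exact h ⟨j, hlt⟩ ((e j).2.cell_subset_chartDomain hJ)

theorem isCompact_skeleton {N : ℕ} {e : Fin N ≃ IndexSet n}
    (he : Monotone fun i => totalHeight (e i).1) (i : ℕ) : IsCompact (skeleton e i) := by
  rw [skeleton_eq he i]
  refine IsClosed.isCompact (isClosed_SpF.inter (isClosed_iInter ?_))
  intro j
  rw [isClosed_compl_iff]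
  exact IsIndex.isOpen_chartDomain _

theorem skeleton_diff {N : ℕ} (e : Fin N ≃ IndexSet n) (i : Fin N) :
    skeleton e (i + 1) \ skeleton e i = cell (e i).1 := by
  ext V
  constructor
  · rintro ⟨⟨j, hj, hV⟩, h⟩
    have : ¬ (j : ℕ) < i := fun hlt => h ⟨j, hlt, hV⟩
    have : j = i := Fin.ext (by omega)
    exact this ▸ hV
  · intro hV
    refine ⟨⟨i, Nat.lt_succ_self _, hV⟩, ?_⟩
    rintro ⟨j, hj, hVj⟩
    have := e.injective (Subtype.ext (eq_of_mem_cell hV hVj))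
    exact absurd (congrArg Fin.val this) hj.ne'

theorem skeleton_card {N : ℕ} (e : Fin N ≃ IndexSet n) : skeleton e N = SpF n := by
  ext V
  constructor
  · rintro ⟨j, -, hV⟩
    exact hV.1
  · intro hV
    obtain ⟨J, hJ⟩ := exists_mem_cell_indexSet hV
    exact ⟨e.symm J, (e.symm J).2, by rwa [e.apply_symm_apply]⟩

theorem nonempty_homeomorph_real (σ : Type) [Finite σ] :
    Nonempty ((σ → ℂ) ≃ₜ (Fin (2 * Nat.card σ) → ℝ)) := by
  have := Fintype.ofFinite σ
  refine ⟨(ContinuousLinearEquiv.ofFinrankEq (𝕜 := ℝ) ?_).toHomeomorph⟩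
  rw [Module.finrank_pi_fintype, Module.finrank_fin_fun]
  simp [Complex.finrank_real_complex, mul_comm]

/-- The cohomology of the symplectic degenerate flag variety. -/
theorem finrank_ratCoh_SpF (n p : ℕ) : Module.Finite ℚ (RatCoh.H (SpF n) p) ∧
    Module.finrank ℚ (RatCoh.H (SpF n) p) =
      Nat.card {I : IndexSet n // 2 * Nat.card (FreeIdx I.1) = p} := by
  obtain ⟨N, e, he⟩ := exists_monotone_equiv n
  let M := Fin n → Fin (2 * n) → Fin (2 * n) → ℂ
  let f : GrProd n → M := proj
  have hf : Topology.IsClosedEmbedding f := isClosedEmbedding_proj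
  let d : ℕ → ℕ := fun i => if h : i < N then Nat.card (FreeIdx (e ⟨i, h⟩).1) else 0
  have hd : ∀ i : Fin N, d i = Nat.card (FreeIdx (e i).1) := fun i => dif_pos i.2
  -- The filtration is moved into the metric space of matrices, and degree `p` is read off from
  -- lists of length `p + 1`.
  obtain ⟨h1, h2⟩ := ListCochain.finrank_H_filtration (A := fun i => f '' skeleton e i) N d
    (by
      rw [Set.image_eq_empty]
      exact Set.eq_empty_of_forall_notMem fun V hV => by
        obtain ⟨j, hj, -⟩ := hV
        exact Nat.not_lt_zero _ hj)
    (fun i _ => (isCompact_skeleton he i).image hf.continuous)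
    (fun i _ => Set.image_mono fun V hV => by
      obtain ⟨j, hj, hV⟩ := hV
      exact ⟨j, hj.trans (Nat.lt_succ_self i), hV⟩)
    (fun i hi => by
      obtain ⟨φ⟩ := nonempty_homeomorph_real (FreeIdx (e ⟨i, hi⟩).1)
      have hs : f '' skeleton e (i + 1) \ f '' skeleton e i = f '' cell (e ⟨i, hi⟩).1 := by
        rw [← Set.image_sdiff hf.injective, ← skeleton_diff e ⟨i, hi⟩]
      have hdi := hd ⟨i, hi⟩
      change d i = _ at hdi
      rw [hdi]
      exact ⟨(Homeomorph.setCongr hs).trans ((hf.isEmbedding.homeomorphImage _).symm.trans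
        ((e ⟨i, hi⟩).2.cellHomeomorph.symm.trans φ))⟩) (p + 1)
  obtain ⟨ψ⟩ := ListCochain.nonempty_equiv_ratCoh
    (hf.isEmbedding.comp (Topology.IsEmbedding.subtypeVal (p := (· ∈ SpF n)))) p
  have hr : Set.range (f ∘ (Subtype.val : SpF n → GrProd n)) = f '' skeleton e N := by
    rw [Set.range_comp, Subtype.range_val, skeleton_card]
  rw [← hr] at h1 h2
  refine ⟨Module.Finite.equiv ψ, ψ.finrank_eq.symm.trans (h2.trans ?_)⟩
  rw [← Nat.card_eq_finsetCard]
  refine Nat.card_congr ⟨fun i => ⟨e ⟨i, Finset.mem_range.1 (Finset.mem_filter.1 i.2).1⟩, ?_⟩,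
    fun I => ⟨e.symm I.1, ?_⟩, fun i => ?_, fun I => ?_⟩
  · have h3 := (Finset.mem_filter.1 i.2).2
    rw [← hd]
    exact (Nat.succ.inj h3).symm
  · rw [Finset.mem_filter, Finset.mem_range, hd, e.apply_symm_apply, I.2]
    exact ⟨(e.symm I.1).2, rfl⟩
  · simp
  · simp

end SpFlag

/-! ### Dellac configurations and index collections -/

namespace Dellac

/-- The description of a symmetric Dellac configuration by the function which gives the column of
the point in each row. -/
structure IsColumn {N : ℕ} (S : Finset (Box N)) (c : Fin (2 * N) → Fin N) : Prop where
  mem_iff : ∀ j r, (j, r) ∈ S ↔ c r = j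
  rev : ∀ r, c r.rev = (c r).rev
  le : ∀ r : Fin (2 * N), (c r : ℕ) ≤ r
  le_add : ∀ r : Fin (2 * N), (r : ℕ) ≤ N + c r
  card : ∀ j, (Finset.univ.filter fun r => c r = j).card = 2

theorem card_filter_fst {N : ℕ} (S : Finset (Box N)) (c : Fin (2 * N) → Fin N)
    (h : ∀ j r, (j, r) ∈ S ↔ c r = j) (j : Fin N) :
    (S.filter fun p => p.1 = j).card = (Finset.univ.filter fun r => c r = j).card := by
  refine Finset.card_nbij' Prod.snd (fun r => (j, r)) ?_ ?_ ?_ ?_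
  · rintro ⟨i, r⟩ hp
    obtain ⟨hp', rfl⟩ := Finset.mem_filter.1 (Finset.mem_coe.1 hp)
    exact Finset.mem_coe.2 (Finset.mem_filter.2 ⟨Finset.mem_univ _, (h _ _).1 hp'⟩)
  · intro r hr
    exact Finset.mem_coe.2 (Finset.mem_filter.2 ⟨(h _ _).2 (Finset.mem_filter.1 hr).2, rfl⟩)
  · rintro ⟨i, r⟩ hp
    obtain ⟨hp, rfl⟩ := Finset.mem_filter.1 hp
    rfl
  · intro r _
    rfl

theorem mem_SDC_iff {N : ℕ} {S : Finset (Box N)} : S ∈ SDC N ↔ ∃ c, IsColumn S c := by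
  classical
  rw [SDC, Finset.mem_filter, and_iff_right (Finset.mem_univ S)]
  constructor
  · rintro ⟨hD, hS⟩
    choose c hc hc' using hD.row
    have h : ∀ j r, (j, r) ∈ S ↔ c r = j := fun j r =>
      ⟨fun h => (hc' r j h).symm, fun h => h ▸ hc r⟩
    refine ⟨c, h, fun r => ?_, fun r => (hD.band _ (hc r)).1, fun r => (hD.band _ (hc r)).2,
      fun j => ?_⟩
    · exact (h _ _).1 ((hS (c r, r)).1 (hc r))
    · rw [← card_filter_fst S c h]
      exact hD.col j
  · rintro ⟨c, hc⟩
    refine ⟨⟨fun r => ⟨c r, (hc.mem_iff _ _).2 rfl, fun j hj => ((hc.mem_iff _ _).1 hj).symm⟩,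
      fun j => ?_, ?_⟩, ?_⟩
    · rw [card_filter_fst S c hc.mem_iff, hc.card]
    · rintro ⟨j, r⟩ hp
      obtain rfl := (hc.mem_iff _ _).1 hp
      exact ⟨hc.le r, hc.le_add r⟩
    · rintro ⟨j, r⟩
      rw [reflect, hc.mem_iff, hc.mem_iff, hc.rev, Fin.rev_inj]

end Dellac

/-! ### The bijection between index collections and configurations -/

namespace SpFlag

open Dellac

variable {n : ℕ}

theorem lt_hgt (k : Fin n) (l : Fin (2 * n)) : (k : ℕ) < hgt k l := by
  rw [hgt_eq]
  split_ifs <;> omega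

theorem hgt_le (k : Fin n) (l : Fin (2 * n)) : hgt k l ≤ 2 * n + k := by
  rw [hgt_eq]
  split_ifs <;> omega

theorem height_injective (k : Fin n) : Function.Injective (height k) := fun _ _ h =>
  hgt_injective k (congrArg Fin.val h)

theorem height_succ {k l : Fin n} (hkl : (k : ℕ) + 1 = l) {b : Fin (2 * n)} (hb : b ≠ idx l) :
    height l b = height k b :=
  Fin.ext (hgt_succ hkl hb)

theorem exists_height_eq (k : Fin n) (r : Fin (2 * (2 * n))) (h1 : (k : ℕ) < r)
    (h2 : (r : ℕ) ≤ 2 * n + k) : ∃ a, height k a = r := by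
  by_cases h : (r : ℕ) < 2 * n
  · refine ⟨⟨r, h⟩, Fin.ext ?_⟩
    change hgt k _ = _
    rw [hgt_eq]
    exact if_pos h1
  · refine ⟨⟨r - 2 * n, by omega⟩, Fin.ext ?_⟩
    change hgt k _ = _
    rw [hgt_eq, if_neg (by simp only; omega)]
    simp only
    omega

theorem height_rev {k : Fin n} (hk : (k : ℕ) + 1 = n) (a : Fin (2 * n)) :
    height k a.rev = (height k a).rev := by
  have := hgt_rev hk a
  refine Fin.ext ?_
  rw [Fin.val_rev]
  change hgt k _ = 2 * (2 * n) - (hgt k a + 1)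
  omega

/-- The rows whose points lie in the columns up to `k`. -/
def Front (I : Fin n → Finset (Fin (2 * n))) (k : Fin n) (r : Fin (2 * (2 * n))) : Prop :=
  (r : ℕ) ≤ k ∨ ∃ a ∈ I k, height k a = r

/-- The rows whose points lie in the column `k`. -/
def Entry (I : Fin n → Finset (Fin (2 * n))) (k : Fin n) (r : Fin (2 * (2 * n))) : Prop :=
  Front I k r ∧ ∀ j : Fin n, (j : ℕ) + 1 = k → ¬ Front I j r

variable {I : Fin n → Finset (Fin (2 * n))}

theorem front_height {k : Fin n} {a : Fin (2 * n)} : Front I k (height k a) ↔ a ∈ I k := by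
  constructor
  · rintro (h | ⟨b, hb, h⟩)
    · exact absurd h (lt_hgt k a).not_ge
    · exact height_injective k h ▸ hb
  · exact fun h => Or.inr ⟨a, h, rfl⟩

theorem Front.le_add {k : Fin n} {r : Fin (2 * (2 * n))} (h : Front I k r) :
    (r : ℕ) ≤ 2 * n + k := by
  rcases h with h | ⟨a, -, rfl⟩
  · omega
  · exact hgt_le k a

open Classical in
theorem card_front (I : Fin n → Finset (Fin (2 * n))) (k : Fin n) :
    (Finset.univ.filter fun r => Front I k r).card = (k + 1) + (I k).card := by
  have h1 : (Finset.univ.filter fun r => Front I k r) =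
      (Finset.univ.filter fun r : Fin (2 * (2 * n)) => (r : ℕ) ≤ k) ∪ (I k).image (height k) := by
    ext r
    rw [Finset.mem_union, Finset.mem_filter, Finset.mem_filter, Finset.mem_image, Front,
      and_iff_right (Finset.mem_univ r), and_iff_right (Finset.mem_univ r)]
  have h2 : (Finset.univ.filter fun r : Fin (2 * (2 * n)) => (r : ℕ) ≤ k) =
      Finset.Iic ⟨k, by omega⟩ := by
    ext r
    simp [Fin.le_def]
  rw [h1, Finset.card_union_of_disjoint, Finset.card_image_of_injective _ (height_injective k), h2,
    Fin.card_Iic]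
  rw [Finset.disjoint_left]
  intro r hr hr'
  obtain ⟨a, -, rfl⟩ := Finset.mem_image.1 hr'
  exact (lt_hgt k a).not_ge (Finset.mem_filter.1 hr).2

namespace IsIndex

variable (hI : IsIndex I)
include hI

/-- The only element that may leave is `idx l`, and its old row is row `l`, which joins the low rows
at step `l`. -/
theorem front_succ {k l : Fin n} (hkl : (k : ℕ) + 1 = l) {r : Fin (2 * (2 * n))}
    (h : Front I k r) : Front I l r := by
  rcases h with h | ⟨a, ha, rfl⟩
  · exact Or.inl (by omega)
  · by_cases hal : a = idx l
    · subst hal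
      refine Or.inl ?_
      change hgt k _ ≤ _
      rw [hgt_eq, if_pos (by simp only; omega)]
    · exact Or.inr ⟨a, (Finset.mem_insert.1 (hI.step k l hkl ha)).resolve_left hal,
        height_succ hkl hal⟩

theorem front_mono {k l : Fin n} (hkl : k ≤ l) {r : Fin (2 * (2 * n))} (h : Front I k r) :
    Front I l r := by
  obtain ⟨l, hl⟩ := l
  induction l with
  | zero => exact (le_antisymm hkl (Fin.le_def.2 (Nat.zero_le _))) ▸ h
  | succ l ih =>
    rcases hkl.eq_or_lt with rfl | hlt
    · exact h
    · exact hI.front_succ (k := ⟨l, by omega⟩) rfl (ih _ (Fin.le_def.2 (Nat.le_of_lt_succ hlt)))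

/-- For the last index the rows of the left half are exchanged with their complement by reflection:
the low rows with the top ones, the others by the Lagrangian condition. -/
theorem front_rev {k : Fin n} (hk : (k : ℕ) + 1 = n) (r : Fin (2 * (2 * n))) :
    Front I k r.rev ↔ ¬ Front I k r := by
  by_cases h1 : (r : ℕ) ≤ k
  · refine iff_of_false (fun h => ?_) (not_not.2 (Or.inl h1))
    have := h.le_add
    rw [Fin.val_rev] at this
    omega
  by_cases h2 : (r : ℕ) ≤ 2 * n + k
  · obtain ⟨a, rfl⟩ := exists_height_eq k r (by omega) h2
    rw [← height_rev hk, front_height, front_height, hI.rev_mem_iff hk]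
  · refine iff_of_true (Or.inl ?_) fun h => h2 h.le_add
    rw [Fin.val_rev]
    omega

theorem entry_unique {k l : Fin n} {r : Fin (2 * (2 * n))} (hk : Entry I k r)
    (hl : Entry I l r) : k = l := by
  rcases lt_trichotomy k l with h | h | h
  · exact absurd (hI.front_mono (l := ⟨l - 1, by omega⟩) (Fin.le_def.2 (by simp only; omega)) hk.1)
      (hl.2 _ (by simp only; omega))
  · exact h
  · exact absurd (hI.front_mono (l := ⟨k - 1, by omega⟩) (Fin.le_def.2 (by simp only; omega)) hl.1)
      (hk.2 _ (by simp only; omega))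

theorem not_entry_rev {k l : Fin n} {r : Fin (2 * (2 * n))} (hk : Entry I k r) :
    ¬ Entry I l r.rev := by
  intro hl
  have hn : n - 1 < n := by
    have := k.2
    omega
  have hle : ∀ k : Fin n, k ≤ ⟨n - 1, hn⟩ := fun k => Fin.le_def.2 (by simp only; omega)
  exact (hI.front_rev (k := ⟨n - 1, hn⟩) (by simp only; omega) r).1
    (hI.front_mono (hle l) hl.1) (hI.front_mono (hle k) hk.1)

omit hI in
theorem _root_.SpFlag.Front.exists_entry {k : Fin n} {r : Fin (2 * (2 * n))} (h : Front I k r) :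
    ∃ j ≤ k, Entry I j r := by
  obtain ⟨k, hk⟩ := k
  induction k with
  | zero => exact ⟨_, le_rfl, h, fun j hj => absurd hj (Nat.succ_ne_zero _)⟩
  | succ k ih =>
    by_cases h' : Front I ⟨k, by omega⟩ r
    · obtain ⟨j, hj, hj'⟩ := ih _ h'
      exact ⟨j, hj.trans (Fin.le_def.2 (Nat.le_succ k)), hj'⟩
    · refine ⟨_, le_rfl, h, fun j hj => ?_⟩
      have : j = ⟨k, by omega⟩ := Fin.ext (Nat.succ.inj hj)
      rwa [this]

theorem exists_entry (r : Fin (2 * (2 * n))) : ∃ k, Entry I k r ∨ Entry I k r.rev := by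
  have hn : n - 1 < n := by
    have := r.2
    omega
  have hk : (⟨n - 1, hn⟩ : Fin n).val + 1 = n := by simp only; omega
  by_cases h : Front I ⟨n - 1, hn⟩ r
  · obtain ⟨k, -, hk⟩ := h.exists_entry
    exact ⟨k, Or.inl hk⟩
  · obtain ⟨k, -, hk⟩ := ((hI.front_rev hk r).2 h).exists_entry
    exact ⟨k, Or.inr hk⟩

omit hI in
theorem _root_.SpFlag.exists_initiating {j : Fin n} {a : Fin (2 * n)} (h : a ∈ I j) :
    ∃ i ≤ j, Initiating I i a := by
  obtain ⟨j, hj⟩ := j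
  induction j with
  | zero => exact ⟨_, le_rfl, h, Or.inr fun i hi => absurd hi (Nat.succ_ne_zero _)⟩
  | succ j ih =>
    by_cases h' : a ∈ I ⟨j, by omega⟩
    · obtain ⟨i, hi, hi'⟩ := ih _ h'
      exact ⟨i, hi.trans (Fin.le_def.2 (Nat.le_succ j)), hi'⟩
    · refine ⟨_, le_rfl, h, Or.inr fun i hi => ?_⟩
      have : i = ⟨j, by omega⟩ := Fin.ext (Nat.succ.inj hi)
      rwa [this]

/-- Entries above row `k` are the initiating disks. The element `idx k` always initiates, since its
height jumps from `k` to `2 * n + k`. The only other possible entry is row `k`, which enters unless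
an earlier disk occupies it. -/
theorem mem_left_iff {p : Box (2 * n)} : p ∈ initiatingBoxes I ∪ diagonalBoxes I ↔
    ∃ k, p.1 = idx k ∧ Entry I k p.2 := by
  obtain ⟨j, r⟩ := p
  rw [Finset.mem_union, initiatingBoxes, diagonalBoxes, Finset.mem_filter, Finset.mem_filter,
    and_iff_right (Finset.mem_univ _), and_iff_right (Finset.mem_univ _)]
  constructor
  · rintro (⟨k, l, hkl, hp⟩ | ⟨hj, hr, hq⟩)
    · obtain ⟨rfl, rfl⟩ := Prod.mk.inj hp
      refine ⟨k, rfl, front_height.2 hkl.1, ?_⟩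
      rintro j hj (h | ⟨a, ha, h⟩)
      · have := lt_hgt k l
        rw [hgt] at this
        simp only at h
        omega
      · by_cases hl : l = idx k
        · subst hl
          have h1 := hgt_le j a
          have h2 : hgt j a = hgt k (idx k) := congrArg Fin.val h
          rw [hgt_eq k, if_neg (lt_irrefl _)] at h2
          simp only at h2
          omega
        · rw [height_succ hj hl] at h
          have hal := height_injective j h
          subst hal
          exact (hkl.2.resolve_left fun h => hl (Fin.ext h)) j hj ha
    · refine ⟨⟨j, hj⟩, rfl, Or.inl hr.le, ?_⟩
      rintro i hi (h | ⟨a, ha, h⟩)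
      · simp only at h hr hi
        omega
      · have h2 : hgt i a = r := congrArg Fin.val h
        obtain ⟨i', hi', hin⟩ := exists_initiating ha
        refine hq (idx i', height i' a) (Finset.mem_filter.2 ⟨Finset.mem_univ _, i', a, hin, rfl⟩) ?_
        refine Fin.ext ?_
        change hgt i' a = r
        rw [Fin.le_def] at hi'
        rw [hgt_eq] at h2 ⊢
        simp only at hr hi
        split_ifs at h2 ⊢ <;> omega
  · rintro ⟨k, hj, h, h'⟩
    simp only at hj h h'
    subst hj
    by_cases hr : (r : ℕ) ≤ k
    · right
      have hrk : (r : ℕ) = k := by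
        by_contra hne
        exact h' ⟨k - 1, by omega⟩ (by simp only; omega) (Or.inl (by simp only; omega))
      refine ⟨k.2, hrk, ?_⟩
      intro q hq hqr
      obtain ⟨-, i, l, hil, rfl⟩ := Finset.mem_filter.1 hq
      simp only at hqr
      have hi := lt_hgt i l
      rw [hgt, hqr] at hi
      refine h' ⟨k - 1, by omega⟩ (by simp only; omega)
        (hI.front_mono (k := i) (Fin.le_def.2 (by simp only; omega)) ?_)
      exact hqr ▸ front_height.2 hil.1
    · left
      obtain ⟨a, ha, rfl⟩ := h.resolve_left hr
      refine ⟨k, a, ⟨ha, ?_⟩, rfl⟩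
      rw [or_iff_not_imp_left]
      intro hak j hj haj
      refine h' j hj ?_
      rw [height_succ hj fun h => hak (congrArg Fin.val h)]
      exact front_height.2 haj

theorem mem_config_iff {p : Box (2 * n)} : p ∈ config I ↔
    ∃ k, (p.1 = idx k ∧ Entry I k p.2) ∨ (p.1 = (idx k).rev ∧ Entry I k p.2.rev) := by
  rw [config, Finset.mem_union, Finset.mem_image, hI.mem_left_iff, exists_or]
  refine or_congr Iff.rfl ⟨?_, ?_⟩
  · rintro ⟨q, hq, rfl⟩
    obtain ⟨k, h1, h2⟩ := hI.mem_left_iff.1 hq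
    exact ⟨k, by rw [reflect, h1], by rwa [reflect, Fin.rev_rev]⟩
  · rintro ⟨k, h1, h2⟩
    refine ⟨reflect p, hI.mem_left_iff.2 ⟨k, ?_, h2⟩, ?_⟩
    · rw [reflect, h1, Fin.rev_rev]
    · rw [reflect, reflect, Fin.rev_rev, Fin.rev_rev]

-- Consecutive fronts have `2 * k` and `2 * (k + 1)` rows.
open Classical in
theorem card_entry (k : Fin n) : (Finset.univ.filter fun r => Entry I k r).card = 2 := by
  have hk := card_front I k
  rw [hI.card] at hk
  by_cases h0 : (k : ℕ) = 0
  · rw [h0] at hk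
    refine Eq.trans ?_ hk
    refine congrArg _ (Finset.filter_congr fun r _ => ?_)
    exact and_iff_left fun j hj => by omega
  · set j : Fin n := ⟨k - 1, by omega⟩ with hj
    have hjk : (j : ℕ) + 1 = k := by rw [hj]; simp only; omega
    have hj' := card_front I j
    rw [hI.card] at hj'
    have : (Finset.univ.filter fun r => Entry I k r) =
        (Finset.univ.filter fun r => Front I k r) \ Finset.univ.filter fun r => Front I j r := by
      ext r
      simp only [Finset.mem_filter, Finset.mem_univ, true_and, Finset.mem_sdiff]
      refine and_congr_right fun _ => ⟨fun h => h j hjk, fun h i hi => ?_⟩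
      rwa [show i = j from Fin.ext (by omega)]
    rw [this, Finset.card_sdiff_of_subset]
    · omega
    · intro r hr
      rw [Finset.mem_filter] at hr ⊢
      exact ⟨hr.1, hI.front_succ hjk hr.2⟩

end IsIndex

/-- The compatibility of an index collection with the column function of a configuration. -/
def Fits (I : Fin n → Finset (Fin (2 * n))) (c : Fin (2 * (2 * n)) → Fin (2 * n)) : Prop :=
  ∀ (k : Fin n) (r : Fin (2 * (2 * n))), (c r : ℕ) ≤ k ↔ Front I k r

theorem IsIndex.exists_isColumn (hI : IsIndex I) : ∃ c, IsColumn (config I) c ∧ Fits I c := by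
  have hex : ∀ r, ∃ j, (j, r) ∈ config I ∧ ∀ i, (i, r) ∈ config I → j = i := by
    intro r
    obtain ⟨k, hk | hk⟩ := hI.exists_entry r
    · refine ⟨idx k, hI.mem_config_iff.2 ⟨k, Or.inl ⟨rfl, hk⟩⟩, fun i hi => ?_⟩
      obtain ⟨l, ⟨h, hl⟩ | ⟨-, hl⟩⟩ := hI.mem_config_iff.1 hi
      · rw [hI.entry_unique hk hl]
        exact h.symm
      · exact absurd hl (hI.not_entry_rev hk)
    · refine ⟨(idx k).rev, hI.mem_config_iff.2 ⟨k, Or.inr ⟨rfl, hk⟩⟩, fun i hi => ?_⟩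
      obtain ⟨l, ⟨-, hl⟩ | ⟨h, hl⟩⟩ := hI.mem_config_iff.1 hi
      · exact absurd hk (hI.not_entry_rev hl)
      · rw [hI.entry_unique hk hl]
        exact h.symm
  choose c hc hc' using hex
  have hmem : ∀ j r, (j, r) ∈ config I ↔ c r = j := fun j r => ⟨hc' r j, fun h => h ▸ hc r⟩
  have hrev : ∀ r, c r.rev = (c r).rev := by
    intro r
    refine (hmem _ _).1 (hI.mem_config_iff.2 ?_)
    obtain ⟨k, ⟨h1, h2⟩ | ⟨h1, h2⟩⟩ := hI.mem_config_iff.1 (hc r)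
    · exact ⟨k, Or.inr ⟨congrArg Fin.rev h1, by rwa [Fin.rev_rev]⟩⟩
    · exact ⟨k, Or.inl ⟨(congrArg Fin.rev h1).trans (Fin.rev_rev _), h2⟩⟩
  have hent : ∀ k r, c r = idx k ↔ Entry I k r := by
    intro k r
    rw [← hmem, hI.mem_config_iff]
    constructor
    · rintro ⟨l, ⟨h1, h2⟩ | ⟨h1, -⟩⟩
      · rwa [show k = l from Fin.ext (congrArg Fin.val h1 :)]
      · have := congrArg Fin.val h1
        rw [Fin.val_rev] at this
        simp only at this
        omega
    · exact fun h => ⟨k, Or.inl ⟨rfl, h⟩⟩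
  have hband : ∀ (k : Fin n) (r : Fin (2 * (2 * n))), Entry I k r → (k : ℕ) ≤ r ∧ (r : ℕ) ≤ 2 * n + k := by
    refine fun k r h => ⟨?_, h.1.le_add⟩
    by_contra! hlt
    exact h.2 ⟨k - 1, by omega⟩ (by simp only; omega) (Or.inl (by simp only; omega))
  have hside : ∀ r, (∃ k, c r = idx k ∧ Entry I k r) ∨
      ∃ k, c r = (idx k).rev ∧ Entry I k r.rev := fun r =>
    exists_or.1 (hI.mem_config_iff.1 (hc r))
  have hcol : ∀ k, (Finset.univ.filter fun r => c r = idx k).card = 2 := by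
    classical
    intro k
    refine Eq.trans ?_ (hI.card_entry k)
    exact congrArg _ (Finset.filter_congr fun r _ => hent k r)
  refine ⟨c, ⟨hmem, hrev, fun r => ?_, fun r => ?_, fun j => ?_⟩, fun k r => ⟨fun h => ?_,
    fun h => ?_⟩⟩
  · obtain ⟨k, h1, h2⟩ | ⟨k, h1, h2⟩ := hside r
    · rw [h1]
      exact (hband k r h2).1
    · have := (hband k _ h2).2
      rw [h1]
      rw [Fin.val_rev] at this ⊢
      simp only
      omega
  · obtain ⟨k, h1, h2⟩ | ⟨k, h1, h2⟩ := hside r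
    · rw [h1]
      exact (hband k r h2).2
    · have := (hband k _ h2).1
      rw [h1]
      rw [Fin.val_rev] at this ⊢
      simp only
      omega
  · by_cases hj : (j : ℕ) < n
    · exact hcol ⟨j, hj⟩
    · refine Eq.trans ?_ (hcol ⟨j.rev, by rw [Fin.val_rev]; omega⟩)
      refine Finset.card_nbij' Fin.rev Fin.rev ?_ ?_ ?_ ?_
      · intro r hr
        refine Finset.mem_coe.2 (Finset.mem_filter.2 ⟨Finset.mem_univ _, ?_⟩)
        rw [hrev, (Finset.mem_filter.1 hr).2]
      · intro r hr
        refine Finset.mem_coe.2 (Finset.mem_filter.2 ⟨Finset.mem_univ _, ?_⟩)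
        rw [hrev, (Finset.mem_filter.1 hr).2]
        exact Fin.rev_rev j
      · exact fun _ _ => Fin.rev_rev _
      · exact fun _ _ => Fin.rev_rev _
  · obtain ⟨l, h1, h2⟩ | ⟨l, h1, h2⟩ := hside r
    · rw [h1] at h
      exact hI.front_mono (Fin.le_def.2 h) h2.1
    · have h3 := Fin.val_rev (idx l)
      rw [h1] at h
      simp only at h3
      omega
  · obtain ⟨j, hj, hj'⟩ := h.exists_entry
    rw [(hent j r).2 hj']
    exact hj

/-- Columns up to `k` contain `2 * (k + 1)` points; by the band condition they include all rows `≤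
k`, so `k + 1` points remain, and their rows are heights for `k`. Symmetry of `c` gives the
Lagrangian condition. -/
theorem exists_fits {S : Finset (Box (2 * n))} {c : Fin (2 * (2 * n)) → Fin (2 * n)}
    (hc : IsColumn S c) : ∃ I, IsIndex I ∧ Fits I c := by
  classical
  let I : Fin n → Finset (Fin (2 * n)) := fun k =>
    Finset.univ.filter fun l => (c (height k l) : ℕ) ≤ k
  have hmem : ∀ (k : Fin n) l, l ∈ I k ↔ (c (height k l) : ℕ) ≤ k := fun k l => by simp [I]
  have hfit : Fits I c := by
    refine fun k r => ⟨fun h => ?_, ?_⟩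
    · rw [Front, or_iff_not_imp_left]
      intro hr
      have := hc.le_add r
      obtain ⟨a, rfl⟩ := exists_height_eq k r (by omega) (by omega)
      exact ⟨a, (hmem k a).2 h, rfl⟩
    · rintro (h | ⟨a, ha, rfl⟩)
      · exact (hc.le r).trans h
      · exact (hmem k a).1 ha
  refine ⟨I, ⟨fun k => ?_, fun k l hkl a ha => ?_, fun k hk a ha ha' => ?_⟩, hfit⟩
  · have h1 := card_front I k
    have h2 : (Finset.univ.filter fun r => Front I k r) =
        Finset.univ.filter fun r => c r ∈ Finset.Iic (idx k) := by
      refine Finset.filter_congr fun r _ => ?_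
      rw [← hfit k r, Finset.mem_Iic, Fin.le_def]
    have h3 := Finset.card_eq_sum_card_fiberwise (f := c)
      (s := Finset.univ.filter fun r => c r ∈ Finset.Iic (idx k)) (t := Finset.Iic (idx k))
      (fun r hr => (Finset.mem_filter.1 hr).2)
    rw [Finset.sum_congr rfl (g := fun _ => 2), Finset.sum_const, Fin.card_Iic, smul_eq_mul] at h3
    · rw [h2, h3] at h1
      simp only at h1
      omega
    · intro j hj
      rw [Finset.filter_filter]
      refine Eq.trans ?_ (hc.card j)
      refine congrArg _ (Finset.filter_congr fun r _ => ⟨And.right, fun h => ⟨h ▸ hj, h⟩⟩)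
  · rw [Finset.mem_insert, or_iff_not_imp_left]
    intro hal
    rw [hmem] at ha ⊢
    rw [height_succ hkl hal]
    omega
  · rw [hmem] at ha ha'
    rw [height_rev hk, hc.rev, Fin.val_rev] at ha'
    omega

theorem Fits.index_eq {I I' : Fin n → Finset (Fin (2 * n))}
    {c : Fin (2 * (2 * n)) → Fin (2 * n)} (h : Fits I c) (h' : Fits I' c) : I = I' := by
  funext k
  ext a
  rw [← front_height, ← h, h', front_height]

/-- The fronts determine `c` on rows with points in the left half, and reflection does the rest. -/
theorem Fits.column_eq {S S' : Finset (Box (2 * n))} {c c' : Fin (2 * (2 * n)) → Fin (2 * n)}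
    (h : Fits I c) (h' : Fits I c') (hc : IsColumn S c) (hc' : IsColumn S' c') : c = c' := by
  have key : ∀ {c c' : Fin (2 * (2 * n)) → Fin (2 * n)}, Fits I c → Fits I c' →
      ∀ r : Fin (2 * (2 * n)), (c r : ℕ) < n → (c' r : ℕ) ≤ c r := fun h h' r hr =>
    (h' ⟨_, hr⟩ r).2 ((h ⟨_, hr⟩ r).1 le_rfl)
  have key' : ∀ r : Fin (2 * (2 * n)), (c r : ℕ) < n → c r = c' r := fun r hr => by
    have h1 := key h h' r hr
    exact Fin.ext (le_antisymm (key h' h r (by omega)) h1)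
  refine funext fun r => ?_
  by_cases hr : (c r : ℕ) < n
  · exact key' r hr
  · have := key' r.rev (by rw [hc.rev, Fin.val_rev]; omega)
    rwa [hc.rev, hc'.rev, Fin.rev_inj] at this

theorem _root_.Dellac.IsColumn.eq {N : ℕ} {S S' : Finset (Box N)} {c : Fin (2 * N) → Fin N}
    (h : IsColumn S c) (h' : IsColumn S' c) : S = S' := by
  ext ⟨j, r⟩
  rw [h.mem_iff, h'.mem_iff]

theorem _root_.Dellac.IsColumn.column_eq {N : ℕ} {S : Finset (Box N)}
    {c c' : Fin (2 * N) → Fin N} (h : IsColumn S c) (h' : IsColumn S c') : c = c' :=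
  funext fun _ => (h.mem_iff _ _).1 ((h'.mem_iff _ _).2 rfl)

theorem IsIndex.config_mem_SDC (hI : IsIndex I) : config I ∈ SDC (2 * n) := by
  obtain ⟨c, hc, -⟩ := hI.exists_isColumn
  exact mem_SDC_iff.2 ⟨c, hc⟩

theorem bijective_config :
    Function.Bijective fun I : IndexSet n => (⟨config I.1, I.2.config_mem_SDC⟩ : SDC (2 * n)) := by
  constructor
  · rintro ⟨I, hI⟩ ⟨I', hI'⟩ h
    obtain ⟨c, hc, hf⟩ := hI.exists_isColumn
    obtain ⟨c', hc', hf'⟩ := hI'.exists_isColumn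
    have h : config I = config I' := congrArg Subtype.val h
    rw [← h] at hc'
    rw [hc'.column_eq hc] at hf'
    exact Subtype.ext (hf.index_eq hf')
  · rintro ⟨S, hS⟩
    obtain ⟨c, hc⟩ := mem_SDC_iff.1 hS
    obtain ⟨I, hI, hf⟩ := exists_fits hc
    obtain ⟨c', hc', hf'⟩ := hI.exists_isColumn
    rw [hf'.column_eq hf hc' hc] at hc'
    exact ⟨⟨I, hI⟩, Subtype.ext (hc'.eq hc)⟩

end SpFlag

/-! ### Inversions and free coordinates -/

namespace Dellac

variable {N : ℕ} {S : Finset (Box N)}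

theorem symmetric_iff {x y : Inversion S} :
    Symmetric S x y ↔ y.1 = (reflect x.1.2, reflect x.1.1) := by
  rw [Symmetric, Set.pair_eq_pair_iff]
  constructor
  · rintro (⟨h1, h2⟩ | ⟨h1, h2⟩)
    · have h3 := y.2.2.2.1
      rw [← h1, ← h2] at h3
      exact absurd (Fin.rev_lt_rev.1 h3) x.2.2.2.1.not_gt
    · rw [h1, h2]
  · intro h
    rw [h]
    exact Or.inr ⟨rfl, rfl⟩

theorem reflect_reflect (p : Box N) : reflect (reflect p) = p := by
  rw [reflect, reflect, Fin.rev_rev, Fin.rev_rev]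

theorem Symmetric.symm {x y : Inversion S} (h : Symmetric S x y) : Symmetric S y x := by
  rw [symmetric_iff] at h ⊢
  rw [h, reflect_reflect, reflect_reflect]

theorem Symmetric.eq_of_symmetric {x y z : Inversion S} (h : Symmetric S x y)
    (h' : Symmetric S y z) : x = z := by
  rw [symmetric_iff] at h h'
  refine Subtype.ext ?_
  rw [h', h, reflect_reflect, reflect_reflect]

/-- `Symmetric` is the graph of an involution, so the equivalence relation it generates has classes
of at most two elements. -/
theorem eq_or_symmetric_of_eqvGen {x y : Inversion S} (h : Relation.EqvGen (Symmetric S) x y) :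
    x = y ∨ Symmetric S x y := by
  induction h with
  | rel x y h => exact Or.inr h
  | refl x => exact Or.inl rfl
  | symm x y _ ih => exact ih.imp Eq.symm Symmetric.symm
  | trans x y z _ _ ih ih' =>
    rcases ih with rfl | h1
    · exact ih'
    · rcases ih' with rfl | h2
      · exact Or.inr h1
      · exact Or.inl (h1.eq_of_symmetric h2)

theorem mk_eq_mk_iff {x y : Inversion S} :
    Quot.mk (Symmetric S) x = Quot.mk (Symmetric S) y ↔ x = y ∨ Symmetric S x y := by
  constructor
  · exact fun h => eq_or_symmetric_of_eqvGen (Quot.eqvGen_exact h)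
  · rintro (rfl | h)
    · rfl
    · exact Quot.sound h

theorem IsColumn.exists_symmetric {c : Fin (2 * N) → Fin N} (hc : IsColumn S c)
    (x : Inversion S) : ∃ y : Inversion S, Symmetric S y x ∧
      y.1 = (reflect x.1.2, reflect x.1.1) := by
  have hmem : ∀ p, p ∈ S → reflect p ∈ S := by
    rintro ⟨j, r⟩ hp
    rw [reflect, hc.mem_iff, hc.rev, (hc.mem_iff _ _).1 hp]
  have h : Symmetric S x ⟨(reflect x.1.2, reflect x.1.1), hmem _ x.2.2.1, hmem _ x.2.1,
    Fin.rev_lt_rev.2 x.2.2.2.1, Fin.rev_lt_rev.2 x.2.2.2.2⟩ := symmetric_iff.2 rfl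
  exact ⟨_, h.symm, rfl⟩

end Dellac

namespace SpFlag

open Dellac

variable {n : ℕ} {I : Fin n → Finset (Fin (2 * n))} {S : Finset (Box (2 * n))}
  {c : Fin (2 * (2 * n)) → Fin (2 * n)}

theorem Fits.col_left_le (hf : Fits I c) (s : FreeIdx I) :
    (c (height s.1.1 s.1.2.1) : ℕ) ≤ s.1.1 :=
  (hf _ _).2 (front_height.2 s.2.1)

theorem Fits.lt_col_right (hf : Fits I c) (s : FreeIdx I) :
    (s.1.1 : ℕ) < c (height s.1.1 s.1.2.2) := by
  rw [← not_le, hf, front_height]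
  exact s.2.2.1

theorem Fits.col_right_le (hf : Fits I c) (s : FreeIdx I) {l : Fin n}
    (hl : (s.1.1 : ℕ) + 1 = l) : (c (height s.1.1 s.1.2.2) : ℕ) ≤ l := by
  rw [hf]
  obtain ⟨⟨k, a, b⟩, hs⟩ := s
  simp only at hl ⊢
  by_cases hb : b = idx l
  · subst hb
    refine Or.inl ?_
    change hgt k _ ≤ _
    rw [hgt_eq, if_pos (by simp only; omega)]
  · rw [← height_succ hl hb]
    exact front_height.2 ((hs.2.2.2.2 l hl).resolve_right hb)

/-- The inversion of a free coordinate. -/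
def toInversion (hc : IsColumn S c) (hf : Fits I c) (s : FreeIdx I) : Inversion S :=
  ⟨((c (height s.1.1 s.1.2.1), height s.1.1 s.1.2.1),
    (c (height s.1.1 s.1.2.2), height s.1.1 s.1.2.2)),
    (hc.mem_iff _ _).2 rfl, (hc.mem_iff _ _).2 rfl,
    Fin.lt_def.2 ((hf.col_left_le s).trans_lt (hf.lt_col_right s)), s.2.2.2.1⟩

/-- The band condition puts both rows strictly above `k` and at most at `2 * n + k`, so they are
heights for `k`; `Fits` translates the column bounds into the conditions of `Free`. -/
theorem exists_toInversion_eq (hc : IsColumn S c) (hf : Fits I c) (x : Inversion S) (k : Fin n)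
    (h1 : (x.1.1.1 : ℕ) ≤ k) (h2 : (k : ℕ) < x.1.2.1)
    (h3 : (k : ℕ) + 1 = n → ∀ a b, height k a = x.1.1.2 → height k b = x.1.2.2 → b.rev ≤ a)
    (h4 : ∀ l : Fin n, (k : ℕ) + 1 = l → (x.1.2.1 : ℕ) ≤ l) :
    ∃ s, toInversion hc hf s = x := by
  obtain ⟨⟨⟨j, r⟩, ⟨j', r'⟩⟩, hx1, hx2, hx3, hx4⟩ := x
  simp only at h1 h2 h3 h4 hx3 hx4
  obtain rfl := (hc.mem_iff _ _).1 hx1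
  obtain rfl := (hc.mem_iff _ _).1 hx2
  have h5 := hc.le r'
  have h6 := hc.le_add r
  rw [Fin.lt_def] at hx4
  obtain ⟨a, rfl⟩ := exists_height_eq k r (by omega) (by omega)
  obtain ⟨b, rfl⟩ := exists_height_eq k r' (by omega) (by omega)
  refine ⟨⟨(k, a, b), front_height.1 ((hf _ _).1 h1), ?_, hx4, fun hk => h3 hk a b rfl rfl, ?_⟩,
    rfl⟩
  · rw [← front_height, ← hf]
    exact h2.not_ge
  · intro l hl
    rw [or_iff_not_imp_right]
    intro hb
    rw [← front_height, height_succ hl hb, ← hf]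
    exact h4 l hl

/-- The right point has a column greater than `k`, and at most `k + 1` unless `k` is last, so its
row determines `k`. -/
theorem Fits.le_of_height_eq (hf : Fits I c) {s s' : FreeIdx I}
    (h : height s.1.1 s.1.2.2 = height s'.1.1 s'.1.2.2) : s'.1.1 ≤ s.1.1 := by
  by_contra! hlt
  rw [Fin.lt_def] at hlt
  have h1 := hf.col_right_le s (l := ⟨s.1.1 + 1, by omega⟩) rfl
  have h2 := hf.lt_col_right s'
  rw [← h] at h2
  simp only at h1
  omega

/-- The free coordinates of a cell correspond to the classes of inversions. -/
theorem invTilde_eq (hc : IsColumn S c) (hf : Fits I c) : invTilde S = Nat.card (FreeIdx I) := by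
  refine (Nat.card_eq_of_bijective
    (fun s => Quot.mk (Symmetric S) (toInversion hc hf s)) ⟨fun s s' h => ?_, fun q => ?_⟩).symm
  · rcases mk_eq_mk_iff.1 h with h | h
    · have ha := congrArg (fun x => x.1.1.2) h
      have hb := congrArg (fun x => x.1.2.2) h
      simp only [toInversion] at ha hb
      have hk := le_antisymm (hf.le_of_height_eq hb.symm)
        (hf.le_of_height_eq hb)
      obtain ⟨⟨k, a, b⟩, hs⟩ := s
      obtain ⟨⟨k', a', b'⟩, hs'⟩ := s'
      simp only at hk ha hb
      subst hk
      obtain rfl := height_injective _ ha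
      obtain rfl := height_injective _ hb
      rfl
    · rw [symmetric_iff] at h
      have ha : height s'.1.1 s'.1.2.1 = (height s.1.1 s.1.2.2).rev :=
        congrArg (fun x => x.1.2) h
      have hb : height s'.1.1 s'.1.2.2 = (height s.1.1 s.1.2.1).rev :=
        congrArg (fun x => x.2.2) h
      have hlast : ∀ t : FreeIdx I, n ≤ (c (height t.1.1 t.1.2.2) : ℕ) → (t.1.1 : ℕ) + 1 = n := by
        intro t ht
        by_contra hne
        have := hf.col_right_le t (l := ⟨t.1.1 + 1, by omega⟩) rfl
        simp only at this
        omega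
      have hk' : (s'.1.1 : ℕ) + 1 = n := by
        refine hlast s' ?_
        have := hf.col_left_le s
        rw [hb, hc.rev, Fin.val_rev]
        omega
      have hk : (s.1.1 : ℕ) + 1 = n := by
        refine hlast s ?_
        have := hf.col_left_le s'
        rw [ha, hc.rev, Fin.val_rev] at this
        omega
      obtain ⟨⟨k, a, b⟩, hs⟩ := s
      obtain ⟨⟨k', a', b'⟩, hs'⟩ := s'
      simp only at hk hk' ha hb
      obtain rfl : k = k' := Fin.ext (by omega)
      rw [← height_rev hk] at ha hb
      obtain rfl := height_injective _ ha
      obtain rfl := height_injective _ hb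
      have h1 := hs.2.2.2.1 hk
      have h2 := hs'.2.2.2.1 hk
      simp only [Fin.rev_rev] at h1 h2
      obtain rfl := le_antisymm h1 h2
      simp only [Fin.rev_rev]
  · obtain ⟨x⟩ := q
    obtain ⟨y, hyx, hy⟩ := hc.exists_symmetric x
    have hx := x.2.2.2.1
    rw [Fin.lt_def] at hx
    have hy1 : (y.1.1.1 : ℕ) = 2 * n - (x.1.2.1 + 1) := by
      rw [hy]
      exact Fin.val_rev _
    have hy2 : (y.1.2.1 : ℕ) = 2 * n - (x.1.1.1 + 1) := by
      rw [hy]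
      exact Fin.val_rev _
    -- An inversion inside the left half has `k` one less than its right column; one inside the
    -- right half is reflected first. One that crosses the middle takes the last `k`, after
    -- reflection if `b.rev ≤ a` fails.
    by_cases h1 : (x.1.2.1 : ℕ) < n
    · obtain ⟨s, hs⟩ := exists_toInversion_eq hc hf x ⟨x.1.2.1 - 1, by omega⟩
        (by simp only; omega) (by simp only; omega) (fun h => by simp only at h; omega)
        (fun l hl => by simp only at hl; omega)
      exact ⟨s, congrArg _ hs⟩
    by_cases h2 : n ≤ (x.1.1.1 : ℕ)
    · obtain ⟨s, hs⟩ := exists_toInversion_eq hc hf y ⟨y.1.2.1 - 1, by omega⟩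
        (by simp only; omega) (by simp only; omega) (fun h => by simp only at h; omega)
        (fun l hl => by simp only at hl; omega)
      exact ⟨s, (congrArg _ hs).trans (Quot.sound hyx)⟩
    · have hn : n - 1 < n := by omega
      have hk : ((⟨n - 1, hn⟩ : Fin n) : ℕ) + 1 = n := by simp only; omega
      by_cases h3 : ∀ a b, height ⟨n - 1, hn⟩ a = x.1.1.2 → height ⟨n - 1, hn⟩ b = x.1.2.2 →
          b.rev ≤ a
      · obtain ⟨s, hs⟩ := exists_toInversion_eq hc hf x ⟨n - 1, hn⟩
          (by simp only; omega) (by simp only; omega) (fun _ => h3)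
          (fun l hl => by simp only at hl; omega)
        exact ⟨s, congrArg _ hs⟩
      · push Not at h3
        obtain ⟨a, b, ha, hb, hab⟩ := h3
        obtain ⟨s, hs⟩ := exists_toInversion_eq hc hf y ⟨n - 1, hn⟩
          (by simp only; omega) (by simp only; omega) (fun _ a' b' ha' hb' => by
            have ha' : height ⟨n - 1, hn⟩ a' = x.1.2.2.rev := by
              rw [ha', hy]
              rfl
            have hb' : height ⟨n - 1, hn⟩ b' = x.1.1.2.rev := by
              rw [hb', hy]
              rfl
            rw [← hb, ← height_rev hk] at ha'
            rw [← ha, ← height_rev hk] at hb'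
            rw [height_injective _ ha', height_injective _ hb', Fin.rev_rev]
            exact hab.le)
          (fun l hl => by simp only at hl; omega)
        exact ⟨s, (congrArg _ hs).trans (Quot.sound hyx)⟩

theorem IsIndex.invTilde_config (hI : IsIndex I) : invTilde (config I) = Nat.card (FreeIdx I) := by
  obtain ⟨c, hc, hf⟩ := hI.exists_isColumn
  exact invTilde_eq hc hf

theorem poincareSeries_SpF (n : ℕ) : RatCoh.poincareSeries (SpF n) =
    ∑ S ∈ SDC (2 * n), (PowerSeries.X ^ 2) ^ invTilde S := by
  ext p
  rw [RatCoh.poincareSeries, PowerSeries.coeff_mk, (finrank_ratCoh_SpF n p).2, map_sum,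
    ← Finset.sum_coe_sort, ← bijective_config.sum_comp, Nat.card_eq_fintype_card,
    Fintype.card_subtype, Finset.card_filter]
  refine Finset.sum_congr rfl fun I _ => ?_
  rw [← pow_mul, PowerSeries.coeff_X_pow, I.2.invTilde_config]
  exact if_congr eq_comm rfl rfl

end SpFlag

theorem mainTheorem1 (n : ℕ) :
    (∀ I : Fin n → Finset (Fin (2 * n)), SpFlag.IsIndex I →
      SpFlag.config I ∈ Dellac.SDC (2 * n) ∧
      SpFlag.dim (SpFlag.cell I) = ((Dellac.invTilde (SpFlag.config I) : ℕ∞) : WithBot ℕ∞)) ∧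
    (∀ p : ℕ, Module.Finite ℚ (RatCoh.H (SpFlag.SpF n) p)) ∧
    RatCoh.poincareSeries (SpFlag.SpF n) =
      ∑ S ∈ Dellac.SDC (2 * n), (PowerSeries.X ^ 2) ^ Dellac.invTilde S := by
  refine ⟨fun I hI => ⟨hI.config_mem_SDC, ?_⟩, fun p => (SpFlag.finrank_ratCoh_SpF n p).1,
    SpFlag.poincareSeries_SpF n⟩
  rw [hI.dim_cell, hI.invTilde_config]
  rfl
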